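/- Let $X$ be a compact Kähler manifold of complex dimension $n$ with Kähler form $\omega=\omega_{i\bar j}\,dz^i\wedge d\bar z^j$ (so $\omega_{i\bar j}=\sqrt{-1}\,g_{i\bar j}$), let $(\omega^{\bar j i})$ be the inverse matrix, $\omega^{\bar k i}\omega_{i\bar j}=\delta^{\bar k}_{\bar j}$, and let $\nabla$ be the Levi-Civita connection, $\Gamma^p_{ij}=\omega^{\bar q p}\partial_i\omega_{j\bar q}$. Let $L$ be a pre-quantum line bundle on $X$: a holomorphic Hermitian line bundle whose Chern connection $\nabla$ has curvature $F_\nabla$ with $\omega=\sqrt{-1}F_\nabla$. Write $TX$ for the holomorphic tangent bundle, and $y^i,\bar y^j$ for the fibre generators $dz^i, d\bar z^j$ of $\widehat{\mathrm{Sym}}\,T^*X\otimes \mathrm{Sym}\,\overline{T^*X}[\hbar]$. For $k\ge 1$ the level $k$ Bargmann--Fock action $\circledast_k$ of $\widehat{\mathrm{Sym}}\,T^*X\otimes\mathrm{Sym}\,\overline{T^*X}[\hbar]$ on $\mathcal F_k=\widehat{\mathrm{Sym}}\,T^*X\otimes L^{\otimes k}$ is $$\hbar^r y^{i_1}\cdots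 y^{i_a}\bar y^{j_1}\cdots\bar y^{j_b}\mapsto\Big(\tfrac{\sqrt{-1}}{k}\Big)^{b+r}\omega^{\bar j_1p_1}\cdots\omega^{\bar j_bp_b}\frac{\partial^b}{\partial y^{p_1}\cdots\partial y^{p_b}}\circ m_{y^{i_1}\cdots y^{i_a}},$$ where $m$ denotes multiplication. The symbol $\sigma$ sets all $y^i=0$. Let $D_{BF,k}=\nabla+(\tfrac1\hbar\gamma_{BT})\circledast_k$ be the Fedosov connection on $\mathcal F_k$ (with $\hbar=\sqrt{-1}/k$), where $$\gamma_{BT}=-\omega_{i\bar j}\,dz^i\,\bar y^j+\omega_{i\bar j}\,d\bar z^j\,y^i+I+J .$$ Here $I=\sum_{r\ge2}R^p_{r,\bar l}\,\omega_{p\bar j}\,d\bar z^l\,\bar y^j$, where $R_2^*=\tfrac12(\partial_{\bar l}\Gamma^p_{ij})\,d\bar z^l\otimes y^iy^j\otimes\partial_{z^p}$ and $R_{r+1}^*=(\delta^{1,0})^{-1}\nabla^{1,0}R_r^*$, and $R^p_{r,\bar l}$ is the coefficient of $d\bar z^l\otimes\partial_{z^p}$ in $R_r^*$. The operator $(\delta^{1,0})^{-1}$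 sends $dz^i\otimes u$, with $u$ of degree $r$ in $y$, to $\tfrac1{r+1}y^iu$. Moreover $J=\hbar\sum_{r\ge1}J_r$, where $J_1=-(\partial_{\bar l}\Gamma^p_{pi})\,y^i\,d\bar z^l$ and $J_{r+1}=(\delta^{1,0})^{-1}\nabla^{1,0}J_r$. For every $k\ge1$, every holomorphic section $s\in H^0(X,L^{\otimes k})$ is the symbol of a unique smooth $D_{BF,k}$-flat section $O_s$ of $\mathcal F_k$. For a smooth section $\alpha$ of $\widehat{\mathrm{Sym}}\,T^*X\otimes\mathrm{Sym}\,\overline{T^*X}[\hbar]$ put $P_{\alpha,k}(s)=\sigma(\alpha\circledast_kO_s)$. For $G\in\Gamma(X,TX^{\otimes r})$ the higher covariant derivative $\nabla_G$ on sections of $L^{\otimes k}$ is additive in $G$ and defined recursively by $\nabla_Gs=G\cdot s$ if $r=0$, and $\nabla_{Y\otimes G'}s=\nabla_Y(\nabla_{G'}s)-\nabla_{\nabla_YG'}s$ for a vector field $Y$ of type $(1,0)$. **Proposition.** Let $m\ge l\ge0$ and let $\alpha$ be a smooth section of $\mathrm{Sym}^lT^*X\otimes\mathrm{Sym}^m\overline{T^*X}$.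 Then there is a smooth tensor field $G\in\Gamma(X,TX^{\otimes(m-l)})$, independent of $k$, such that for every $k\ge1$ and every $s\in H^0(X,L^{\otimes k})$ $$P_{\alpha,k}(s)=\Big(\frac{\sqrt{-1}}{k}\Big)^m\nabla_Gs .$$ -/

import Mathlib

open Bundle
open scoped Manifold ContDiff TensorProduct ComplexConjugate

noncomputable section

namespace BargmannFock

/-! ### Calculus in complex coordinates -/

/-- The model space `ℂⁿ`. -/
abbrev CSpace (n : ℕ) : Type := Fin n → ℂ

/-- The Wirtinger derivative `∂f/∂zⁱ`. -/
def dz {n : ℕ} (i : Fin n) (f : CSpace n → ℂ) (z : CSpace n) : ℂ :=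
  (fderiv ℝ f z (Pi.single i 1) - Complex.I * fderiv ℝ f z (Pi.single i Complex.I)) / 2

/-- The Wirtinger derivative `∂f/∂z̄ʲ`. -/
def dzbar {n : ℕ} (j : Fin n) (f : CSpace n → ℂ) (z : CSpace n) : ℂ :=
  (fderiv ℝ f z (Pi.single j 1) + Complex.I * fderiv ℝ f z (Pi.single j Complex.I)) / 2

/-- Coefficientwise `∂/∂zⁱ` of a family of power series in the fibre variables `y`. -/
def dzSeries {n : ℕ} (i : Fin n) (F : CSpace n → MvPowerSeries (Fin n) ℂ) (z : CSpace n) :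
    MvPowerSeries (Fin n) ℂ :=
  fun d => dz i (fun w => MvPowerSeries.coeff d (F w)) z

/-- Coefficientwise `∂/∂z̄ʲ` of a family of power series in the fibre variables `y`. -/
def dzbarSeries {n : ℕ} (j : Fin n) (F : CSpace n → MvPowerSeries (Fin n) ℂ) (z : CSpace n) :
    MvPowerSeries (Fin n) ℂ :=
  fun d => dzbar j (fun w => MvPowerSeries.coeff d (F w)) z

/-! ### The fibrewise algebra -/

/-- The fibre of the finite weight subbundle `Ŝym T*X ⊗ Sym T̄*X [ħ]`: polynomials in `ħ`
(the variable `none`) and in `ȳʲ` (the variable `some j`) whose coefficients are formal power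
series in the `yⁱ`. -/
abbrev FiniteWeight (n : ℕ) : Type :=
  MvPolynomial (Option (Fin n)) (MvPowerSeries (Fin n) ℂ)

/-- Formal power series in `y` with coefficients in `M`: the fibre of `Ŝym T*X ⊗ M`. -/
abbrev SeriesIn (n : ℕ) (M : Type*) : Type _ := (Fin n →₀ ℕ) → M

/-- Multiplication of an `M`-valued series by a scalar power series. -/
def seriesMul {n : ℕ} {M : Type*} [AddCommGroup M] [Module ℂ M]
    (f : MvPowerSeries (Fin n) ℂ) (F : SeriesIn n M) : SeriesIn n M :=
  fun d => ∑ p ∈ Finset.HasAntidiagonal.antidiagonal d, MvPowerSeries.coeff p.1 f • F p.2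

/-- The iterated derivative `∂^{|e|} / ∂y^e` of an `M`-valued series. -/
def seriesDeriv {n : ℕ} {M : Type*} [AddCommGroup M]
    (e : Fin n →₀ ℕ) (F : SeriesIn n M) : SeriesIn n M :=
  fun d => (∏ i, (d i + e i).descFactorial (e i)) • F (d + e)

/-- The value `√-1 / k` of `ħ` at level `k`. -/
def hbar (k : ℕ) : ℂ := Complex.I / k

/-- The symbol of the constant coefficient operator `∏_j (∑_p ω^{j̄p} ∂/∂yᵖ)^{a_j}` attached to
the monomial `∏_j (ȳʲ)^{a_j}`; here `B j p = ω^{j̄p}`. -/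
def wickSymbol {n : ℕ} (B : Matrix (Fin n) (Fin n) ℂ) (a : Option (Fin n) →₀ ℕ) :
    MvPolynomial (Fin n) ℂ :=
  ∏ j, (∑ p, MvPolynomial.C (B j p) * MvPolynomial.X p) ^ a (some j)

/-- The level `k` Bargmann--Fock action in Wick ordering: first multiply by the part in the `yⁱ`,
then let each `ȳʲ` act as `(√-1/k) ∑_p ω^{j̄p} ∂/∂yᵖ` and each `ħ` as `√-1/k`. -/
def bfAction {n : ℕ} {M : Type*} [AddCommGroup M] [Module ℂ M]
    (B : Matrix (Fin n) (Fin n) ℂ) (k : ℕ) (A : FiniteWeight n) (F : SeriesIn n M) :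
    SeriesIn n M :=
  ∑ a ∈ A.support, hbar k ^ a.degree •
    ∑ e ∈ (wickSymbol B a).support,
      (wickSymbol B a).coeff e • seriesDeriv e (seriesMul (A.coeff a) F)

/-- The Bargmann--Fock action on scalar power series. -/
def bfActionScalar {n : ℕ} (B : Matrix (Fin n) (Fin n) ℂ) (k : ℕ) (A : FiniteWeight n)
    (F : MvPowerSeries (Fin n) ℂ) : MvPowerSeries (Fin n) ℂ :=
  bfAction (M := ℂ) B k A F

/-- The linear forms `yⁱ = ∑_j A i j ηʲ`. -/
def linearForms {n : ℕ} (A : Matrix (Fin n) (Fin n) ℂ) (i : Fin n) : MvPowerSeries (Fin n) ℂ :=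
  ∑ j, MvPowerSeries.C (A i j) * MvPowerSeries.X j

theorem hasSubst_linearForms {n : ℕ} (A : Matrix (Fin n) (Fin n) ℂ) :
    MvPowerSeries.HasSubst (linearForms A) :=
  MvPowerSeries.hasSubst_of_constantCoeff_zero fun i => by simp [linearForms]

/-- The linear change of variables `yⁱ = ∑_j A i j ηʲ` on power series. -/
def changeSeries {n : ℕ} (A : Matrix (Fin n) (Fin n) ℂ) :
    MvPowerSeries (Fin n) ℂ →ₐ[ℂ] MvPowerSeries (Fin n) ℂ :=
  MvPowerSeries.substAlgHom (hasSubst_linearForms A)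

/-- The induced change of variables on the finite weight algebra: `yⁱ = ∑_j A i j ηʲ`,
`ȳⁱ = ∑_j conj (A i j) η̄ʲ`, and `ħ` is fixed. -/
def changeFiniteWeight {n : ℕ} (A : Matrix (Fin n) (Fin n) ℂ) :
    FiniteWeight n →+* FiniteWeight n :=
  MvPolynomial.eval₂Hom (MvPolynomial.C.comp (changeSeries A).toRingHom) fun o =>
    o.elim (MvPolynomial.X none) fun i =>
      ∑ j, MvPolynomial.C (MvPowerSeries.C (conj (A i j))) * MvPolynomial.X (some j)

/-- The summand `Sym^l T*X ⊗ Sym^m T̄*X` of the finite weight algebra: degree `0` in `ħ`, degree `m`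
in the `ȳʲ`, degree `l` in the `yⁱ`. -/
def IsBihomogeneous {n : ℕ} (l m : ℕ) (A : FiniteWeight n) : Prop :=
  ∀ (a : Option (Fin n) →₀ ℕ) (d : Fin n →₀ ℕ), MvPowerSeries.coeff d (A.coeff a) ≠ 0 →
    a none = 0 ∧ a.degree = m ∧ d.degree = l

/-! ### The Kähler manifold and the pre-quantum line bundle

The fibre of `T^{1,0}X` at `x` is `TangentSpace 𝓘(ℂ, CSpace n) x`; its vectors are written in the
coordinates of the preferred chart at `x`, and `yⁱ` denotes the `i`-th coordinate function on it. -/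

section Geometry

variable {n : ℕ} {X : Type*} [TopologicalSpace X] [ChartedSpace (CSpace n) X]

/-- The coordinate vector field `∂/∂zⁱ` of the chart `φ`, at the point with coordinates `z`. -/
def coordVec (φ : OpenPartialHomeomorph X (CSpace n)) (z : CSpace n) (i : Fin n) :
    TangentSpace 𝓘(ℂ, CSpace n) (φ.symm z) :=
  mfderiv 𝓘(ℂ, CSpace n) 𝓘(ℂ, CSpace n) φ.symm z (Pi.single i 1 : CSpace n)

/-- The matrix with entry `(i, j)` the `i`-th coordinate of `∂/∂zʲ` in the fibre at `φ.symm z`. -/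
def frameMatrix (φ : OpenPartialHomeomorph X (CSpace n)) (z : CSpace n) :
    Matrix (Fin n) (Fin n) ℂ :=
  fun i j => (show CSpace n from coordVec φ z j) i

variable (n X) in
/-- A Kähler metric: a smooth Hermitian metric on `T^{1,0}X`, with matrix
`g_{ij̄} = g(∂_i, ∂_j)` in each chart, whose form `ω = √-1 ∑ g_{ij̄} dzⁱ ∧ dz̄ʲ` is closed. -/
structure KahlerMetric where
  /-- the Hermitian inner product, conjugate linear in the first variable -/
  inner : ∀ x : X, TangentSpace 𝓘(ℂ, CSpace n) x →ₗ⋆[ℂ] TangentSpace 𝓘(ℂ, CSpace n) x →ₗ[ℂ] ℂ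
  conj_symm : ∀ x v w, conj (inner x v w) = inner x w v
  pos : ∀ x v, v ≠ 0 → 0 < (inner x v v).re
  smooth : ∀ φ ∈ atlas (CSpace n) X, ∀ i j : Fin n,
    ContDiffOn ℝ ∞ (fun z => inner (φ.symm z) (coordVec φ z j) (coordVec φ z i)) φ.target
  closed : ∀ φ ∈ atlas (CSpace n) X, ∀ i k j : Fin n, ∀ z ∈ φ.target,
    dz k (fun w => inner (φ.symm w) (coordVec φ w j) (coordVec φ w i)) z =
      dz i (fun w => inner (φ.symm w) (coordVec φ w j) (coordVec φ w k)) z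

/-- The matrix `ω_{ij̄} = √-1 g(∂_i, ∂_j)` of the Kähler form in the chart `φ`. -/
def omega (g : KahlerMetric n X) (φ : OpenPartialHomeomorph X (CSpace n)) (z : CSpace n) :
    Matrix (Fin n) (Fin n) ℂ :=
  fun i j => Complex.I * g.inner (φ.symm z) (coordVec φ z j) (coordVec φ z i)

/-- The inverse matrix, with entry `(k, i)` equal to `ω^{k̄i}`: `∑_i ω^{k̄i} ω_{ij̄} = δ_{kj}`. -/
def omegaInv (g : KahlerMetric n X) (φ : OpenPartialHomeomorph X (CSpace n)) (z : CSpace n) :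
    Matrix (Fin n) (Fin n) ℂ :=
  (omega g φ z)⁻¹

/-- The matrix `ω^{k̄i}` at the point `x`, in the standard coordinates of the fibre at `x`. -/
def omegaInvAt (g : KahlerMetric n X) (x : X) : Matrix (Fin n) (Fin n) ℂ :=
  (Matrix.of fun i j => Complex.I *
    g.inner x (Pi.single j 1 : CSpace n) (Pi.single i 1 : CSpace n))⁻¹

/-- The Christoffel symbol `Γᵖ_{ij} = ∑_q ω^{q̄p} ∂_i ω_{jq̄}` of the Levi-Civita connection. -/
def christoffel (g : KahlerMetric n X) (φ : OpenPartialHomeomorph X (CSpace n))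
    (p i j : Fin n) (z : CSpace n) : ℂ :=
  ∑ q, omegaInv g φ z q p * dz i (fun w => omega g φ w j q) z

variable (L : X → Type*) [TopologicalSpace (TotalSpace ℂ L)]
  [∀ x, AddCommGroup (L x)] [∀ x, Module ℂ (L x)] [∀ x, TopologicalSpace (L x)]
  [FiberBundle ℂ L] [VectorBundle ℂ ℂ L]

/-- The coordinates of the points of the chart `φ` over which the trivialization `e` is defined. -/
def domain {L : X → Type*} [TopologicalSpace (TotalSpace ℂ L)]
    (φ : OpenPartialHomeomorph X (CSpace n)) (e : Trivialization ℂ (π ℂ L)) : Set (CSpace n) :=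
  φ.target ∩ φ.symm ⁻¹' e.baseSet

variable (n) in
/-- A smooth Hermitian metric on the holomorphic line bundle `L`. -/
structure LineMetric where
  /-- the Hermitian inner product, conjugate linear in the first variable -/
  inner : ∀ x : X, L x →ₗ⋆[ℂ] L x →ₗ[ℂ] ℂ
  conj_symm : ∀ x v w, conj (inner x v w) = inner x w v
  pos : ∀ x v, v ≠ 0 → 0 < (inner x v v).re
  smooth : ∀ φ ∈ atlas (CSpace n) X,
    ∀ (e : Trivialization ℂ (π ℂ L)) [MemTrivializationAtlas e],
      ContDiffOn ℝ ∞ (fun z => (inner (φ.symm z) (e.symm (φ.symm z) 1) (e.symm (φ.symm z) 1)).re)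
        (domain φ e)

variable {L}

/-- The coefficients `θ_i = ∂_i log |σ|²` of the Chern connection of `L`, where `σ` is the
holomorphic frame of the trivialization `e`: `∇ σ = ∑ θ_i dzⁱ ⊗ σ`. -/
def chernForm (h : LineMetric n L) (φ : OpenPartialHomeomorph X (CSpace n))
    (e : Trivialization ℂ (π ℂ L)) (i : Fin n) (z : CSpace n) : ℂ :=
  dz i (fun w => ((Real.log
    (h.inner (φ.symm w) (e.symm (φ.symm w) 1) (e.symm (φ.symm w) 1)).re : ℝ) : ℂ)) z

/-- The pre-quantum condition `ω = √-1 F`, where `F = ∂̄ θ = ∑ (-∂_{j̄} θ_i) dzⁱ ∧ dz̄ʲ` is the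
curvature of the Chern connection. -/
def IsPrequantum (g : KahlerMetric n X) (h : LineMetric n L) : Prop :=
  ∀ φ ∈ atlas (CSpace n) X, ∀ (e : Trivialization ℂ (π ℂ L)) [MemTrivializationAtlas e],
    ∀ z ∈ domain φ e, ∀ i j : Fin n,
      omega g φ z i j = Complex.I * -dzbar j (chernForm h φ e i) z

/-! ### Sections -/

/-- The coordinate on `L_x^{⊗k}` in which the frame `σ^{⊗k}` of the trivialization `e` is `1`. -/
def powCoord (k : ℕ) (e : Trivialization ℂ (π ℂ L)) [e.IsLinear ℂ] (x : X) :
    (⨂[ℂ]^k (L x)) →ₗ[ℂ] ℂ :=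
  PiTensorProduct.lift ((MultilinearMap.mkPiAlgebra ℂ (Fin k) ℂ).compLinearMap
    fun _ => e.linearMapAt ℂ x)

/-- The local representative of a section of `L^{⊗k}`. -/
def localSection {k : ℕ} (s : ∀ x, ⨂[ℂ]^k (L x)) (φ : OpenPartialHomeomorph X (CSpace n))
    (e : Trivialization ℂ (π ℂ L)) [e.IsLinear ℂ] (z : CSpace n) : ℂ :=
  powCoord k e (φ.symm z) (s (φ.symm z))

variable (n) in
/-- `s ∈ H⁰(X, L^{⊗k})`: a smooth section with `∂̄ s = 0`. -/
def IsHolomorphicSection {k : ℕ} (s : ∀ x, ⨂[ℂ]^k (L x)) : Prop :=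
  ∀ φ ∈ atlas (CSpace n) X, ∀ (e : Trivialization ℂ (π ℂ L)) [MemTrivializationAtlas e],
    ContDiffOn ℝ ∞ (localSection s φ e) (domain φ e) ∧
      ∀ z ∈ domain φ e, ∀ j : Fin n, dzbar j (localSection s φ e) z = 0

/-- The components `G^{I_1 … I_r}` in the chart `φ` of a section of `TX^{⊗r}`. -/
def tensorComponents {r : ℕ} (G : ∀ x : X, ⨂[ℂ]^r (TangentSpace 𝓘(ℂ, CSpace n) x))
    (φ : OpenPartialHomeomorph X (CSpace n)) (z : CSpace n) (I : Fin r → Fin n) : ℂ :=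
  PiTensorProduct.lift ((MultilinearMap.mkPiAlgebra ℂ (Fin r) ℂ).compLinearMap
    fun a => (LinearMap.proj (I a) : CSpace n →ₗ[ℂ] ℂ) ∘ₗ
      (mfderiv 𝓘(ℂ, CSpace n) 𝓘(ℂ, CSpace n) φ (φ.symm z)).toLinearMap) (G (φ.symm z))

/-- `G ∈ Γ(X, TX^{⊗r})`: the components of `G` in every chart are smooth. -/
def IsSmoothTensor {r : ℕ} (G : ∀ x : X, ⨂[ℂ]^r (TangentSpace 𝓘(ℂ, CSpace n) x)) : Prop :=
  ∀ φ ∈ atlas (CSpace n) X, ∀ I : Fin r → Fin n,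
    ContDiffOn ℝ ∞ (fun z => tensorComponents G φ z I) φ.target

/-- The local representative of a section of the finite weight bundle, written in the fibre
coordinates of the chart `φ`. -/
def localWeyl (α : X → FiniteWeight n) (φ : OpenPartialHomeomorph X (CSpace n)) (z : CSpace n) :
    FiniteWeight n :=
  changeFiniteWeight (frameMatrix φ z) (α (φ.symm z))

/-- Smoothness of a section of the finite weight bundle. -/
def IsSmoothWeyl (α : X → FiniteWeight n) : Prop :=
  ∀ φ ∈ atlas (CSpace n) X, ∀ (a : Option (Fin n) →₀ ℕ) (d : Fin n →₀ ℕ),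
    ContDiffOn ℝ ∞ (fun z => MvPowerSeries.coeff d ((localWeyl α φ z).coeff a)) φ.target

/-- The local representative of a section of the Bargmann--Fock sheaf `Ŝym T*X ⊗ L^{⊗k}`. -/
def localFock {k : ℕ} (O : ∀ x, SeriesIn n (⨂[ℂ]^k (L x)))
    (φ : OpenPartialHomeomorph X (CSpace n)) (e : Trivialization ℂ (π ℂ L)) [e.IsLinear ℂ]
    (z : CSpace n) : MvPowerSeries (Fin n) ℂ :=
  changeSeries (frameMatrix φ z) fun d => powCoord k e (φ.symm z) (O (φ.symm z) d)

/-- The symbol map of the Bargmann--Fock sheaf: set all `yⁱ` to zero. -/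
def symbol {k : ℕ} (O : ∀ x, SeriesIn n (⨂[ℂ]^k (L x))) (x : X) : ⨂[ℂ]^k (L x) := O x 0

/-! ### The Fedosov connection on the Bargmann--Fock sheaf -/

/-- The covariant derivative `∇_{∂_i}` on power series in `y`, with `∇_{∂_i} yᵖ = -∑ Γᵖ_{ij} yʲ`. -/
def nablaSeries (g : KahlerMetric n X) (φ : OpenPartialHomeomorph X (CSpace n)) (i : Fin n)
    (F : CSpace n → MvPowerSeries (Fin n) ℂ) (z : CSpace n) : MvPowerSeries (Fin n) ℂ :=
  dzSeries i F z - ∑ p, ∑ j, MvPowerSeries.C (christoffel g φ p i j z) *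
    (MvPowerSeries.X j * MvPowerSeries.pderiv ℂ p (F z))

/-- The component `(p, l̄)` of `R_m^*`, where `R_m^* = 0` for `m < 2`,
`R_2^* = ½ ∑ (∂_{l̄} Γᵖ_{ij}) dz̄ˡ ⊗ yⁱ yʲ ⊗ ∂_p`, and `R_{m+1}^* = (δ^{1,0})⁻¹ ∇^{1,0} R_m^*`. -/
def curvatureTerm (g : KahlerMetric n X) (φ : OpenPartialHomeomorph X (CSpace n)) (l : Fin n) :
    ℕ → Fin n → CSpace n → MvPowerSeries (Fin n) ℂ
  | 0 => fun _ _ => 0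
  | 1 => fun _ _ => 0
  | 2 => fun p z => ∑ i, ∑ j, MvPowerSeries.C ((1 / 2 : ℂ) * dzbar l (christoffel g φ p i j) z) *
      (MvPowerSeries.X i * MvPowerSeries.X j)
  | m + 3 => fun p z => MvPowerSeries.C (1 / ((m : ℂ) + 3)) *
      ∑ i, MvPowerSeries.X i * (nablaSeries g φ i (curvatureTerm g φ l (m + 2) p) z +
        ∑ q, MvPowerSeries.C (christoffel g φ p i q z) * curvatureTerm g φ l (m + 2) q z)

/-- The coefficient of `dz̄ˡ ⊗ ∂_p` in `∑_{m ≥ 2} R_m^*`; the `m`-th term is homogeneous of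
degree `m` in `y`. -/
def curvatureSum (g : KahlerMetric n X) (φ : OpenPartialHomeomorph X (CSpace n)) (l p : Fin n)
    (z : CSpace n) : MvPowerSeries (Fin n) ℂ :=
  fun d => MvPowerSeries.coeff d (curvatureTerm g φ l d.degree p z)

/-- The coefficient of `dz̄ˡ` in the degree `m` part of `J / ħ`. With the form
`Ric = ∑ ρ_{il̄} dzⁱ ∧ dz̄ˡ`, `ρ_{il̄} = ∑_p ∂_{l̄} Γᵖ_{pi}`, written locally as `∂̄∂ f`, this is
`((δ^{1,0})⁻¹ ∇^{1,0})^m (∂̄ f)`; for `m = 1` it equals `-∑_i ρ_{il̄} yⁱ`. -/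
def ricciTerm (g : KahlerMetric n X) (φ : OpenPartialHomeomorph X (CSpace n)) (l : Fin n) :
    ℕ → CSpace n → MvPowerSeries (Fin n) ℂ
  | 0 => fun _ => 0
  | 1 => fun z => -∑ i, MvPowerSeries.C (∑ p, dzbar l (christoffel g φ p p i) z) *
      MvPowerSeries.X i
  | m + 2 => fun z => MvPowerSeries.C (1 / ((m : ℂ) + 2)) *
      ∑ i, MvPowerSeries.X i * nablaSeries g φ i (ricciTerm g φ l (m + 1)) z

/-- The coefficient of `dz̄ˡ` in `J / ħ`; the `m`-th term is homogeneous of degree `m`. -/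
def ricciSum (g : KahlerMetric n X) (φ : OpenPartialHomeomorph X (CSpace n)) (l : Fin n)
    (z : CSpace n) : MvPowerSeries (Fin n) ℂ :=
  fun d => MvPowerSeries.coeff d (ricciTerm g φ l d.degree z)

/-- The coefficient `-∑_j ω_{ij̄} ȳʲ` of `dzⁱ` in `γ_BT`. -/
def gammaHol (g : KahlerMetric n X) (φ : OpenPartialHomeomorph X (CSpace n)) (i : Fin n)
    (z : CSpace n) : FiniteWeight n :=
  -∑ j, MvPolynomial.C (MvPowerSeries.C (omega g φ z i j)) * MvPolynomial.X (some j)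

/-- The coefficient of `dz̄ˡ` in `γ_BT`: the sum of `∑_i ω_{il̄} yⁱ`, of
`I = ∑_{m ≥ 2} R_m^{*,p} ω_{pj̄} ȳʲ`, and of `J`. -/
def gammaAnti (g : KahlerMetric n X) (φ : OpenPartialHomeomorph X (CSpace n)) (l : Fin n)
    (z : CSpace n) : FiniteWeight n :=
  MvPolynomial.C (∑ i, MvPowerSeries.C (omega g φ z i l) * MvPowerSeries.X i) +
    ∑ j, MvPolynomial.C (∑ p, curvatureSum g φ l p z * MvPowerSeries.C (omega g φ z p j)) *
      MvPolynomial.X (some j) +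
    MvPolynomial.C (ricciSum g φ l z) * MvPolynomial.X none

/-- The `dzⁱ` component of `D_{BF,k} = ∇ + (γ_BT / ħ) ⊛_k` in a chart and a holomorphic frame. -/
def fedosovHol (g : KahlerMetric n X) (h : LineMetric n L) (k : ℕ)
    (φ : OpenPartialHomeomorph X (CSpace n)) (e : Trivialization ℂ (π ℂ L)) (i : Fin n)
    (F : CSpace n → MvPowerSeries (Fin n) ℂ) (z : CSpace n) : MvPowerSeries (Fin n) ℂ :=
  nablaSeries g φ i F z + MvPowerSeries.C (k * chernForm h φ e i z) * F z +
    (hbar k)⁻¹ • bfActionScalar (omegaInv g φ z) k (gammaHol g φ i z) (F z)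

/-- The `dz̄ˡ` component of `D_{BF,k} = ∇ + (γ_BT / ħ) ⊛_k` in a chart and a holomorphic frame. -/
def fedosovAnti (g : KahlerMetric n X) (k : ℕ)
    (φ : OpenPartialHomeomorph X (CSpace n)) (l : Fin n)
    (F : CSpace n → MvPowerSeries (Fin n) ℂ) (z : CSpace n) : MvPowerSeries (Fin n) ℂ :=
  dzbarSeries l F z +
    (hbar k)⁻¹ • bfActionScalar (omegaInv g φ z) k (gammaAnti g φ l z) (F z)

/-- `O` is a smooth section of the Bargmann--Fock sheaf with `D_{BF,k} O = 0`. -/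
def IsFlat (g : KahlerMetric n X) (h : LineMetric n L) {k : ℕ}
    (O : ∀ x, SeriesIn n (⨂[ℂ]^k (L x))) : Prop :=
  ∀ φ ∈ atlas (CSpace n) X, ∀ (e : Trivialization ℂ (π ℂ L)) [MemTrivializationAtlas e],
    (∀ d, ContDiffOn ℝ ∞ (fun z => MvPowerSeries.coeff d (localFock O φ e z)) (domain φ e)) ∧
    ∀ z ∈ domain φ e, ∀ i : Fin n,
      fedosovHol g h k φ e i (localFock O φ e) z = 0 ∧
      fedosovAnti g k φ i (localFock O φ e) z = 0

/-- The flat section `O_s` with symbol `s` (an arbitrary value if there is none). -/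
def flatLift (g : KahlerMetric n X) (h : LineMetric n L) {k : ℕ} (s : ∀ x, ⨂[ℂ]^k (L x)) :
    ∀ x, SeriesIn n (⨂[ℂ]^k (L x)) :=
  Classical.epsilon fun O => IsFlat g h O ∧ symbol O = s

/-- The operator `P_{α,k}(s) = σ(α ⊛_k O_s)`. -/
def bfOperator (g : KahlerMetric n X) (h : LineMetric n L) (k : ℕ) (α : X → FiniteWeight n)
    (s : ∀ x, ⨂[ℂ]^k (L x)) : ∀ x, ⨂[ℂ]^k (L x) :=
  symbol (n := n) fun x => bfAction (omegaInvAt g x) k (α x) (flatLift g h s x)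

/-! ### Higher covariant derivatives -/

/-- The components of `∇_{∂_i} G` for a tensor field `G` of type `TX^{⊗r}`. -/
def nablaTensor (g : KahlerMetric n X) (φ : OpenPartialHomeomorph X (CSpace n)) {r : ℕ} (i : Fin n)
    (G : CSpace n → (Fin r → Fin n) → ℂ) (z : CSpace n) (I : Fin r → Fin n) : ℂ :=
  dz i (fun w => G w I) z +
    ∑ a, ∑ q, christoffel g φ (I a) i q z * G z (Function.update I a q)

/-- The degree `r` covariant derivative `∇_G` on `L^{⊗k}` in a chart and a holomorphic frame:
`∇_G s = G s` for `r = 0`, and, writing `G = ∑_i ∂_i ⊗ G_i`,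
`∇_G s = ∑_i (∇_{∂_i} (∇_{G_i} s) - ∇_{∇_{∂_i} G_i} s)`. -/
def localCovDeriv (g : KahlerMetric n X) (h : LineMetric n L) (k : ℕ)
    (φ : OpenPartialHomeomorph X (CSpace n)) (e : Trivialization ℂ (π ℂ L)) :
    (r : ℕ) → (CSpace n → (Fin r → Fin n) → ℂ) → (CSpace n → ℂ) → CSpace n → ℂ
  | 0, G, s => fun z => G z Fin.elim0 * s z
  | r + 1, G, s => fun z => ∑ i,
      let Gi : CSpace n → (Fin r → Fin n) → ℂ := fun w I => G w (Fin.cons i I)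
      (dz i (localCovDeriv g h k φ e r Gi s) z +
          k * chernForm h φ e i z * localCovDeriv g h k φ e r Gi s z) -
        localCovDeriv g h k φ e r (nablaTensor g φ i Gi) s z

/-- The section `t` of `L^{⊗k}` is the higher covariant derivative `∇_G s`. -/
def IsHigherCovDeriv (g : KahlerMetric n X) (h : LineMetric n L) {k r : ℕ}
    (G : ∀ x : X, ⨂[ℂ]^r (TangentSpace 𝓘(ℂ, CSpace n) x)) (s t : ∀ x, ⨂[ℂ]^k (L x)) : Prop :=
  ∀ φ ∈ atlas (CSpace n) X, ∀ (e : Trivialization ℂ (π ℂ L)) [MemTrivializationAtlas e],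
    ∀ z ∈ domain φ e,
      localSection t φ e z =
        localCovDeriv g h k φ e r (tensorComponents G φ) (localSection s φ e) z

end Geometry

end BargmannFock

end

/-!
# Bargmann--Fock operators of bihomogeneous sections as higher covariant derivatives

Write `θ_i` for the Chern connection form of `L` in a holomorphic frame. In `γ_BT` the generator
`ȳʲ` acts as `ħ ω^{j̄p} ∂/∂yᵖ`, so the contraction of `ω_{ij̄}` with its inverse turns the `dzⁱ`
component of the Fedosov equation for a series `F` into `∂F/∂yⁱ = ∇_i F + k θ_i F`
(`fedosovHol_eq`). The `(1,0)` parts of the Levi-Civita and the Chern connection have no `(2,0)`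
curvature and the former is torsion-free, so `∇_i` commutes with `∇_j` and the equation is
integrable: it has exactly one solution with a given smooth symbol, namely the sum of the iterates
of `(δ^{1,0})⁻¹ ∇^{1,0}` (`FlatConnection.pderiv_parallel`, `FlatConnection.eq_zero_of_parallel`).

The `dz̄ˡ` component comes for free when the symbol is holomorphic. The curvature series `R`
satisfies `∂R/∂yⁱ = ∇_i R + (mixed curvature)`, its divergence is `-J / ħ`, and the prequantum
condition identifies `∂_l̄ (k θ_i)` with a multiple of `ω_{il̄}`, which is parallel. It follows
that the left side of the `dz̄ˡ` equation again solves the `dzⁱ` equations; its symbol is zero, so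
it vanishes (`FlatConnection.sum_pderiv_curvSum`, `FlatConnection.antiholomorphic_of_parallel`,
`IsParallelOn.fedosovAnti_eq_zero`). The `dzⁱ` equations are invariant under changes of chart and
of frame (`IsParallelOn.change`), and by uniqueness the local solutions glue to the flat section
`O_s` (`exists_isFlat`, `IsFlat.eq_of_symbol_eq`).

Applying `∂/∂yⁱ = ∇_i + k θ_i` repeatedly at `y = 0` shows that the `y`-derivatives of `O_s` of
order `r` are there the components of the `r`-th covariant derivative of `s`, whence `∇_G s` is the
pairing of `G` with them (`localCovDeriv_eq`). On the other hand, for `α` of bidegree `(l, m)`,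
the map `F ↦ σ(α ⊛ F)` is `(√-1/k)ᵐ` times a functional independent of `k`, and this functional
only sees the part of `F` of degree `m - l`, because `m` derivatives have to remove exactly the
`l` factors `y` of `α` and the factors of `F` (`constantCoeff_bfActionScalar`,
`wickFunctional_eq_zero`). By Taylor's formula the functional is the pairing with the tensor
`G = (1/r!) ∑_K σ(α ⊛ y^K) ∂_K`, where `r = m - l` and the power of `√-1/k` is left out
(`symbolTensor`, `wickFunctional_coordSeries`).

The identities over a coordinate domain `U` are proved for power series with coefficients in the
`ℂ`-algebra `SmoothFun U`, on which `∂/∂zⁱ` and `∂/∂z̄ⁱ` act as commuting derivations. Two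
additive maps on such series with the same Leibniz rule agree as soon as they agree on constants
and on the variables (`eq_of_leibniz`), so that most identities need to be checked on the
variables only.
-/

noncomputable section

namespace BargmannFock

/-! ### Derivations of formal power series -/

section PowerSeries

open MvPowerSeries

variable {n : ℕ} {Q R : Type*} [CommRing Q] [CommRing R]

theorem coeff_X_mul_eq (d : Fin n →₀ ℕ) (i : Fin n) (F : MvPowerSeries (Fin n) R) :
    coeff d (X i * F) = if d i = 0 then 0 else coeff (d - Finsupp.single i 1) F := by
  classical
  rw [X_def, coeff_monomial_mul, one_mul]
  have : Finsupp.single i 1 ≤ d ↔ d i ≠ 0 := by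
    rw [Finsupp.single_le_iff]; omega
  by_cases h : d i = 0 <;> simp [this, h]

theorem sub_single_add_single {d : Fin n →₀ ℕ} {i : Fin n} (h : d i ≠ 0) :
    d - Finsupp.single i 1 + Finsupp.single i 1 = d :=
  tsub_add_cancel_of_le (by rw [Finsupp.single_le_iff]; omega)

theorem degree_sub_single {d : Fin n →₀ ℕ} {i : Fin n} (h : d i ≠ 0) :
    (d - Finsupp.single i 1).degree + 1 = d.degree := by
  conv_rhs => rw [← sub_single_add_single h]
  simp [map_add]

theorem isUnit_natCast_of_algebra_complex [Algebra ℂ R] {m : ℕ} (hm : m ≠ 0) : IsUnit (m : R) := by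
  have := (isUnit_iff_ne_zero.2 (Nat.cast_ne_zero.2 hm : (m : ℂ) ≠ 0)).map (algebraMap ℂ R)
  simpa using this

theorem exists_eq_C_add_sum_X_mul [Algebra ℂ R] (F : MvPowerSeries (Fin n) R) :
    ∃ G : Fin n → MvPowerSeries (Fin n) R, F = C (constantCoeff F) + ∑ i, X i * G i := by
  -- the factor `(dᵢ + 1) / (|d| + 1)` distributes each monomial over the variables in it
  let G : Fin n → MvPowerSeries (Fin n) R := fun i d =>
    algebraMap ℂ R (((d i : ℂ) + 1) / (d.degree + 1)) * coeff (d + Finsupp.single i 1) F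
  have hG : ∀ i d, coeff d (G i) =
      algebraMap ℂ R (((d i : ℂ) + 1) / (d.degree + 1)) * coeff (d + Finsupp.single i 1) F :=
    fun _ _ => rfl
  refine ⟨G, ?_⟩
  ext d
  by_cases hd : d = 0
  · subst hd
    simp only [map_add, map_sum, coeff_X_mul_eq]
    simp
  · rw [map_add, coeff_C_of_ne_zero hd, zero_add, map_sum]
    have hdeg : (d.degree : ℂ) ≠ 0 := by
      exact_mod_cast (fun h => hd ((Finsupp.degree_eq_zero_iff d).1 h))
    have : ∀ i : Fin n, coeff d (X i * G i) = algebraMap ℂ R (d i / d.degree) * coeff d F := by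
      intro i
      rw [coeff_X_mul_eq]
      split_ifs with h
      · simp [h]
      · rw [hG, sub_single_add_single h]
        congr 3
        · have : (d - Finsupp.single i 1 : Fin n →₀ ℕ) i + 1 = d i := by
            simp only [Finsupp.tsub_apply, Finsupp.single_eq_same]; omega
          exact_mod_cast this
        · exact_mod_cast degree_sub_single h
    rw [Finset.sum_congr rfl fun i _ => this i, ← Finset.sum_mul, ← map_sum, ← Finset.sum_div]
    have : (∑ i, (d i : ℂ)) = d.degree := by
      rw [Finsupp.degree_eq_sum]; push_cast; rfl
    rw [this, div_self hdeg, map_one, one_mul]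

theorem coeff_mul_eq_zero_of_degree_lt {F G : MvPowerSeries (Fin n) R} {N : ℕ}
    (hF : constantCoeff F = 0) (hG : ∀ d : Fin n →₀ ℕ, d.degree < N → coeff d G = 0)
    (d : Fin n →₀ ℕ) (hd : d.degree < N + 1) : coeff d (F * G) = 0 := by
  classical
  rw [coeff_mul]
  refine Finset.sum_eq_zero fun p hp => ?_
  rw [Finset.HasAntidiagonal.mem_antidiagonal] at hp
  by_cases h0 : p.1 = 0
  · rw [h0, coeff_zero_eq_constantCoeff_apply, hF, zero_mul]
  · rw [hG, mul_zero]
    have h1 : p.1.degree ≠ 0 := fun h => h0 ((Finsupp.degree_eq_zero_iff _).1 h)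
    have h2 : p.1.degree + p.2.degree = d.degree := by rw [← hp, map_add]
    omega

/-- A derivation of power series rings over a ring homomorphism preserving the maximal ideal of the
variables is automatically continuous, so it is determined by constants and variables. -/
theorem eq_zero_of_leibniz [Algebra ℂ Q] (Φ : MvPowerSeries (Fin n) Q →+* MvPowerSeries (Fin n) R)
    (hΦ : ∀ i, constantCoeff (Φ (X i)) = 0)
    (D : MvPowerSeries (Fin n) Q → MvPowerSeries (Fin n) R)
    (hadd : ∀ a b, D (a + b) = D a + D b) (hmul : ∀ a b, D (a * b) = Φ a * D b + Φ b * D a)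
    (hC : ∀ q, D (C q) = 0) (hX : ∀ i, D (X i) = 0) (F : MvPowerSeries (Fin n) Q) : D F = 0 := by
  suffices H : ∀ N : ℕ, ∀ F, ∀ d : Fin n →₀ ℕ, d.degree < N → coeff d (D F) = 0 by
    ext d
    exact H _ F d (Nat.lt_succ_self _)
  intro N
  induction N with
  | zero => intro F d hd; omega
  | succ N ih =>
    intro F d hd
    obtain ⟨G, hG⟩ := exists_eq_C_add_sum_X_mul F
    let D' : MvPowerSeries (Fin n) Q →+ MvPowerSeries (Fin n) R := AddMonoidHom.mk' D hadd
    have hD : ∀ x, D x = D' x := fun _ => rfl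
    rw [hG, hadd, hC, zero_add, hD, map_sum, map_sum]
    refine Finset.sum_eq_zero fun i _ => ?_
    rw [← hD, hmul, hX, mul_zero, add_zero]
    exact coeff_mul_eq_zero_of_degree_lt (hΦ i) (fun e he => ih _ e he) d hd

theorem eq_of_leibniz [Algebra ℂ Q] (Φ : MvPowerSeries (Fin n) Q →+* MvPowerSeries (Fin n) R)
    (hΦ : ∀ i, constantCoeff (Φ (X i)) = 0)
    (D E : MvPowerSeries (Fin n) Q → MvPowerSeries (Fin n) R)
    (hadd : ∀ a b, D (a + b) = D a + D b) (hmul : ∀ a b, D (a * b) = Φ a * D b + Φ b * D a)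
    (hadd' : ∀ a b, E (a + b) = E a + E b) (hmul' : ∀ a b, E (a * b) = Φ a * E b + Φ b * E a)
    (hC : ∀ q, D (C q) = E (C q)) (hX : ∀ i, D (X i) = E (X i)) (F : MvPowerSeries (Fin n) Q) :
    D F = E F := by
  refine sub_eq_zero.1 (eq_zero_of_leibniz Φ hΦ (fun F => D F - E F) ?_ ?_ ?_ ?_ F)
  · intro a b; simp only [hadd, hadd']; ring
  · intro a b; simp only [hmul, hmul']; ring
  · intro q; simp [hC]
  · intro i; simp [hX]

/-- The two homomorphisms are not assumed continuous: mapping the variables into the maximal ideal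
is enough. -/
theorem ringHom_ext_of_constantCoeff [Algebra ℂ Q]
    (Φ Ψ : MvPowerSeries (Fin n) Q →+* MvPowerSeries (Fin n) R)
    (hΦ : ∀ i, constantCoeff (Φ (X i)) = 0)
    (hC : ∀ q, Φ (C q) = Ψ (C q)) (hX : ∀ i, Φ (X i) = Ψ (X i)) : Φ = Ψ := by
  suffices H : ∀ N : ℕ, ∀ F, ∀ d : Fin n →₀ ℕ, d.degree < N → coeff d (Φ F - Ψ F) = 0 by
    refine RingHom.ext fun F => sub_eq_zero.1 ?_
    ext d
    exact H _ F d (Nat.lt_succ_self _)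
  intro N
  induction N with
  | zero => intro F d hd; omega
  | succ N ih =>
    intro F d hd
    obtain ⟨G, hG⟩ := exists_eq_C_add_sum_X_mul F
    have : Φ F - Ψ F = ∑ i, Φ (X i) * (Φ (G i) - Ψ (G i)) := by
      conv_lhs => rw [hG]
      simp only [map_add, map_sum, map_mul, hC, ← hX, mul_sub, Finset.sum_sub_distrib]
      ring
    rw [this, map_sum]
    exact Finset.sum_eq_zero fun i _ =>
      coeff_mul_eq_zero_of_degree_lt (hΦ i) (fun e he => ih _ e he) d hd

/-- The coefficientwise extension of a derivation of `R` to power series over `R`. -/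
def coeffDeriv [Algebra ℂ R] (D : Derivation ℂ R R) :
    Derivation ℂ (MvPowerSeries (Fin n) R) (MvPowerSeries (Fin n) R) :=
  Derivation.mk'
    { toFun := fun F d => D (coeff d F)
      map_add' := fun F G => by funext d; simp [map_add]; rfl
      map_smul' := fun c F => by
        funext d
        exact D.map_smul c (coeff d F) }
    (fun F G => by
      classical
      ext d
      change D (coeff d (F * G)) = coeff d (F * (show MvPowerSeries (Fin n) R from
        fun d => D (coeff d G)) + G * (show MvPowerSeries (Fin n) R from fun d => D (coeff d F)))
      rw [map_add, coeff_mul, coeff_mul, coeff_mul, map_sum]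
      simp only [Derivation.leibniz, smul_eq_mul, Finset.sum_add_distrib]
      congr 1
      refine Finset.sum_equiv (Equiv.prodComm _ _) (fun p => ?_) fun p _ => rfl
      simp [Finset.HasAntidiagonal.mem_antidiagonal, add_comm])

@[simp] theorem coeff_coeffDeriv [Algebra ℂ R] (D : Derivation ℂ R R) (F : MvPowerSeries (Fin n) R)
    (d : Fin n →₀ ℕ) : coeff d (coeffDeriv D F) = D (coeff d F) := rfl

@[simp] theorem coeffDeriv_C [Algebra ℂ R] (D : Derivation ℂ R R) (r : R) :
    coeffDeriv D (C r : MvPowerSeries (Fin n) R) = C (D r) := by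
  classical
  ext d
  rw [coeff_coeffDeriv, coeff_C, coeff_C]
  split_ifs <;> simp

@[simp] theorem coeffDeriv_X [Algebra ℂ R] (D : Derivation ℂ R R) (i : Fin n) :
    coeffDeriv D (X i : MvPowerSeries (Fin n) R) = 0 := by
  classical
  ext d
  rw [coeff_coeffDeriv, coeff_X]
  split_ifs <;> simp

theorem coeffDeriv_pderiv [Algebra ℂ R] (D : Derivation ℂ R R) (i : Fin n)
    (F : MvPowerSeries (Fin n) R) :
    coeffDeriv D (pderiv R i F) = pderiv R i (coeffDeriv D F) := by
  ext d
  rw [coeff_coeffDeriv, coeff_pderiv, coeff_pderiv, coeff_coeffDeriv]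
  have : (((d i : ℕ) : R) + 1) = ((d i + 1 : ℕ) : R) := by push_cast; rfl
  rw [this, Derivation.leibniz, Derivation.map_natCast]
  simp [mul_comm]

theorem pderiv_comm (i j : Fin n) (F : MvPowerSeries (Fin n) R) :
    pderiv R i (pderiv R j F) = pderiv R j (pderiv R i F) := by
  ext d
  rcases eq_or_ne i j with rfl | h
  · rfl
  · simp only [coeff_pderiv, Finsupp.add_apply, Finsupp.single_eq_of_ne h,
      Finsupp.single_eq_of_ne h.symm]
    rw [add_right_comm, add_zero, add_zero]
    ring

theorem pderiv_C_mul (i : Fin n) (r : R) (F : MvPowerSeries (Fin n) R) :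
    pderiv R i (C r * F) = C r * pderiv R i F := by
  simp [Derivation.leibniz]

theorem pderiv_X_eq_ite (i j : Fin n) :
    pderiv R i (X j : MvPowerSeries (Fin n) R) = if i = j then 1 else 0 := by
  split_ifs with h
  · subst h; simp
  · exact pderiv_X_of_ne (Ne.symm h)

/-! ### Graded pieces of power series -/

/-- All coefficients of degree `r` of the power series `F` vanish. -/
def VanishesInDegree (r : ℕ) (F : MvPowerSeries (Fin n) R) : Prop :=
  ∀ d : Fin n →₀ ℕ, d.degree = r → coeff d F = 0

/-- The power series `F` is homogeneous of degree `r`. -/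
def HomogeneousOf (r : ℕ) (F : MvPowerSeries (Fin n) R) : Prop :=
  ∀ s, s ≠ r → VanishesInDegree s F

theorem eq_zero_of_vanishesInDegree {F : MvPowerSeries (Fin n) R}
    (h : ∀ r, VanishesInDegree r F) : F = 0 := by
  ext d
  exact h _ d rfl

theorem VanishesInDegree.zero (r : ℕ) : VanishesInDegree r (0 : MvPowerSeries (Fin n) R) :=
  fun _ _ => map_zero _

theorem VanishesInDegree.add {r : ℕ} {F G : MvPowerSeries (Fin n) R} (hF : VanishesInDegree r F)
    (hG : VanishesInDegree r G) : VanishesInDegree r (F + G) := fun d hd => by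
  rw [map_add, hF d hd, hG d hd, add_zero]

theorem VanishesInDegree.sub {r : ℕ} {F G : MvPowerSeries (Fin n) R} (hF : VanishesInDegree r F)
    (hG : VanishesInDegree r G) : VanishesInDegree r (F - G) := fun d hd => by
  rw [map_sub, hF d hd, hG d hd, sub_zero]

theorem VanishesInDegree.sum {ι : Type*} {r : ℕ} {s : Finset ι} {F : ι → MvPowerSeries (Fin n) R}
    (hF : ∀ i ∈ s, VanishesInDegree r (F i)) : VanishesInDegree r (∑ i ∈ s, F i) := fun d hd => by
  rw [map_sum]
  exact Finset.sum_eq_zero fun i hi => hF i hi d hd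

theorem VanishesInDegree.C_mul {r : ℕ} {F : MvPowerSeries (Fin n) R} (hF : VanishesInDegree r F)
    (a : R) : VanishesInDegree r (C a * F) := fun d hd => by
  rw [coeff_C_mul, hF d hd, mul_zero]

theorem VanishesInDegree.X_mul {r : ℕ} {F : MvPowerSeries (Fin n) R} (hF : VanishesInDegree r F)
    (i : Fin n) : VanishesInDegree (r + 1) (X i * F) := fun d hd => by
  rw [coeff_X_mul_eq]
  split_ifs with h
  · rfl
  · refine hF _ ?_
    have := degree_sub_single h
    omega

theorem vanishesInDegree_zero_X_mul (F : MvPowerSeries (Fin n) R) (i : Fin n) :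
    VanishesInDegree 0 (X i * F) := fun d hd => by
  rw [(Finsupp.degree_eq_zero_iff d).1 hd, coeff_zero_X_mul]

theorem VanishesInDegree.pderiv {r : ℕ} {F : MvPowerSeries (Fin n) R}
    (hF : VanishesInDegree (r + 1) F) (i : Fin n) :
    VanishesInDegree r (pderiv R i F) := fun d hd => by
  rw [coeff_pderiv, hF _ (by simp [map_add, hd]), zero_mul]

theorem VanishesInDegree.coeffDeriv [Algebra ℂ R] {r : ℕ} {F : MvPowerSeries (Fin n) R}
    (hF : VanishesInDegree r F) (D : Derivation ℂ R R) :
    VanishesInDegree r (coeffDeriv D F) := fun d hd => by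
  rw [coeff_coeffDeriv, hF d hd, map_zero]

theorem VanishesInDegree.X_mul_pderiv {r : ℕ} {F : MvPowerSeries (Fin n) R}
    (hF : VanishesInDegree r F) (i j : Fin n) :
    VanishesInDegree r (X i * MvPowerSeries.pderiv R j F) := by
  cases r with
  | zero => exact vanishesInDegree_zero_X_mul _ _
  | succ r => exact (hF.pderiv j).X_mul i

theorem vanishesInDegree_succ_of_pderiv [Algebra ℂ R] {r : ℕ} {F : MvPowerSeries (Fin n) R}
    (h : ∀ i, VanishesInDegree r (pderiv R i F)) : VanishesInDegree (r + 1) F := by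
  intro d hd
  have h0 : d ≠ 0 := by rintro rfl; simp at hd
  obtain ⟨i, hi⟩ := Finsupp.ne_iff.1 h0
  have hi' : d i ≠ 0 := hi
  have := h i (d - Finsupp.single i 1) (by have := degree_sub_single hi'; omega)
  rw [coeff_pderiv, sub_single_add_single hi'] at this
  have hu : IsUnit (((d - Finsupp.single i 1 : Fin n →₀ ℕ) i : R) + 1) := by
    have := isUnit_natCast_of_algebra_complex (R := R)
      (Nat.succ_ne_zero ((d - Finsupp.single i 1 : Fin n →₀ ℕ) i))
    simpa using this
  exact hu.mul_left_eq_zero.1 this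

theorem vanishesInDegree_zero_iff {F : MvPowerSeries (Fin n) R} :
    VanishesInDegree 0 F ↔ constantCoeff F = 0 := by
  refine ⟨fun h => h 0 (map_zero _), fun h d hd => ?_⟩
  rw [(Finsupp.degree_eq_zero_iff d).1 hd]
  exact h

theorem coeff_sum_X_mul_pderiv (d : Fin n →₀ ℕ) (F : MvPowerSeries (Fin n) R) :
    coeff d (∑ i, X i * pderiv R i F) = (d.degree : R) * coeff d F := by
  have key : ∀ i, coeff d (X i * pderiv R i F) = (d i : R) * coeff d F := by
    intro i
    rw [coeff_X_mul_eq]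
    split_ifs with h
    · simp [h]
    · rw [coeff_pderiv, sub_single_add_single h, mul_comm]
      congr 1
      have : (d - Finsupp.single i 1 : Fin n →₀ ℕ) i + 1 = d i := by
        simp only [Finsupp.tsub_apply, Finsupp.single_eq_same]; omega
      exact_mod_cast congrArg (Nat.cast (R := R)) this
  rw [map_sum, Finset.sum_congr rfl fun i _ => key i, ← Finset.sum_mul, Finsupp.degree_eq_sum,
    Nat.cast_sum]

/-- Euler's identity. -/
theorem HomogeneousOf.sum_X_mul_pderiv {r : ℕ} {F : MvPowerSeries (Fin n) R}
    (hF : HomogeneousOf r F) : ∑ i, X i * pderiv R i F = C (r : R) * F := by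
  ext d
  rw [coeff_sum_X_mul_pderiv, coeff_C_mul]
  by_cases hd : d.degree = r
  · rw [hd]
  · rw [hF _ hd d rfl]; simp

/-- The sum of a sequence of series, the `r`-th one homogeneous of degree `r`. -/
def gradedSum (T : ℕ → MvPowerSeries (Fin n) R) : MvPowerSeries (Fin n) R :=
  fun d => coeff d (T d.degree)

theorem vanishesInDegree_gradedSum_sub (T : ℕ → MvPowerSeries (Fin n) R) (r : ℕ) :
    VanishesInDegree r (gradedSum T - T r) := by
  rintro d rfl
  rw [map_sub]
  exact sub_self _

theorem homogeneousOf_C (r : R) : HomogeneousOf 0 (C r : MvPowerSeries (Fin n) R) :=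
  fun s hs d hd => coeff_C_of_ne_zero (by rintro rfl; simp at hd; omega) r

end PowerSeries

/-! ### Flat torsion-free connections of type `(1,0)` acting on power series -/

/-- The `(1,0)` part of a torsion-free connection without `(2,0)` curvature over a `ℂ`-algebra `R`
of functions with commuting derivations `∂_i`: the Christoffel symbols are `Γ p i j = Γᵖ_{ij}`. -/
structure FlatConnection (n : ℕ) (R : Type*) [CommRing R] [Algebra ℂ R] where
  /-- the derivation `∂_i` -/
  der : Fin n → Derivation ℂ R R
  der_comm : ∀ i j r, der i (der j r) = der j (der i r)
  /-- the Christoffel symbol `Γᵖ_{ij}` -/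
  Γ : Fin n → Fin n → Fin n → R
  symm : ∀ p i j, Γ p i j = Γ p j i
  flat : ∀ p i j c, der i (Γ p j c) + ∑ b, Γ p i b * Γ b j c =
    der j (Γ p i c) + ∑ b, Γ p j b * Γ b i c

namespace FlatConnection

open MvPowerSeries

variable {n : ℕ} {R : Type*} [CommRing R] [Algebra ℂ R] (D : FlatConnection n R)

/-- The covariant derivative `∇_{∂_i}` on power series in the fibre variables. -/
def nabla (i : Fin n) : Derivation ℂ (MvPowerSeries (Fin n) R) (MvPowerSeries (Fin n) R) :=
  coeffDeriv (D.der i) -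
    ∑ p, ∑ j, (C (D.Γ p i j) * X j) • (pderiv R p).restrictScalars ℂ

theorem nabla_apply (i : Fin n) (F : MvPowerSeries (Fin n) R) :
    D.nabla i F = coeffDeriv (D.der i) F -
      ∑ p, ∑ j, C (D.Γ p i j) * (X j * pderiv R p F) := by
  have hsum : ∀ E : Fin n → Derivation ℂ (MvPowerSeries (Fin n) R) (MvPowerSeries (Fin n) R),
      (∑ p, E p) F = ∑ p, E p F := fun E =>
    (congrFun (map_sum Derivation.coeFnAddMonoidHom E Finset.univ) F).trans (Finset.sum_apply _ _ _)
  simp [nabla, Derivation.sub_apply, hsum, mul_assoc]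

@[simp] theorem nabla_C (i : Fin n) (r : R) : D.nabla i (C r) = C (D.der i r) := by
  simp [nabla_apply]

@[simp] theorem nabla_X (i p : Fin n) : D.nabla i (X p) = -∑ j, C (D.Γ p i j) * X j := by
  simp only [nabla_apply, coeffDeriv_X, pderiv_X_eq_ite]
  simp

theorem nabla_C_mul (i : Fin n) (r : R) (F : MvPowerSeries (Fin n) R) :
    D.nabla i (C r * F) = C (D.der i r) * F + C r * D.nabla i F := by
  rw [Derivation.leibniz, nabla_C, smul_eq_mul, smul_eq_mul]
  ring

theorem _root_.BargmannFock.VanishesInDegree.nabla {r : ℕ} {F : MvPowerSeries (Fin n) R}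
    (hF : VanishesInDegree r F) (i : Fin n) : VanishesInDegree r (D.nabla i F) := by
  rw [nabla_apply]
  exact (hF.coeffDeriv _).sub <| VanishesInDegree.sum fun p _ => VanishesInDegree.sum fun j _ =>
    (hF.X_mul_pderiv j p).C_mul _

theorem constantCoeff_nabla (i : Fin n) (F : MvPowerSeries (Fin n) R) :
    constantCoeff (D.nabla i F) = D.der i (constantCoeff F) := by
  rw [nabla_apply, map_sub, map_sum]
  simp only [map_sum, map_mul, constantCoeff_X, zero_mul, mul_zero, Finset.sum_const_zero, sub_zero]
  rfl

/-- The absence of `(2,0)` curvature. Both sides differ by a derivation that kills constants, and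
`flat` is the vanishing of this derivation on the variables. -/
theorem nabla_comm (i j : Fin n) (F : MvPowerSeries (Fin n) R) :
    D.nabla i (D.nabla j F) = D.nabla j (D.nabla i F) := by
  refine sub_eq_zero.1 ?_
  refine eq_zero_of_leibniz (RingHom.id _) (fun _ => constantCoeff_X _)
    (fun F => D.nabla i (D.nabla j F) - D.nabla j (D.nabla i F)) ?_ ?_ ?_ ?_ F
  · intro a b
    simp only [map_add]
    ring
  · intro a b
    simp only [Derivation.leibniz, map_add, smul_eq_mul, RingHom.id_apply]
    ring
  · intro q
    simp [D.der_comm i j]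
  · intro p
    have key : ∀ i j, D.nabla i (D.nabla j (X p)) =
        -∑ c, C (D.der i (D.Γ p j c) - ∑ b, D.Γ p j b * D.Γ b i c) * X c := by
      intro i j
      simp only [nabla_X, map_neg, map_sum, nabla_C_mul, map_sub, sub_mul, Finset.sum_mul,
        Finset.sum_add_distrib, Finset.sum_sub_distrib, map_mul, mul_neg, Finset.mul_sum,
        Finset.sum_neg_distrib]
      rw [Finset.sum_comm (f := fun x b => C (D.Γ p j b) * C (D.Γ b i x) * X x)]
      simp only [mul_assoc, sub_eq_add_neg]
    rw [key, key, sub_eq_zero]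
    refine congrArg _ (Finset.sum_congr rfl fun c _ => ?_)
    have := D.flat p i j c
    congr 2
    linear_combination this

/-- The commutator of `∂/∂yᵃ` with `∇_i`: the vectors `∂/∂yᵃ` are differentiated by the Levi-Civita
connection as well. -/
theorem pderiv_nabla (a i : Fin n) (F : MvPowerSeries (Fin n) R) :
    pderiv R a (D.nabla i F) =
      D.nabla i (pderiv R a F) - ∑ q, C (D.Γ q i a) * pderiv R q F := by
  simp only [nabla_apply, map_sub, map_sum, ← coeffDeriv_pderiv, pderiv_C,
    Derivation.leibniz, smul_eq_mul, pderiv_X_eq_ite, mul_add, Finset.sum_add_distrib]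
  simp only [pderiv_comm a, Finset.sum_const_zero, mul_ite, mul_one, mul_zero,
    Finset.sum_ite_eq, Finset.mem_univ, if_true]
  ring

/-! ### Twisted connections -/

variable {ι : Type*} [Fintype ι] (M : Fin n → ι → ι → R)

/-- The connection `∇ + M` on tuples of power series, for a matrix valued form `M`. -/
def twist (i : Fin n) (T : ι → MvPowerSeries (Fin n) R) (a : ι) : MvPowerSeries (Fin n) R :=
  D.nabla i (T a) + ∑ b, C (M i a b) * T b

/-- The curvature of the form `M` has no `(2,0)` part. -/
def IsFlatForm : Prop := ∀ i j a c, D.der i (M j a c) + ∑ b, M i a b * M j b c =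
    D.der j (M i a c) + ∑ b, M j a b * M i b c

variable {M}

theorem twist_comm (hM : D.IsFlatForm M) (i j : Fin n) (T : ι → MvPowerSeries (Fin n) R) :
    D.twist M i (D.twist M j T) = D.twist M j (D.twist M i T) := by
  have key : ∀ i j a, D.twist M i (D.twist M j T) a = D.nabla i (D.nabla j (T a)) +
      (∑ b, C (M j a b) * D.nabla i (T b) + ∑ b, C (M i a b) * D.nabla j (T b)) +
      ∑ c, C (D.der i (M j a c) + ∑ b, M i a b * M j b c) * T c := by
    intro i j a
    simp only [twist, map_add, map_sum, nabla_C_mul, mul_add, add_mul, Finset.sum_mul, map_mul,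
      Finset.sum_add_distrib, Finset.mul_sum]
    rw [Finset.sum_comm (f := fun c b => C (M i a b) * C (M j b c) * T c)]
    simp only [mul_assoc]
    ring
  funext a
  rw [key, key, D.nabla_comm i j]
  simp only [hM i j]
  ring

variable (M)

theorem pderiv_twist (a i : Fin n) (T : ι → MvPowerSeries (Fin n) R) (x : ι) :
    pderiv R a (D.twist M i T x) =
      D.twist M i (fun x => pderiv R a (T x)) x - ∑ q, C (D.Γ q i a) * pderiv R q (T x) := by
  simp only [twist, map_add, pderiv_nabla, map_sum, pderiv_C_mul]
  ring

theorem _root_.BargmannFock.VanishesInDegree.twist {r : ℕ} {T : ι → MvPowerSeries (Fin n) R}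
    (hT : ∀ x, VanishesInDegree r (T x)) (i : Fin n) (x : ι) :
    VanishesInDegree r (D.twist M i T x) :=
  ((hT x).nabla D i).add <| VanishesInDegree.sum fun b _ => (hT b).C_mul _

/-- The operator `(δ^{1,0})⁻¹ ∇^{1,0}` on tuples of series homogeneous of degree `r`. -/
def raise (r : ℕ) (T : ι → MvPowerSeries (Fin n) R) (x : ι) : MvPowerSeries (Fin n) R :=
  C (algebraMap ℂ R (1 / (r + 1))) * ∑ i, X i * D.twist M i T x

theorem homogeneousOf_raise {r : ℕ} {T : ι → MvPowerSeries (Fin n) R}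
    (hT : ∀ x, HomogeneousOf r (T x)) (x : ι) : HomogeneousOf (r + 1) (D.raise M r T x) := by
  intro s hs
  refine VanishesInDegree.C_mul (VanishesInDegree.sum fun i _ => ?_) _
  cases s with
  | zero => exact vanishesInDegree_zero_X_mul _ _
  | succ s =>
    exact (VanishesInDegree.twist D M (fun x => hT x s (by omega)) i x).X_mul i

theorem C_algebraMap_inv_mul (r : ℕ) (F : MvPowerSeries (Fin n) R) :
    C (algebraMap ℂ R (1 / (r + 1))) * (F + C (r : R) * F) = F := by
  have h : (C (r : R) : MvPowerSeries (Fin n) R) = C (algebraMap ℂ R r) := by simp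
  have h2 : F + C (r : R) * F = C (algebraMap ℂ R (r + 1)) * F := by
    rw [h, map_add, map_add, map_one, map_one]; ring
  have h0 : (r : ℂ) + 1 ≠ 0 := by exact_mod_cast Nat.succ_ne_zero r
  rw [h2, ← mul_assoc, ← map_mul, ← map_mul, one_div, inv_mul_cancel₀ h0]
  simp

/-- If `∂_{yⁱ} ∇_j T` is symmetric in `i, j`, then `∂_{yⁱ}` of `(δ^{1,0})⁻¹ ∇^{1,0} T` is
`∇_i T`. -/
theorem pderiv_raise {r : ℕ} {T : ι → MvPowerSeries (Fin n) R}
    (hT : ∀ x, HomogeneousOf r (T x))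
    (hsym : ∀ i j x, pderiv R i (D.twist M j T x) = pderiv R j (D.twist M i T x))
    (i : Fin n) (x : ι) : pderiv R i (D.raise M r T x) = D.twist M i T x := by
  rw [raise, pderiv_C_mul, map_sum]
  simp only [Derivation.leibniz, smul_eq_mul, pderiv_X_eq_ite, Finset.sum_add_distrib, mul_ite,
    mul_one, mul_zero, Finset.sum_ite_eq, Finset.mem_univ, if_true]
  simp only [hsym i]
  have hh : HomogeneousOf r (D.twist M i T x) := fun s hs =>
    VanishesInDegree.twist D M (fun x => hT x s hs) i x
  rw [hh.sum_X_mul_pderiv, add_comm (C (r : R) * _), C_algebraMap_inv_mul]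

/-- The symmetry of `∂_{yⁱ} ∇_j T` propagates to any `T'` with `∂_{yⁱ} T' = ∇_i T`. -/
theorem pderiv_twist_symm (hM : D.IsFlatForm M) {T T' : ι → MvPowerSeries (Fin n) R}
    (h : ∀ i x, pderiv R i (T' x) = D.twist M i T x) (i j : Fin n) (x : ι) :
    pderiv R i (D.twist M j T' x) = pderiv R j (D.twist M i T' x) := by
  rw [pderiv_twist, pderiv_twist]
  simp only [h]
  rw [D.twist_comm hM]
  simp only [D.symm _ i j]

/-- A parallel series, that is one with `∂_{yⁱ} E = ∇_i E`, is determined by its symbol. -/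
theorem eq_zero_of_parallel {E : ι → MvPowerSeries (Fin n) R}
    (h : ∀ i x, pderiv R i (E x) = D.twist M i E x) (h0 : ∀ x, constantCoeff (E x) = 0) (x : ι) :
    E x = 0 := by
  refine eq_zero_of_vanishesInDegree fun r => ?_
  induction r generalizing x with
  | zero => exact vanishesInDegree_zero_iff.2 (h0 x)
  | succ r ih =>
    refine vanishesInDegree_succ_of_pderiv fun i => ?_
    rw [h]
    exact VanishesInDegree.twist D M ih i x

theorem twist_sub (i : Fin n) (T S : ι → MvPowerSeries (Fin n) R) (x : ι) :
    D.twist M i (fun x => T x - S x) x = D.twist M i T x - D.twist M i S x := by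
  simp only [twist, map_sub, mul_sub, Finset.sum_sub_distrib]
  ring

/-- A sequence of series with `∂_{yⁱ} T_{r+1} = ∇_i T_r + K_{i,r}` sums to a series with
`∂_{yⁱ} T = ∇_i T + K_i`. -/
theorem pderiv_gradedSum (T : ℕ → ι → MvPowerSeries (Fin n) R)
    (K : ℕ → Fin n → ι → MvPowerSeries (Fin n) R) (i : Fin n)
    (h : ∀ r x, VanishesInDegree r (pderiv R i (T (r + 1) x) - D.twist M i (T r) x - K r i x))
    (x : ι) :
    pderiv R i (gradedSum fun r => T r x) =
      D.twist M i (fun x => gradedSum fun r => T r x) x + gradedSum fun r => K r i x := by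
  refine sub_eq_zero.1 (eq_zero_of_vanishesInDegree fun r => ?_)
  have h1 := (vanishesInDegree_gradedSum_sub (fun r => T r x) (r + 1)).pderiv i
  have h2 := VanishesInDegree.twist D M
    (fun x => vanishesInDegree_gradedSum_sub (fun r => T r x) r) i x
  have h3 := vanishesInDegree_gradedSum_sub (fun r => K r i x) r
  rw [twist_sub] at h2
  rw [map_sub] at h1
  have := ((h1.sub h2).sub h3).add (h r x)
  convert this using 1
  ring

/-- The homogeneous parts of the parallel series with symbol `s`. -/
def parallelTerm (s : ι → R) : ℕ → ι → MvPowerSeries (Fin n) R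
  | 0 => fun x => C (s x)
  | r + 1 => D.raise M r (parallelTerm s r)

theorem parallelTerm_spec (hM : D.IsFlatForm M) (s : ι → R) (r : ℕ) :
    (∀ x, HomogeneousOf r (D.parallelTerm M s r x)) ∧
      ∀ i j x, pderiv R i (D.twist M j (D.parallelTerm M s r) x) =
        pderiv R j (D.twist M i (D.parallelTerm M s r) x) := by
  induction r with
  | zero =>
    refine ⟨fun x => homogeneousOf_C _, fun i j x => ?_⟩
    simp [parallelTerm, twist]
  | succ r ih =>
    exact ⟨D.homogeneousOf_raise M ih.1,
      D.pderiv_twist_symm M hM fun i x => D.pderiv_raise M ih.1 ih.2 i x⟩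

/-- The parallel series with symbol `s`. -/
def parallel (s : ι → R) (x : ι) : MvPowerSeries (Fin n) R :=
  gradedSum fun r => D.parallelTerm M s r x

theorem constantCoeff_parallel (s : ι → R) (x : ι) : constantCoeff (D.parallel M s x) = s x := by
  change coeff 0 (D.parallelTerm M s (Finsupp.degree (0 : Fin n →₀ ℕ)) x) = s x
  rw [map_zero]
  exact coeff_zero_C _

theorem pderiv_parallel (hM : D.IsFlatForm M) (s : ι → R) (i : Fin n) (x : ι) :
    pderiv R i (D.parallel M s x) = D.twist M i (D.parallel M s) x := by
  have h := D.pderiv_gradedSum M (D.parallelTerm M s) (fun _ _ _ => 0) i (fun r x => ?_) x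
  · have h0 : (gradedSum fun _ => (0 : MvPowerSeries (Fin n) R)) = 0 := rfl
    rw [h0, add_zero] at h
    exact h
  · have hs := D.parallelTerm_spec M hM s r
    rw [parallelTerm, D.pderiv_raise M hs.1 hs.2, sub_self, sub_zero]
    exact VanishesInDegree.zero r

end FlatConnection

/-! ### The curvature series and the antiholomorphic equation -/

namespace FlatConnection

open MvPowerSeries

variable {n : ℕ} {R : Type*} [CommRing R] [Algebra ℂ R] (D : FlatConnection n R)

/-- The connection form of the tangent bundle, with `∇_{∂_i} ∂_q = ∑_p Γᵖ_{iq} ∂_p`. -/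
def tangentForm (i p q : Fin n) : R := D.Γ p i q

theorem isFlatForm_tangentForm : D.IsFlatForm D.tangentForm := fun i j p c => D.flat p i j c

theorem sum_pderiv_twist_tangentForm (i : Fin n) (T : Fin n → MvPowerSeries (Fin n) R) :
    ∑ p, pderiv R p (D.twist D.tangentForm i T p) = D.nabla i (∑ p, pderiv R p (T p)) := by
  simp only [pderiv_twist]
  simp only [twist, tangentForm, map_sum, Finset.sum_sub_distrib, Finset.sum_add_distrib]
  rw [Finset.sum_comm (f := fun p q => C (D.Γ q i p) * pderiv R q (T p))]
  ring

variable (δ : Derivation ℂ R R)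

/-- The component `p` of `[∂̄, ∇_i]`: the linear form `∑_j (∂̄ Γᵖ_{ij}) yʲ`. -/
def mixedCurvature (i p : Fin n) : MvPowerSeries (Fin n) R := ∑ j, C (δ (D.Γ p i j)) * X j

theorem homogeneousOf_mixedCurvature (i p : Fin n) : HomogeneousOf 1 (D.mixedCurvature δ i p) := by
  intro s hs
  refine VanishesInDegree.sum fun j _ => VanishesInDegree.C_mul (fun d hd => ?_) _
  classical
  rw [coeff_X, if_neg]
  rintro rfl
  simp at hd
  omega

/-- The commutator of `δ` with `∇_i` is the mixed curvature. -/
theorem coeffDeriv_nabla (hδ : ∀ i r, δ (D.der i r) = D.der i (δ r)) (i : Fin n)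
    (F : MvPowerSeries (Fin n) R) : coeffDeriv δ (D.nabla i F) =
      D.nabla i (coeffDeriv δ F) - ∑ p, D.mixedCurvature δ i p * pderiv R p F := by
  have h : coeffDeriv δ (coeffDeriv (D.der i) F) = coeffDeriv (D.der i) (coeffDeriv δ F) := by
    ext d; exact hδ i _
  have h2 : ∀ p j, coeffDeriv δ (C (D.Γ p i j) * (X j * pderiv R p F)) =
      C (D.Γ p i j) * (X j * pderiv R p (coeffDeriv δ F)) +
        C (δ (D.Γ p i j)) * X j * pderiv R p F := by
    intro p j
    rw [Derivation.leibniz, Derivation.leibniz, coeffDeriv_C, coeffDeriv_X, coeffDeriv_pderiv]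
    simp only [smul_eq_mul]
    ring
  simp only [nabla_apply, map_sub, map_sum, h, h2, mixedCurvature, Finset.sum_add_distrib,
    Finset.sum_mul]
  rw [sub_sub]

/-- The Bianchi identity for the mixed curvature, obtained by applying `δ` to the absence of `(2,0)`
curvature. -/
theorem twist_mixedCurvature (hδ : ∀ i r, δ (D.der i r) = D.der i (δ r)) (i j p : Fin n) :
    D.twist D.tangentForm i (D.mixedCurvature δ j) p =
      D.twist D.tangentForm j (D.mixedCurvature δ i) p := by
  have key : ∀ i j, D.twist D.tangentForm i (D.mixedCurvature δ j) p =
      ∑ c, C (D.der i (δ (D.Γ p j c)) + ∑ b, D.Γ p i b * δ (D.Γ b j c) -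
        ∑ b, δ (D.Γ p j b) * D.Γ b i c) * X c := by
    intro i j
    simp only [twist, tangentForm, mixedCurvature, nabla_X, map_sum, nabla_C_mul, map_sub,
      map_add, sub_mul, add_mul, Finset.sum_mul, Finset.sum_add_distrib, Finset.sum_sub_distrib,
      map_mul, mul_neg, Finset.mul_sum, Finset.sum_neg_distrib]
    rw [Finset.sum_comm (f := fun x b => C (δ (D.Γ p j b)) * C (D.Γ b i x) * X x),
      Finset.sum_comm (f := fun x b => C (D.Γ p i b) * C (δ (D.Γ b j x)) * X x)]
    simp only [mul_assoc]
    ring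
  rw [key, key]
  refine Finset.sum_congr rfl fun c _ => ?_
  have := congrArg δ (D.flat p i j c)
  simp only [map_add, map_sum, Derivation.leibniz, smul_eq_mul, Finset.sum_add_distrib, hδ,
    mul_comm (D.Γ _ _ c)] at this
  congr 2
  linear_combination this

/-- The homogeneous parts of the series `∑_m R_m^*` of curvature terms. -/
def curvTerm : ℕ → Fin n → MvPowerSeries (Fin n) R
  | 0 => fun _ => 0
  | 1 => fun _ => 0
  | 2 => fun p => ∑ i, ∑ j, C (algebraMap ℂ R (1 / 2) * δ (D.Γ p i j)) * (X i * X j)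
  | m + 3 => D.raise D.tangentForm (m + 2) (curvTerm (m + 2))

theorem pderiv_curvTerm_two (i p : Fin n) :
    pderiv R i (D.curvTerm δ 2 p) = D.mixedCurvature δ i p := by
  simp only [curvTerm, mixedCurvature, map_sum, pderiv_C_mul]
  simp only [Derivation.leibniz, smul_eq_mul, pderiv_X_eq_ite, mul_add, Finset.sum_add_distrib,
    mul_ite, mul_one, mul_zero, Finset.sum_ite_eq, Finset.mem_univ, if_true]
  rw [Finset.sum_comm (f := fun a b => if i = a then
    C (algebraMap ℂ R (1 / 2) * δ (D.Γ p a b)) * X b else 0)]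
  simp only [Finset.sum_ite_eq, Finset.mem_univ, if_true, D.symm p _ i]
  rw [← Finset.sum_add_distrib]
  refine Finset.sum_congr rfl fun j _ => ?_
  rw [← add_mul, ← map_add, ← add_mul, ← map_add]
  norm_num

theorem homogeneousOf_curvTerm (r : ℕ) (p : Fin n) : HomogeneousOf r (D.curvTerm δ r p) := by
  induction r using Nat.strong_induction_on generalizing p with
  | _ r ih =>
    match r, ih with
    | 0, _ => exact fun s _ => VanishesInDegree.zero s
    | 1, _ => exact fun s _ => VanishesInDegree.zero s
    | 2, _ =>
      intro s hs
      cases s with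
      | zero =>
        exact VanishesInDegree.sum fun i _ => VanishesInDegree.sum fun j _ =>
          (vanishesInDegree_zero_X_mul _ _).C_mul _
      | succ s =>
        refine vanishesInDegree_succ_of_pderiv fun i => ?_
        rw [pderiv_curvTerm_two]
        exact D.homogeneousOf_mixedCurvature δ i p s (by omega)
    | m + 3, ih => exact D.homogeneousOf_raise _ (fun x => ih (m + 2) (by omega) x) p

/-- The integrability condition for the next homogeneous part of the curvature series. In degree two
it is the Bianchi identity `twist_mixedCurvature`. -/
theorem pderiv_twist_curvTerm (hδ : ∀ i r, δ (D.der i r) = D.der i (δ r)) (m : ℕ)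
    (i j p : Fin n) :
    pderiv R i (D.twist D.tangentForm j (D.curvTerm δ (m + 2)) p) =
      pderiv R j (D.twist D.tangentForm i (D.curvTerm δ (m + 2)) p) := by
  induction m generalizing i j p with
  | zero =>
    rw [pderiv_twist, pderiv_twist]
    have h : ∀ i, (fun p => pderiv R i (D.curvTerm δ (0 + 2) p)) = D.mixedCurvature δ i :=
      fun i => funext fun p => D.pderiv_curvTerm_two δ i p
    rw [h, h, D.twist_mixedCurvature δ hδ]
    simp only [D.symm _ i j]
  | succ m ih =>
    exact D.pderiv_twist_symm _ D.isFlatForm_tangentForm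
      (fun i p => D.pderiv_raise _ (D.homogeneousOf_curvTerm δ (m + 2)) ih i p) i j p

/-- The recursion for the curvature series says that `R_{m+3}` is a primitive of `∇ R_{m+2}`. -/
theorem pderiv_curvTerm (hδ : ∀ i r, δ (D.der i r) = D.der i (δ r)) (m : ℕ) (i p : Fin n) :
    pderiv R i (D.curvTerm δ (m + 3) p) = D.twist D.tangentForm i (D.curvTerm δ (m + 2)) p :=
  D.pderiv_raise _ (D.homogeneousOf_curvTerm δ (m + 2)) (D.pderiv_twist_curvTerm δ hδ m) i p

/-- The component `p` of the series `∑_m R_m^*`. -/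
def curvSum (p : Fin n) : MvPowerSeries (Fin n) R := gradedSum fun r => D.curvTerm δ r p

theorem pderiv_curvSum (hδ : ∀ i r, δ (D.der i r) = D.der i (δ r)) (i p : Fin n) :
    pderiv R i (D.curvSum δ p) =
      D.twist D.tangentForm i (D.curvSum δ) p + D.mixedCurvature δ i p := by
  have h := D.pderiv_gradedSum D.tangentForm (D.curvTerm δ)
    (fun r i p => if r = 1 then D.mixedCurvature δ i p else 0) i (fun r x => ?_) p
  · have hK : (gradedSum fun r => if r = 1 then D.mixedCurvature δ i p else 0) =
        D.mixedCurvature δ i p := by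
      ext d
      change coeff d (if d.degree = 1 then D.mixedCurvature δ i p else 0) = _
      split_ifs with hd
      · rfl
      · rw [D.homogeneousOf_mixedCurvature δ i p _ hd d rfl, map_zero]
    rw [hK] at h
    exact h
  · match r with
    | 0 => simpa [curvTerm, twist] using VanishesInDegree.zero 0
    | 1 =>
      rw [pderiv_curvTerm_two]
      simpa [curvTerm, twist] using VanishesInDegree.zero 1
    | m + 2 =>
      rw [D.pderiv_curvTerm δ hδ, sub_self, if_neg (by omega), sub_zero]
      exact VanishesInDegree.zero _

/-- The homogeneous parts of the coefficient of `J / ħ`. -/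
def ricTerm : ℕ → MvPowerSeries (Fin n) R
  | 0 => 0
  | 1 => -∑ i, C (∑ p, δ (D.Γ p p i)) * X i
  | m + 2 => C (algebraMap ℂ R (1 / (m + 2))) * ∑ i, X i * D.nabla i (ricTerm (m + 1))

/-- The divergence of the curvature series cancels the quantum correction `J / ħ`, degree by
degree. -/
theorem sum_pderiv_curvTerm (hδ : ∀ i r, δ (D.der i r) = D.der i (δ r)) (r : ℕ) :
    ∑ p, pderiv R p (D.curvTerm δ (r + 1) p) = -D.ricTerm δ r := by
  induction r with
  | zero => simp [curvTerm, ricTerm]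
  | succ r ih =>
    cases r with
    | zero =>
      change ∑ p, pderiv R p (D.curvTerm δ 2 p) = _
      simp only [pderiv_curvTerm_two, mixedCurvature, ricTerm, neg_neg, map_sum, Finset.sum_mul]
      exact Finset.sum_comm
    | succ m =>
      -- both sides of `(m + 3) div R_{m+3} = div R_{m+3} + ∑ yⁱ ∇_i div R_{m+2}`
      have h1 : ∑ p, pderiv R p (D.curvTerm δ (m + 3) p) =
          C (algebraMap ℂ R (1 / ((m + 2 : ℕ) + 1))) *
            (∑ p, pderiv R p (D.curvTerm δ (m + 3) p) +
              ∑ i, X i * D.nabla i (∑ p, pderiv R p (D.curvTerm δ (m + 2) p))) := by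
        conv_lhs =>
          simp only [curvTerm, raise, pderiv_C_mul, ← Finset.mul_sum]
        congr 1
        simp only [← D.sum_pderiv_twist_tangentForm, Finset.mul_sum]
        rw [Finset.sum_comm (f := fun i p => X i *
          pderiv R p (D.twist D.tangentForm i (D.curvTerm δ (m + 2)) p)), ← Finset.sum_add_distrib]
        refine Finset.sum_congr rfl fun p _ => ?_
        rw [map_sum, D.pderiv_curvTerm δ hδ]
        simp only [Derivation.leibniz, smul_eq_mul, pderiv_X_eq_ite, Finset.sum_add_distrib,
          mul_ite, mul_one, mul_zero, Finset.sum_ite_eq, Finset.mem_univ, if_true]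
        ring
      set A := ∑ p, pderiv R p (D.curvTerm δ (m + 3) p) with hA
      rw [ih] at h1
      simp only [map_neg, mul_neg, Finset.sum_neg_distrib] at h1
      change A = -(C (algebraMap ℂ R (1 / (m + 2))) * ∑ i, X i * D.nabla i (D.ricTerm δ (m + 1)))
      set B := ∑ i, X i * D.nabla i (D.ricTerm δ (m + 1)) with hB
      have hc : ∀ c d : ℂ, C (algebraMap ℂ R c) * (C (algebraMap ℂ R d) :
          MvPowerSeries (Fin n) R) = C (algebraMap ℂ R (c * d)) := by
        intro c d; rw [← map_mul, ← map_mul]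
      have hm3 : ((m + 2 : ℕ) : ℂ) + 1 ≠ 0 := Nat.cast_add_one_ne_zero _
      have hm2 : (m : ℂ) + 2 ≠ 0 := by exact_mod_cast (Nat.succ_ne_zero (m + 1))
      have h2 : C (algebraMap ℂ R ((m : ℂ) + 2)) * A = -B := by
        have h3 := congrArg (fun x => C (algebraMap ℂ R (((m + 2 : ℕ) : ℂ) + 1)) * x) h1
        simp only [← mul_assoc, hc, mul_one_div_cancel hm3, map_one, one_mul] at h3
        have h4 : (C (algebraMap ℂ R (((m + 2 : ℕ) : ℂ) + 1)) : MvPowerSeries (Fin n) R) =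
            C (algebraMap ℂ R ((m : ℂ) + 2)) + 1 := by
          rw [map_add, map_add, map_one, map_one]; push_cast; rfl
        rw [h4] at h3
        linear_combination h3
      have h5 := congrArg (fun x => C (algebraMap ℂ R (1 / ((m : ℂ) + 2))) * x) h2
      simp only [← mul_assoc, hc, one_div_mul_cancel hm2, map_one, one_mul] at h5
      rw [h5, mul_neg]

/-- The coefficient of `J / ħ`. -/
def ricSum : MvPowerSeries (Fin n) R := gradedSum fun r => D.ricTerm δ r

/-- The divergence produced by moving the derivatives of the Bargmann--Fock action past the
curvature series is cancelled by `J / ħ`. -/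
theorem sum_pderiv_curvSum (hδ : ∀ i r, δ (D.der i r) = D.der i (δ r)) :
    ∑ p, pderiv R p (D.curvSum δ p) = -D.ricSum δ := by
  refine sub_eq_zero.1 (eq_zero_of_vanishesInDegree fun r => ?_)
  have h1 : VanishesInDegree r (∑ p, pderiv R p (D.curvSum δ p - D.curvTerm δ (r + 1) p)) :=
    VanishesInDegree.sum fun p _ =>
      (vanishesInDegree_gradedSum_sub (fun r => D.curvTerm δ r p) (r + 1)).pderiv p
  have h2 := vanishesInDegree_gradedSum_sub (fun r => D.ricTerm δ r) r
  simp only [map_sub, Finset.sum_sub_distrib, D.sum_pderiv_curvTerm δ hδ] at h1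
  convert h1.add h2 using 1
  simp only [ricSum]
  ring

/-- A series parallel in the directions `∂_i` satisfies the antiholomorphic equation as soon as its
symbol does. -/
theorem antiholomorphic_of_parallel (hδ : ∀ i r, δ (D.der i r) = D.der i (δ r)) (κ : Fin n → R)
    (hw : ∀ i j, D.der i (δ (κ j)) = ∑ q, D.Γ q i j * δ (κ q)) {F : MvPowerSeries (Fin n) R}
    (hF : ∀ i, pderiv R i F = D.nabla i F + C (κ i) * F) (h0 : δ (constantCoeff F) = 0) :
    coeffDeriv δ F - (∑ i, C (δ (κ i)) * X i) * F + ∑ p, D.curvSum δ p * pderiv R p F = 0 := by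
  refine D.eq_zero_of_parallel (ι := Unit) (fun i _ _ => κ i) (E := fun _ => coeffDeriv δ F -
    (∑ i, C (δ (κ i)) * X i) * F + ∑ p, D.curvSum δ p * pderiv R p F) (fun i _ => ?_) (fun _ => ?_)
    ()
  · simp only [twist, Finset.univ_unique, Finset.sum_singleton]
    set W : MvPowerSeries (Fin n) R := ∑ i, C (δ (κ i)) * X i with hW
    -- each of the three summands fails to be parallel by an error term; the errors cancel:
    -- `h1` for `∂̄F` gives `∂̄κ_i F` minus the mixed curvature, `hW1` and `hW2` for `W F` give
    -- `∂̄κ_i F`, and `h3` for the curvature series gives the mixed curvature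
    have hW1 : pderiv R i W = C (δ (κ i)) := by
      simp [hW, map_sum, pderiv_X_eq_ite]
    have hW2 : D.nabla i W = 0 := by
      simp only [hW, map_sum, nabla_C_mul, nabla_X, hw, mul_neg, Finset.mul_sum, Finset.sum_mul,
        map_mul, Finset.sum_add_distrib, Finset.sum_neg_distrib]
      rw [Finset.sum_comm, add_neg_eq_zero]
      exact Finset.sum_congr rfl fun _ _ => Finset.sum_congr rfl fun _ _ => by ring
    have h1 : pderiv R i (coeffDeriv δ F) = D.nabla i (coeffDeriv δ F) -
        ∑ p, D.mixedCurvature δ i p * pderiv R p F + C (δ (κ i)) * F +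
          C (κ i) * coeffDeriv δ F := by
      rw [← coeffDeriv_pderiv, hF, map_add, D.coeffDeriv_nabla δ hδ, Derivation.leibniz,
        coeffDeriv_C, smul_eq_mul, smul_eq_mul]
      ring
    have h2 : ∀ p, pderiv R i (pderiv R p F) = D.nabla i (pderiv R p F) -
        ∑ q, C (D.Γ q i p) * pderiv R q F + C (κ i) * pderiv R p F := by
      intro p
      rw [pderiv_comm, hF, map_add, pderiv_nabla, pderiv_C_mul]
    have h3 : ∑ p, pderiv R i (D.curvSum δ p * pderiv R p F) =
        ∑ p, D.nabla i (D.curvSum δ p * pderiv R p F) +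
          C (κ i) * ∑ p, D.curvSum δ p * pderiv R p F +
          ∑ p, D.mixedCurvature δ i p * pderiv R p F := by
      simp only [Derivation.leibniz, smul_eq_mul, h2, D.pderiv_curvSum δ hδ, twist, tangentForm,
        mul_add, mul_sub, Finset.sum_add_distrib, Finset.sum_sub_distrib, Finset.mul_sum]
      rw [Finset.sum_comm (f := fun p q => D.curvSum δ p * (C (D.Γ q i p) * pderiv R q F))]
      have e1 : ∀ p q, pderiv R p F * (C (D.Γ p i q) * D.curvSum δ q) =
          D.curvSum δ q * (C (D.Γ p i q) * pderiv R p F) := fun p q => by ring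
      have e2 : ∀ p, C (κ i) * (D.curvSum δ p * pderiv R p F) =
          D.curvSum δ p * (C (κ i) * pderiv R p F) := fun p => by ring
      have e3 : ∀ p, pderiv R p F * D.mixedCurvature δ i p =
          D.mixedCurvature δ i p * pderiv R p F := fun p => by ring
      simp only [e1, e2, e3]
      ring
    rw [map_add, map_sub, h1, Derivation.leibniz, hW1, hF, map_sum, h3, map_add, map_sub,
      Derivation.leibniz (D.nabla i) W, hW2, map_sum]
    simp only [smul_eq_mul]
    ring
  · rw [map_add, map_sub, map_mul, map_sum, map_sum]
    have hc : ∀ p, constantCoeff (D.curvSum δ p) = 0 := fun p => by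
      change coeff 0 (D.curvTerm δ (Finsupp.degree (0 : Fin n →₀ ℕ)) p) = 0
      rw [map_zero]
      rfl
    have hd : constantCoeff (coeffDeriv δ F) = δ (constantCoeff F) := rfl
    simp [hc, hd, h0]

end FlatConnection

/-! ### The Levi-Civita connection of a Kähler form -/

namespace FlatConnection

open MvPowerSeries

variable {n : ℕ} {Q R : Type*} [CommRing Q] [Algebra ℂ Q] [CommRing R] [Algebra ℂ R]

/-- The form is parallel, `∂_i ω_{jq̄} = ∑_p Γᵖ_{ij} ω_{pq̄}`. -/
theorem der_eq_sum_christoffel (der : Fin n → Derivation ℂ R R) {W V : Matrix (Fin n) (Fin n) R}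
    (hV : V * W = 1) (i j q : Fin n) :
    der i (W j q) = ∑ p, (∑ q, V q p * der i (W j q)) * W p q := by
  have h : ∀ a, ∑ p, V a p * W p q = if a = q then 1 else 0 := fun a => by
    rw [← Matrix.mul_apply, hV, Matrix.one_apply]
  simp only [Finset.sum_mul]
  rw [Finset.sum_comm]
  have h2 : ∀ a p, V a p * der i (W j a) * W p q = der i (W j a) * (V a p * W p q) :=
    fun a p => by ring
  simp only [h2, ← Finset.mul_sum, h]
  simp

omit [Algebra ℂ R] in
theorem eq_of_sum_mul_eq {W V : Matrix (Fin n) (Fin n) R} (hV : W * V = 1) {x y : Fin n → R}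
    (h : ∀ q, ∑ p, x p * W p q = ∑ p, y p * W p q) : x = y := by
  have h1 : Matrix.vecMul x W = Matrix.vecMul y W := funext h
  have h2 := congrArg (fun v => Matrix.vecMul v V) h1
  simpa [Matrix.vecMul_vecMul, hV] using h2

/-- The Levi-Civita connection of the closed form with matrix `W`, whose inverse is `V`. -/
def ofKahler (der : Fin n → Derivation ℂ R R) (hder : ∀ i j r, der i (der j r) = der j (der i r))
    (W V : Matrix (Fin n) (Fin n) R) (hV : V * W = 1)
    (hclosed : ∀ i k j, der k (W i j) = der i (W k j)) : FlatConnection n R where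
  der := der
  der_comm := hder
  Γ p i j := ∑ q, V q p * der i (W j q)
  symm p i j := by simp only [hclosed j i]
  flat p i j c := by
    set Γ : Fin n → Fin n → Fin n → R := fun p i j => ∑ q, V q p * der i (W j q) with hΓ
    have hW : ∀ i j q, der i (W j q) = ∑ p, Γ p i j * W p q :=
      fun i j q => der_eq_sum_christoffel der hV i j q
    have key : ∀ i j q, der i (der j (W c q)) =
        ∑ p, (der i (Γ p j c) + ∑ b, Γ p i b * Γ b j c) * W p q := by
      intro i j q
      rw [hW j c q, map_sum]
      simp only [Derivation.leibniz, smul_eq_mul, hW i _ q, add_mul, Finset.sum_mul,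
        Finset.sum_add_distrib, Finset.mul_sum]
      rw [Finset.sum_comm (f := fun p b => Γ p i b * Γ b j c * W p q), add_comm]
      congr 1
      · exact Finset.sum_congr rfl fun _ _ => by ring
      · exact Finset.sum_congr rfl fun _ _ => Finset.sum_congr rfl fun _ _ => by ring
    refine congrFun (eq_of_sum_mul_eq (mul_eq_one_comm.1 hV) (x := fun p => der i (Γ p j c) +
      ∑ b, Γ p i b * Γ b j c) (y := fun p => der j (Γ p i c) + ∑ b, Γ p j b * Γ b i c)
      fun q => ?_) p
    rw [← key, ← key, hder]

/-! ### Change of coordinates -/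

variable (D : FlatConnection n Q) (D' : FlatConnection n R) (h : Q →+* R)
  (J : Matrix (Fin n) (Fin n) R)

/-- The transformation law of the Christoffel symbols under a holomorphic change of coordinates with
Jacobian matrix `J`. -/
def ChristoffelLaw : Prop := ∀ p i j, D'.der i (J p j) =
  ∑ q, J p q * D'.Γ q i j - ∑ a, ∑ b, J a i * h (D.Γ p a b) * J b j

/-- The Christoffel symbols obey their transformation law because they are determined by
`∂_i ω_{jq̄} = ∑_p Γᵖ_{ij} ω_{pq̄}`; the antiholomorphic factor `Jbar` is constant for `∂_i`. -/
theorem christoffelLaw_of_kahler {W : Matrix (Fin n) (Fin n) Q} {W' V' : Matrix (Fin n) (Fin n) R}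
    (hW : ∀ i j q, D.der i (W j q) = ∑ p, D.Γ p i j * W p q)
    (hW' : ∀ i j q, D'.der i (W' j q) = ∑ p, D'.Γ p i j * W' p q)
    (hV' : W' * V' = 1) (hJ : ∀ i q, D'.der i (h q) = ∑ a, J a i * h (D.der a q))
    (Jbar : Matrix (Fin n) (Fin n) R) (hJbar : ∀ i a b, D'.der i (Jbar a b) = 0)
    (hWW' : W' = J.transpose * (W.map h * Jbar)) : ChristoffelLaw D D' h J := by
  set Y := W.map h * Jbar with hY
  have hinv : Y * (V' * J.transpose) = 1 := by
    rw [hWW', Matrix.mul_assoc, mul_eq_one_comm, Matrix.mul_assoc] at hV'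
    exact hV'
  have hdY : ∀ i a q, D'.der i (Y a q) = ∑ c, ∑ e, J c i * h (D.Γ e c a) * Y e q := by
    intro i a q
    simp only [hY, Matrix.mul_apply, Matrix.map_apply, map_sum, Derivation.leibniz, smul_eq_mul,
      hJbar, mul_zero, zero_add, hJ, hW, map_mul, Finset.mul_sum]
    rw [Finset.sum_comm]
    refine Finset.sum_congr rfl fun c _ => ?_
    rw [Finset.sum_comm]
    exact Finset.sum_congr rfl fun _ _ => Finset.sum_congr rfl fun _ _ => by ring
  have hW'Y : ∀ j q, W' j q = ∑ a, J a j * Y a q := by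
    intro j q
    rw [hWW', Matrix.mul_apply]
    rfl
  intro p i j
  refine congrFun (eq_of_sum_mul_eq hinv (x := fun p => D'.der i (J p j)) (y := fun p =>
    ∑ q, J p q * D'.Γ q i j - ∑ a, ∑ b, J a i * h (D.Γ p a b) * J b j) fun q => ?_) p
  have h1 := hW' i j q
  rw [hW'Y, map_sum] at h1
  simp only [Derivation.leibniz, smul_eq_mul, Finset.sum_add_distrib, hdY, hW'Y] at h1
  have e1 : ∑ p, D'.der i (J p j) * Y p q = ∑ p, Y p q * D'.der i (J p j) :=
    Finset.sum_congr rfl fun _ _ => mul_comm _ _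
  have e2 : ∑ p, (∑ q, J p q * D'.Γ q i j) * Y p q =
      ∑ p, D'.Γ p i j * ∑ a, J a p * Y a q := by
    simp only [Finset.sum_mul, Finset.mul_sum]
    rw [Finset.sum_comm]
    exact Finset.sum_congr rfl fun _ _ => Finset.sum_congr rfl fun _ _ => by ring
  have e3 : ∑ p, (∑ a, ∑ b, J a i * h (D.Γ p a b) * J b j) * Y p q =
      ∑ b, J b j * ∑ a, ∑ p, J a i * h (D.Γ p a b) * Y p q := by
    simp only [Finset.sum_mul, Finset.mul_sum]
    rw [Finset.sum_comm, Finset.sum_congr rfl fun a _ => Finset.sum_comm, Finset.sum_comm]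
    exact Finset.sum_congr rfl fun _ _ => Finset.sum_congr rfl fun _ _ =>
      Finset.sum_congr rfl fun _ _ => by ring
  simp only [sub_mul, Finset.sum_sub_distrib]
  rw [e1, e2, e3]
  linear_combination h1

variable {D D' h J}

section Change

variable (Φ : MvPowerSeries (Fin n) Q →+* MvPowerSeries (Fin n) R)
  (hC : ∀ q, Φ (C q) = C (h q)) (hX : ∀ p, Φ (X p) = ∑ j, C (J p j) * X j)
include hC hX

omit [Algebra ℂ Q] [Algebra ℂ R] hC in
theorem constantCoeff_change_X (p : Fin n) : constantCoeff (Φ (X p)) = 0 := by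
  simp [hX]

omit [Algebra ℂ R] in
/-- The chain rule for a linear change `Φ` of the fibre variables. -/
theorem pderiv_change (i : Fin n) (F : MvPowerSeries (Fin n) Q) :
    pderiv R i (Φ F) = ∑ a, C (J a i) * Φ (pderiv Q a F) := by
  refine eq_of_leibniz Φ (constantCoeff_change_X Φ hX) (fun F => pderiv R i (Φ F))
    (fun F => ∑ a, C (J a i) * Φ (pderiv Q a F)) ?_ ?_ ?_ ?_ ?_ ?_ F
  · intro a b; simp
  · intro a b; simp
  · intro a b; simp [mul_add, Finset.sum_add_distrib]
  · intro a b
    simp only [Derivation.leibniz, smul_eq_mul, map_add, map_mul, mul_add, Finset.sum_add_distrib,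
      Finset.mul_sum]
    congr 1 <;> exact Finset.sum_congr rfl fun _ _ => by ring
  · intro q; simp [hC]
  · intro p
    simp [hX, pderiv_X_eq_ite, apply_ite Φ]

/-- The covariant derivative commutes with a change of coordinates. On the variables this is the
transformation law of the Christoffel symbols. -/
theorem nabla_change (hJ : ∀ i q, D'.der i (h q) = ∑ a, J a i * h (D.der a q))
    (hΓ : ChristoffelLaw D D' h J) (i : Fin n) (F : MvPowerSeries (Fin n) Q) :
    D'.nabla i (Φ F) = ∑ a, C (J a i) * Φ (D.nabla a F) := by
  refine eq_of_leibniz Φ (constantCoeff_change_X Φ hX) (fun F => D'.nabla i (Φ F))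
    (fun F => ∑ a, C (J a i) * Φ (D.nabla a F)) ?_ ?_ ?_ ?_ ?_ ?_ F
  · intro a b; simp
  · intro a b; simp
  · intro a b; simp [mul_add, Finset.sum_add_distrib]
  · intro a b
    simp only [Derivation.leibniz, smul_eq_mul, map_add, map_mul, mul_add, Finset.sum_add_distrib,
      Finset.mul_sum]
    congr 1 <;> exact Finset.sum_congr rfl fun _ _ => by ring
  · intro q; simp [hC, hJ]
  · intro p
    have e1 : D'.nabla i (Φ (X p)) = ∑ j, C (D'.der i (J p j)) * X j -
        ∑ j, ∑ b, C (J p j) * (C (D'.Γ j i b) * X b) := by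
      simp only [hX, map_sum, nabla_C_mul, nabla_X, mul_neg, Finset.mul_sum,
        Finset.sum_add_distrib, Finset.sum_neg_distrib]
      ring
    have e2 : ∑ a, C (J a i) * Φ (D.nabla a (X p)) =
        -∑ a, ∑ b, ∑ j, C (J a i * h (D.Γ p a b) * J b j) * X j := by
      simp only [nabla_X, map_neg, map_sum, map_mul, hC, hX, mul_neg, Finset.mul_sum,
        Finset.sum_neg_distrib]
      refine congrArg _ (Finset.sum_congr rfl fun _ _ => Finset.sum_congr rfl fun _ _ =>
        Finset.sum_congr rfl fun _ _ => by ring)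
    have e3 : ∑ j, C (D'.der i (J p j)) * X j =
        ∑ j, ∑ b, C (J p j) * (C (D'.Γ j i b) * X b) -
          ∑ a, ∑ b, ∑ j, C (J a i * h (D.Γ p a b) * J b j) * X j := by
      rw [Finset.sum_comm, Finset.sum_congr rfl fun a _ => Finset.sum_comm,
        Finset.sum_comm (f := fun a j => ∑ b, C (J a i * h (D.Γ p a b) * J b j) * X j),
        ← Finset.sum_sub_distrib]
      refine Finset.sum_congr rfl fun j _ => ?_
      rw [hΓ p i, map_sub, sub_mul]
      simp only [map_sum, Finset.sum_mul]
      congr 1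
      exact Finset.sum_congr rfl fun _ _ => by rw [map_mul]; ring
    rw [e1, e2, e3]
    ring

/-- The equation `∂F/∂yⁱ = ∇_i F + κ_i F` is preserved by a change of coordinates followed by
multiplication with `c`, a change of frame. -/
theorem parallel_change (hJ : ∀ i q, D'.der i (h q) = ∑ a, J a i * h (D.der a q))
    (hΓ : ChristoffelLaw D D' h J) {κ : Fin n → Q} {κ' : Fin n → R} {c : R}
    (hc : ∀ i, D'.der i c + κ' i * c = c * ∑ a, J a i * h (κ a)) {F : MvPowerSeries (Fin n) Q}
    (hF : ∀ i, pderiv Q i F = D.nabla i F + C (κ i) * F) (i : Fin n) :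
    pderiv R i (C c * Φ F) = D'.nabla i (C c * Φ F) + C (κ' i) * (C c * Φ F) := by
  have hc' := congrArg (C (σ := Fin n)) (hc i)
  simp only [map_add, map_mul, map_sum] at hc'
  rw [pderiv_C_mul, nabla_C_mul, pderiv_change Φ hC hX, nabla_change Φ hC hX hJ hΓ]
  simp only [hF, map_add, map_mul, hC, mul_add, Finset.sum_add_distrib]
  have : ∑ a, C (J a i) * (C (h (κ a)) * Φ F) = (∑ a, C (J a i) * C (h (κ a))) * Φ F := by
    rw [Finset.sum_mul]
    exact Finset.sum_congr rfl fun _ _ => by ring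
  rw [this]
  linear_combination (-Φ F) * hc'

end Change

end FlatConnection

/-! ### Wirtinger calculus -/

section Wirtinger

open Topology

variable {n : ℕ}

/-- The complex directional derivative `(∂_v f + a ∂_w f) / 2`, of which the Wirtinger derivatives
are special cases. -/
def cdir (a : ℂ) (v w : CSpace n) (f : CSpace n → ℂ) (z : CSpace n) : ℂ :=
  (fderiv ℝ f z v + a * fderiv ℝ f z w) / 2

theorem dz_eq_cdir (i : Fin n) (f : CSpace n → ℂ) :
    dz i f = cdir (-Complex.I) (Pi.single i 1) (Pi.single i Complex.I) f := by
  funext z; simp [dz, cdir, sub_eq_add_neg]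

variable (a : ℂ) (v w : CSpace n) {f g : CSpace n → ℂ} {z : CSpace n}

theorem cdir_congr (h : f =ᶠ[𝓝 z] g) : cdir a v w f z = cdir a v w g z := by
  simp only [cdir, h.fderiv_eq]

theorem cdir_congr_of_eqOn {U : Set (CSpace n)} (hU : IsOpen U) (h : Set.EqOn f g U) (hz : z ∈ U) :
    cdir a v w f z = cdir a v w g z :=
  cdir_congr a v w (h.eventuallyEq_of_mem (hU.mem_nhds hz))

theorem cdir_add (hf : DifferentiableAt ℝ f z) (hg : DifferentiableAt ℝ g z) :
    cdir a v w (fun z => f z + g z) z = cdir a v w f z + cdir a v w g z := by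
  have h : fderiv ℝ (fun z => f z + g z) z = fderiv ℝ f z + fderiv ℝ g z := fderiv_fun_add hf hg
  simp only [cdir, h, add_apply]
  ring

theorem cdir_mul (hf : DifferentiableAt ℝ f z) (hg : DifferentiableAt ℝ g z) :
    cdir a v w (fun z => f z * g z) z = f z * cdir a v w g z + g z * cdir a v w f z := by
  have h : fderiv ℝ (fun z => f z * g z) z = f z • fderiv ℝ g z + g z • fderiv ℝ f z :=
    fderiv_fun_mul hf hg
  simp only [cdir, h, add_apply, smul_apply, smul_eq_mul]
  ring

theorem cdir_const (c : ℂ) : cdir a v w (fun _ => c) z = 0 := by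
  simp [cdir]

theorem ContDiffOn.cdir {U : Set (CSpace n)} (hU : IsOpen U) (hf : ContDiffOn ℝ ∞ f U) :
    ContDiffOn ℝ ∞ (cdir a v w f) U := by
  have h : ContDiffOn ℝ ∞ (fderiv ℝ f) U := hf.fderiv_of_isOpen hU (by simp)
  exact ((h.clm_apply contDiffOn_const).add
    (contDiffOn_const.mul (h.clm_apply contDiffOn_const))).div_const 2

theorem cdir_comm (b : ℂ) (v' w' : CSpace n) {U : Set (CSpace n)} (hU : IsOpen U)
    (hf : ContDiffOn ℝ ∞ f U) (hz : z ∈ U) :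
    cdir a v w (cdir b v' w' f) z = cdir b v' w' (cdir a v w f) z := by
  have hfz : ContDiffAt ℝ ∞ f z := hf.contDiffAt (hU.mem_nhds hz)
  have hsymm : IsSymmSndFDerivAt ℝ f z := hfz.isSymmSndFDerivAt (by
    rw [minSmoothness_of_isRCLikeNormedField]; exact ENat.LEInfty.out)
  have hd : DifferentiableAt ℝ (fderiv ℝ f) z :=
    (hfz.fderiv_right (m := 1) (by norm_cast)).differentiableAt (by simp)
  have key : ∀ (b : ℂ) (v' w' u : CSpace n), fderiv ℝ (cdir b v' w' f) z u =
      (fderiv ℝ (fderiv ℝ f) z u v' + b * fderiv ℝ (fderiv ℝ f) z u w') / 2 := by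
    intro b v' w' u
    have h1 : ∀ x : CSpace n, HasFDerivAt (fun z => fderiv ℝ f z x)
        ((fderiv ℝ (fderiv ℝ f) z).flip x) z := fun x => by
      have := hd.hasFDerivAt.clm_apply (hasFDerivAt_const x z)
      simpa using this
    have h2 := (((h1 v').add ((h1 w').const_mul b)).mul_const (2⁻¹ : ℂ)).fderiv
    have h3 : (cdir b v' w' f) = fun y => ((fun z => fderiv ℝ f z v') y +
        b * fderiv ℝ f y w') * (2⁻¹ : ℂ) := by
      funext y; simp [cdir, div_eq_mul_inv]
    rw [h3]
    erw [h2]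
    simp [mul_comm, div_eq_mul_inv, mul_add]
  rw [cdir, cdir, key, key, key, key, hsymm.eq v v', hsymm.eq v w', hsymm.eq w v', hsymm.eq w w']
  ring

end Wirtinger

/-! ### The algebra of smooth functions on an open set -/

section SmoothFun

open Topology TopologicalSpace

variable {n : ℕ} (U : Opens (CSpace n))

/-- The extension by zero of a function on `U`. -/
def extendZero (f : U → ℂ) : CSpace n → ℂ := Function.extend Subtype.val f 0

variable {U}

theorem extendZero_apply (f : U → ℂ) (u : U) : extendZero U f u = f u :=
  Subtype.val_injective.extend_apply _ _ _

theorem extendZero_eqOn {f : U → ℂ} {F : CSpace n → ℂ} (h : ∀ u : U, F u = f u) :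
    Set.EqOn (extendZero U f) F U := fun z hz =>
  (extendZero_apply f ⟨z, hz⟩).trans (h ⟨z, hz⟩).symm

variable (U)

/-- The `ℂ`-algebra of smooth complex functions on the open set `U`. -/
def smoothSubalgebra : Subalgebra ℂ (U → ℂ) where
  carrier := {f | ContDiffOn ℝ ∞ (extendZero U f) U}
  add_mem' {f g} hf hg := (ContDiffOn.add hf hg).congr (extendZero_eqOn fun u => by
    simp [extendZero_apply])
  mul_mem' {f g} hf hg := (ContDiffOn.mul hf hg).congr (extendZero_eqOn fun u => by
    simp [extendZero_apply])
  algebraMap_mem' c := (contDiffOn_const (c := c)).congr (extendZero_eqOn fun u => rfl)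

/-- Smooth complex functions on the open set `U`. -/
def SmoothFun : Type := smoothSubalgebra U

namespace SmoothFun

instance : CommRing (SmoothFun U) := inferInstanceAs (CommRing (smoothSubalgebra U))

instance : Algebra ℂ (SmoothFun U) := inferInstanceAs (Algebra ℂ (smoothSubalgebra U))

variable {U}

/-- The restriction to `U` of a function smooth on `U`. -/
def ofFun (F : CSpace n → ℂ) (hF : ContDiffOn ℝ ∞ F U) : SmoothFun U :=
  ⟨fun u => F u, hF.congr (extendZero_eqOn fun _ => rfl)⟩

/-- A smooth function on `U`, extended by zero. -/
def toFun (f : SmoothFun U) : CSpace n → ℂ := extendZero U f.1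

theorem contDiffOn_toFun (f : SmoothFun U) : ContDiffOn ℝ ∞ f.toFun U := f.2

/-- The evaluation at a point. -/
def ev (u : U) : SmoothFun U →+* ℂ :=
  (Pi.evalRingHom (fun _ => ℂ) u).comp (smoothSubalgebra U).subtype

theorem ev_algebraMap (u : U) (c : ℂ) : ev u (algebraMap ℂ _ c) = c := rfl

theorem ev_ofFun (F : CSpace n → ℂ) (hF : ContDiffOn ℝ ∞ F U) (u : U) : ev u (ofFun F hF) = F u :=
  rfl

theorem toFun_apply (f : SmoothFun U) (u : U) : f.toFun u = ev u f := extendZero_apply _ _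

@[ext] theorem ext {f g : SmoothFun U} (h : ∀ u, ev u f = ev u g) : f = g :=
  Subtype.ext (funext h)

theorem differentiableAt_toFun (f : SmoothFun U) (u : U) : DifferentiableAt ℝ f.toFun u :=
  ((contDiffOn_toFun f).contDiffAt (U.isOpen.mem_nhds u.2)).differentiableAt (by simp)

/-- A complex directional derivative as a derivation of the algebra of smooth functions. -/
def cdirDer (a : ℂ) (v w : CSpace n) : Derivation ℂ (SmoothFun U) (SmoothFun U) :=
  Derivation.mk'
    { toFun := fun f => ofFun (cdir a v w f.toFun)
        (ContDiffOn.cdir a v w U.isOpen f.contDiffOn_toFun)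
      map_add' := fun f g => by
        ext u
        rw [map_add]
        refine Eq.trans ?_ (cdir_add a v w (differentiableAt_toFun f u)
          (differentiableAt_toFun g u))
        exact cdir_congr_of_eqOn a v w U.isOpen (extendZero_eqOn fun u => by
          simp only [toFun_apply]; rfl) u.2
      map_smul' := fun c f => by
        ext u
        have := cdir_mul a v w (f := fun _ => c) (differentiableAt_const c)
          (differentiableAt_toFun f u)
        rw [cdir_const, mul_zero, add_zero] at this
        refine Eq.trans ?_ this
        exact cdir_congr_of_eqOn a v w U.isOpen (extendZero_eqOn fun u => by
          simp only [toFun_apply]; rfl) u.2 }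
    (fun f g => by
      ext u
      have h : ∀ x y x' y' : SmoothFun U, ev u (x • y + x' • y') =
          ev u x * ev u y + ev u x' * ev u y' := fun _ _ _ _ => rfl
      rw [h, ← toFun_apply f, ← toFun_apply g]
      refine Eq.trans ?_ (cdir_mul a v w (differentiableAt_toFun f u) (differentiableAt_toFun g u))
      exact cdir_congr_of_eqOn a v w U.isOpen (extendZero_eqOn fun u => by
        simp only [toFun_apply]; rfl) u.2)

theorem ev_cdirDer (a : ℂ) (v w : CSpace n) (f : SmoothFun U) {F : CSpace n → ℂ}
    (hF : ∀ u : U, ev u f = F u) (u : U) : ev u (cdirDer a v w f) = cdir a v w F u :=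
  cdir_congr_of_eqOn a v w U.isOpen (extendZero_eqOn fun u => (hF u).symm) u.2

theorem cdirDer_comm (a : ℂ) (v w : CSpace n) (b : ℂ) (v' w' : CSpace n) (f : SmoothFun U) :
    cdirDer a v w (cdirDer b v' w' f) = cdirDer b v' w' (cdirDer a v w f) := by
  ext u
  rw [ev_cdirDer a v w _ (F := cdir b v' w' f.toFun) fun u => rfl,
    ev_cdirDer b v' w' _ (F := cdir a v w f.toFun) fun u => rfl]
  exact cdir_comm a v w b v' w' U.isOpen f.2 u.2

/-- The derivation `∂/∂zⁱ` of smooth functions. -/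
def dzDer (i : Fin n) : Derivation ℂ (SmoothFun U) (SmoothFun U) :=
  cdirDer (-Complex.I) (Pi.single i 1) (Pi.single i Complex.I)

/-- The derivation `∂/∂z̄ʲ` of smooth functions. -/
def dzbarDer (i : Fin n) : Derivation ℂ (SmoothFun U) (SmoothFun U) :=
  cdirDer Complex.I (Pi.single i 1) (Pi.single i Complex.I)

theorem ev_dzDer (i : Fin n) (f : SmoothFun U) {F : CSpace n → ℂ}
    (hF : ∀ u : U, ev u f = F u) (u : U) : ev u (dzDer i f) = dz i F u := by
  rw [dz_eq_cdir]; exact ev_cdirDer _ _ _ f hF u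

theorem ev_dzbarDer (i : Fin n) (f : SmoothFun U) {F : CSpace n → ℂ}
    (hF : ∀ u : U, ev u f = F u) (u : U) : ev u (dzbarDer i f) = dzbar i F u :=
  ev_cdirDer _ _ _ f hF u

theorem dzDer_comm (i j : Fin n) (f : SmoothFun U) :
    dzDer i (dzDer j f) = dzDer j (dzDer i f) := cdirDer_comm _ _ _ _ _ _ f

theorem dzbarDer_dzDer (i j : Fin n) (f : SmoothFun U) :
    dzbarDer i (dzDer j f) = dzDer j (dzbarDer i f) := cdirDer_comm _ _ _ _ _ _ f

theorem isUnit_of_ne_zero {f : SmoothFun U} (hf : ∀ u, ev u f ≠ 0) : IsUnit f := by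
  have hc : ContDiffOn ℝ ∞ (fun z => (f.toFun z)⁻¹) U :=
    f.2.inv fun z hz => by
      have := hf ⟨z, hz⟩
      rwa [← toFun_apply] at this
  refine IsUnit.of_mul_eq_one (ofFun _ hc) ?_
  ext u
  rw [map_mul, map_one, ev_ofFun, toFun_apply, mul_inv_cancel₀ (hf u)]

end SmoothFun

end SmoothFun

/-! ### Holomorphic changes of variables -/

section Holomorphic

variable {n m : ℕ}

theorem fderiv_sub_I_fderiv_eq_sum (L : CSpace n →L[ℝ] ℂ) (w : CSpace n) :
    L w - Complex.I * L (Complex.I • w) =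
      ∑ a, w a * (L (Pi.single a 1) - Complex.I * L (Pi.single a Complex.I)) := by
  let T : CSpace n →ₗ[ℂ] ℂ :=
    { toFun := fun w => L w - Complex.I * L (Complex.I • w)
      map_add' := fun x y => by simp only [smul_add, map_add]; ring
      map_smul' := fun c x => by
        have h1 : c • x = c.re • x + c.im • (Complex.I • x) := by
          conv_lhs => rw [← Complex.re_add_im c, add_smul, mul_smul]
          rfl
        have h2 : Complex.I • (c • x) = c.re • (Complex.I • x) - c.im • x := by
          rw [h1, smul_add, smul_comm, smul_comm Complex.I c.im, smul_smul Complex.I,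
            Complex.I_mul_I, neg_smul, one_smul, smul_neg, sub_eq_add_neg]
        simp only [h2, RingHom.id_apply, smul_eq_mul]
        rw [h1]
        simp only [map_add, map_sub, map_smul, Complex.real_smul]
        conv_rhs => rw [← Complex.re_add_im c]
        linear_combination (c.im : ℂ) * L (Complex.I • x) * Complex.I_mul_I }
  have hw : w = ∑ a, w a • (Pi.single a 1 : CSpace n) := by
    ext b
    simp [Finset.sum_apply, Pi.single_apply]
  have h := congrArg T hw
  rw [map_sum] at h
  refine h.trans (Finset.sum_congr rfl fun a _ => ?_)
  rw [map_smul, smul_eq_mul]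
  congr 1
  change L _ - Complex.I * L (Complex.I • Pi.single a 1) = _
  rw [← Pi.single_smul, smul_eq_mul, mul_one]

theorem single_I (i : Fin n) :
    (Pi.single i Complex.I : CSpace n) = Complex.I • Pi.single i 1 := by
  rw [← Pi.single_smul, smul_eq_mul, mul_one]

theorem dz_comp_holomorphic {f : CSpace n → ℂ} {ψ : CSpace m → CSpace n} {z : CSpace m}
    (hf : DifferentiableAt ℝ f (ψ z)) (hψ : DifferentiableAt ℂ ψ z) (i : Fin m) :
    dz i (fun w => f (ψ w)) z = ∑ a, fderiv ℂ ψ z (Pi.single i 1) a * dz a f (ψ z) := by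
  have h : fderiv ℝ (fun w => f (ψ w)) z =
      (fderiv ℝ f (ψ z)).comp ((fderiv ℂ ψ z).restrictScalars ℝ) :=
    (hf.hasFDerivAt.comp z (hψ.hasFDerivAt.restrictScalars ℝ)).fderiv
  simp only [dz, h, ContinuousLinearMap.comp_apply, ContinuousLinearMap.coe_restrictScalars',
    single_I i, map_smul, mul_div_assoc']
  rw [fderiv_sub_I_fderiv_eq_sum, Finset.sum_div]

theorem dz_conj_of_holomorphic {f : CSpace n → ℂ} {z : CSpace n} (hf : DifferentiableAt ℂ f z)
    (i : Fin n) : dz i (fun w => conj (f w)) z = 0 := by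
  have h : fderiv ℝ (fun w => conj (f w)) z =
      (Complex.conjCLE : ℂ →L[ℝ] ℂ).comp ((fderiv ℂ f z).restrictScalars ℝ) :=
    ((Complex.conjCLE : ℂ →L[ℝ] ℂ).hasFDerivAt.comp z (hf.hasFDerivAt.restrictScalars ℝ)).fderiv
  simp only [dz, h, ContinuousLinearMap.comp_apply, ContinuousLinearMap.coe_restrictScalars',
    single_I i, map_smul, smul_eq_mul]
  simp
  linear_combination (conj (fderiv ℂ f z (Pi.single i 1)) ) * Complex.I_mul_I

end Holomorphic

/-! ### Frames, Gram matrices and transition maps of charts -/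

section Charts

open Topology TopologicalSpace

variable {n : ℕ} {X : Type*} [TopologicalSpace X] [ChartedSpace (CSpace n) X]

/-- The Gram matrix `√-1 g(e_i, e_j)` of the Kähler metric in the standard coordinates of the
fibre at `x`. -/
def gram (g : KahlerMetric n X) (x : X) : Matrix (Fin n) (Fin n) ℂ :=
  Matrix.of fun i j => Complex.I *
    g.inner x (Pi.single j 1 : CSpace n) (Pi.single i 1 : CSpace n)

theorem omegaInvAt_eq (g : KahlerMetric n X) (x : X) : omegaInvAt g x = (gram g x)⁻¹ := rfl

theorem pi_eq_sum_single (v : CSpace n) : v = ∑ a, v a • (Pi.single a 1 : CSpace n) := by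
  ext b
  simp [Finset.sum_apply, Pi.single_apply]

theorem sesquilinear_eq_sum (B : CSpace n →ₗ⋆[ℂ] CSpace n →ₗ[ℂ] ℂ) (v w : CSpace n) :
    B v w = ∑ a, ∑ b, w a * B (Pi.single b 1) (Pi.single a 1) * conj (v b) := by
  conv_lhs => rw [pi_eq_sum_single v, pi_eq_sum_single w]
  simp only [map_sum, LinearMap.sum_apply, LinearMap.map_smulₛₗ, LinearMap.smul_apply, smul_eq_mul,
    RingHom.id_apply, Finset.mul_sum]
  exact Finset.sum_congr rfl fun _ _ => Finset.sum_congr rfl fun _ _ => by ring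

theorem inner_eq_sum (g : KahlerMetric n X) (x : X) (v w : CSpace n) :
    Complex.I * g.inner x v w = ∑ a, ∑ b, w a * gram g x a b * conj (v b) := by
  have h := sesquilinear_eq_sum (g.inner x) v w
  refine (congrArg (Complex.I * ·) h).trans ?_
  simp only [Finset.mul_sum]
  refine Finset.sum_congr rfl fun a _ => Finset.sum_congr rfl fun b _ => ?_
  have hr : ∀ p q r s : ℂ, p * (q * r * s) = q * (p * r) * s := fun p q r s => by ring
  exact hr _ _ _ _

theorem omega_eq (g : KahlerMetric n X) (φ : OpenPartialHomeomorph X (CSpace n)) (z : CSpace n) :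
    omega g φ z = (frameMatrix φ z).transpose *
      (gram g (φ.symm z) * (frameMatrix φ z).map conj) := by
  ext i j
  rw [← Matrix.mul_assoc, Matrix.mul_apply]
  simp only [Matrix.mul_apply, Matrix.transpose_apply, Matrix.map_apply, Finset.sum_mul]
  rw [Finset.sum_comm]
  exact inner_eq_sum g (φ.symm z) (coordVec φ z j) (coordVec φ z i)

/-- A vector in the kernel would have norm zero. -/
theorem isUnit_det_gram (g : KahlerMetric n X) (x : X) : IsUnit (gram g x).det := by
  rw [isUnit_iff_ne_zero]
  intro h0
  obtain ⟨v, hv, hv0⟩ := Matrix.exists_mulVec_eq_zero_iff.2 h0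
  -- `gram` is contracted with the conjugate of the first argument of the metric
  set w : CSpace n := fun i => conj (v i) with hw
  have h1 : Complex.I * g.inner x w w = 0 := by
    rw [inner_eq_sum]
    refine Finset.sum_eq_zero fun a _ => ?_
    have h2 := congrFun hv0 a
    simp only [Matrix.mulVec, dotProduct, Pi.zero_apply] at h2
    simp only [hw, Complex.conj_conj, mul_assoc, ← Finset.mul_sum, h2, mul_zero]
  have h3 : w ≠ 0 := by
    intro h
    apply hv
    funext i
    have := congrFun h i
    simpa [hw] using this
  have h4 := g.pos x w h3
  rcases mul_eq_zero.1 h1 with h | h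
  · exact Complex.I_ne_zero h
  · rw [h] at h4; simp at h4

/-- The Jacobian matrix of the chart `φ` in the standard coordinates of the fibre at `φ.symm z`. -/
def coframeMatrix (φ : OpenPartialHomeomorph X (CSpace n)) (z : CSpace n) :
    Matrix (Fin n) (Fin n) ℂ :=
  fun i j => (mfderiv 𝓘(ℂ, CSpace n) 𝓘(ℂ, CSpace n) φ (φ.symm z) (Pi.single j 1 : CSpace n) :
    CSpace n) i

theorem clm_apply_eq_sum (T : CSpace n →L[ℂ] CSpace n) (v : CSpace n) (i : Fin n) :
    T v i = ∑ a, T (Pi.single a 1) i * v a := by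
  conv_lhs => rw [pi_eq_sum_single v]
  simp [Finset.sum_apply, mul_comm]

variable [IsManifold 𝓘(ℂ, CSpace n) ω X] {φ ψ : OpenPartialHomeomorph X (CSpace n)}

theorem coframe_mul_frame (hφ : φ ∈ atlas (CSpace n) X) {z : CSpace n} (hz : z ∈ φ.target) :
    coframeMatrix φ z * frameMatrix φ z = 1 := by
  have h := (mdifferentiable_of_mem_atlas (I := 𝓘(ℂ, CSpace n)) hφ).comp_symm_deriv hz
  ext i j
  have h2 := congrArg (fun T : CSpace n →L[ℂ] CSpace n => T (Pi.single j 1) i) h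
  rw [Matrix.mul_apply, Matrix.one_apply]
  refine (clm_apply_eq_sum _ _ i).symm.trans (h2.trans ?_)
  change (Pi.single j 1 : CSpace n) i = _
  rw [Pi.single_apply]

theorem frame_mul_coframe (hφ : φ ∈ atlas (CSpace n) X) {z : CSpace n} (hz : z ∈ φ.target) :
    frameMatrix φ z * coframeMatrix φ z = 1 :=
  mul_eq_one_comm.1 (coframe_mul_frame hφ hz)

theorem isUnit_det_omega (g : KahlerMetric n X) (hφ : φ ∈ atlas (CSpace n) X) {z : CSpace n}
    (hz : z ∈ φ.target) : IsUnit (omega g φ z).det := by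
  have h : IsUnit (frameMatrix φ z).det := by
    refine IsUnit.of_mul_eq_one (coframeMatrix φ z).det ?_
    rw [← Matrix.det_mul, frame_mul_coframe hφ hz, Matrix.det_one]
  rw [omega_eq, Matrix.det_mul, Matrix.det_mul, Matrix.det_transpose]
  refine h.mul ((isUnit_det_gram g _).mul ?_)
  have := h.map (starRingEnd ℂ)
  rwa [RingHom.map_det] at this

/-- The transition map from the chart `φ` to the chart `ψ`. -/
def transition (φ ψ : OpenPartialHomeomorph X (CSpace n)) (z : CSpace n) : CSpace n := ψ (φ.symm z)

/-- The Jacobian matrix `∂ψᵃ/∂zⁱ` of the transition map. -/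
def jacobian (φ ψ : OpenPartialHomeomorph X (CSpace n)) (z : CSpace n) :
    Matrix (Fin n) (Fin n) ℂ :=
  fun a i => fderiv ℂ (transition φ ψ) z (Pi.single i 1) a

theorem contDiffOn_transition (hφ : φ ∈ atlas (CSpace n) X) (hψ : ψ ∈ atlas (CSpace n) X) :
    ContDiffOn ℂ ω (transition φ ψ) (φ.target ∩ φ.symm ⁻¹' ψ.source) := by
  have h := HasGroupoid.compatible (G := contDiffGroupoid ω 𝓘(ℂ, CSpace n)) hφ hψ
  rw [contDiffGroupoid, mem_groupoid_of_pregroupoid] at h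
  have h1 := h.1
  simp [contDiffPregroupoid] at h1
  exact h1

omit [ChartedSpace (CSpace n) X] [IsManifold 𝓘(ℂ, CSpace n) ω X] in
theorem isOpen_overlap (φ ψ : OpenPartialHomeomorph X (CSpace n)) :
    IsOpen (φ.target ∩ φ.symm ⁻¹' ψ.source) := φ.isOpen_inter_preimage_symm ψ.open_source

theorem frameMatrix_transition (hφ : φ ∈ atlas (CSpace n) X) (hψ : ψ ∈ atlas (CSpace n) X)
    {z : CSpace n} (hz : z ∈ φ.target ∩ φ.symm ⁻¹' ψ.source) :
    frameMatrix φ z = frameMatrix ψ (transition φ ψ z) * jacobian φ ψ z := by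
  have hop := isOpen_overlap φ ψ
  have hd : DifferentiableAt ℂ (transition φ ψ) z :=
    ((contDiffOn_transition hφ hψ).contDiffAt (hop.mem_nhds hz)).differentiableAt (by simp)
  have ht : transition φ ψ z ∈ ψ.target := ψ.map_source hz.2
  have h1 : (φ.symm : CSpace n → X) =ᶠ[𝓝 z] ψ.symm ∘ transition φ ψ := by
    filter_upwards [hop.mem_nhds hz] with w hw
    exact (ψ.left_inv hw.2).symm
  have h2 := h1.mfderiv_eq (I := 𝓘(ℂ, CSpace n)) (I' := 𝓘(ℂ, CSpace n))
  rw [mfderiv_comp z (mdifferentiableAt_atlas_symm hψ ht) hd.mdifferentiableAt,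
    mfderiv_eq_fderiv] at h2
  ext i j
  have h3 := congrArg (fun T : CSpace n →L[ℂ] CSpace n => T (Pi.single j 1) i) h2
  rw [Matrix.mul_apply]
  exact h3.trans (clm_apply_eq_sum (mfderiv 𝓘(ℂ, CSpace n) 𝓘(ℂ, CSpace n) ψ.symm
    (transition φ ψ z)) (fderiv ℂ (transition φ ψ) z (Pi.single j 1)) i)

theorem omega_transition (g : KahlerMetric n X) (hφ : φ ∈ atlas (CSpace n) X)
    (hψ : ψ ∈ atlas (CSpace n) X) {z : CSpace n} (hz : z ∈ φ.target ∩ φ.symm ⁻¹' ψ.source) :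
    omega g φ z = (jacobian φ ψ z).transpose *
      (omega g ψ (transition φ ψ z) * (jacobian φ ψ z).map conj) := by
  have h : ψ.symm (transition φ ψ z) = φ.symm z := ψ.left_inv hz.2
  rw [omega_eq, omega_eq, h, frameMatrix_transition hφ hψ hz, Matrix.map_mul, Matrix.transpose_mul]
  simp only [Matrix.mul_assoc]

end Charts

/-! ### The Bargmann--Fock action on scalar series -/

section Action

open MvPowerSeries

variable {n : ℕ}

/-- The derivative `∂^{|e|} / ∂y^e` of a scalar power series. -/
def derivMonomial (e : Fin n →₀ ℕ) (F : MvPowerSeries (Fin n) ℂ) : MvPowerSeries (Fin n) ℂ :=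
  fun d => ((∏ i, (d i + e i).descFactorial (e i) : ℕ) : ℂ) * coeff (d + e) F

theorem coeff_derivMonomial (d e : Fin n →₀ ℕ) (F : MvPowerSeries (Fin n) ℂ) :
    coeff d (derivMonomial e F) =
      ((∏ i, (d i + e i).descFactorial (e i) : ℕ) : ℂ) * coeff (d + e) F := rfl

theorem derivMonomial_zero (F : MvPowerSeries (Fin n) ℂ) : derivMonomial 0 F = F := by
  ext d
  simp [coeff_derivMonomial]

theorem derivMonomial_add_single (e : Fin n →₀ ℕ) (i : Fin n) (F : MvPowerSeries (Fin n) ℂ) :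
    derivMonomial (e + Finsupp.single i 1) F = pderiv ℂ i (derivMonomial e F) := by
  ext d
  rw [coeff_pderiv, coeff_derivMonomial, coeff_derivMonomial, add_right_comm, ← add_assoc]
  have h : (∏ j, (d j + (e + Finsupp.single i 1 : Fin n →₀ ℕ) j).descFactorial
      ((e + Finsupp.single i 1 : Fin n →₀ ℕ) j)) =
      (∏ j, ((d + Finsupp.single i 1 : Fin n →₀ ℕ) j + e j).descFactorial (e j)) * (d i + 1) := by
    rw [← Finset.mul_prod_erase _ _ (Finset.mem_univ i), ← Finset.mul_prod_erase Finset.univ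
      (fun j => ((d + Finsupp.single i 1 : Fin n →₀ ℕ) j + e j).descFactorial (e j))
      (Finset.mem_univ i)]
    have h1 : ∀ j ∈ Finset.univ.erase i,
        (d j + (e + Finsupp.single i 1 : Fin n →₀ ℕ) j).descFactorial
        ((e + Finsupp.single i 1 : Fin n →₀ ℕ) j) =
        ((d + Finsupp.single i 1 : Fin n →₀ ℕ) j + e j).descFactorial (e j) := by
      intro j hj
      have hij : j ≠ i := Finset.ne_of_mem_erase hj
      simp [Finsupp.add_apply, Finsupp.single_eq_of_ne hij]
    rw [Finset.prod_congr rfl h1]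
    simp only [Finsupp.add_apply, Finsupp.single_eq_same]
    rw [← add_assoc, Nat.descFactorial_succ, show d i + e i + 1 - e i = d i + 1 by omega,
      add_right_comm (d i) 1 (e i)]
    ring
  rw [h]
  push_cast
  ring

theorem derivMonomial_linear (e : Fin n →₀ ℕ) (a b : ℂ) (F G : MvPowerSeries (Fin n) ℂ) :
    derivMonomial e (a • F + b • G) = a • derivMonomial e F + b • derivMonomial e G := by
  ext d
  simp only [coeff_derivMonomial, map_add, coeff_smul]
  ring

/-- The constant coefficient differential operator `p(∂/∂y)` with symbol `p`. -/
def diffOp (p : MvPolynomial (Fin n) ℂ) (F : MvPowerSeries (Fin n) ℂ) : MvPowerSeries (Fin n) ℂ :=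
  ∑ e ∈ p.support, p.coeff e • derivMonomial e F

theorem diffOp_eq_sum {p : MvPolynomial (Fin n) ℂ} {s : Finset (Fin n →₀ ℕ)} (hs : p.support ⊆ s)
    (F : MvPowerSeries (Fin n) ℂ) : diffOp p F = ∑ e ∈ s, p.coeff e • derivMonomial e F :=
  Finset.sum_subset hs fun e _ he => by rw [MvPolynomial.notMem_support_iff.1 he, zero_smul]

theorem diffOp_add (p q : MvPolynomial (Fin n) ℂ) (F : MvPowerSeries (Fin n) ℂ) :
    diffOp (p + q) F = diffOp p F + diffOp q F := by
  classical
  rw [diffOp_eq_sum (MvPolynomial.support_add (p := p) (q := q)),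
    diffOp_eq_sum (p := p) Finset.subset_union_left, diffOp_eq_sum (p := q)
      Finset.subset_union_right, ← Finset.sum_add_distrib]
  simp only [MvPolynomial.coeff_add, add_smul]

theorem diffOp_monomial (e : Fin n →₀ ℕ) (c : ℂ) (F : MvPowerSeries (Fin n) ℂ) :
    diffOp (MvPolynomial.monomial e c) F = c • derivMonomial e F := by
  rw [diffOp_eq_sum MvPolynomial.support_monomial_subset, Finset.sum_singleton,
    MvPolynomial.coeff_monomial, if_pos rfl]

theorem diffOp_linear (p : MvPolynomial (Fin n) ℂ) (a b : ℂ) (F G : MvPowerSeries (Fin n) ℂ) :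
    diffOp p (a • F + b • G) = a • diffOp p F + b • diffOp p G := by
  simp only [diffOp, derivMonomial_linear, Finset.smul_sum, ← Finset.sum_add_distrib, smul_add,
    smul_comm (p.coeff _)]

theorem diffOp_smul (p : MvPolynomial (Fin n) ℂ) (a : ℂ) (F : MvPowerSeries (Fin n) ℂ) :
    diffOp p (a • F) = a • diffOp p F := by
  simpa using diffOp_linear p a 0 F 0

theorem diffOp_map_add (p : MvPolynomial (Fin n) ℂ) (F G : MvPowerSeries (Fin n) ℂ) :
    diffOp p (F + G) = diffOp p F + diffOp p G := by
  simpa using diffOp_linear p 1 1 F G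

theorem diffOp_zero (p : MvPolynomial (Fin n) ℂ) : diffOp p (0 : MvPowerSeries (Fin n) ℂ) = 0 := by
  simpa using diffOp_smul p 0 0

theorem diffOp_C_mul (p : MvPolynomial (Fin n) ℂ) (c : ℂ) (F : MvPowerSeries (Fin n) ℂ) :
    diffOp (MvPolynomial.C c * p) F = c • diffOp p F := by
  induction p using MvPolynomial.induction_on' with
  | monomial e a => rw [MvPolynomial.C_mul_monomial, diffOp_monomial, diffOp_monomial, mul_smul]
  | add p q hp hq => rw [mul_add, diffOp_add, diffOp_add, hp, hq, smul_add]

theorem diffOp_mul_X (p : MvPolynomial (Fin n) ℂ) (i : Fin n) (F : MvPowerSeries (Fin n) ℂ) :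
    diffOp (p * MvPolynomial.X i) F = pderiv ℂ i (diffOp p F) := by
  induction p using MvPolynomial.induction_on' with
  | monomial e a =>
    rw [MvPolynomial.X, MvPolynomial.monomial_mul, diffOp_monomial, diffOp_monomial, mul_one,
      derivMonomial_add_single, Derivation.map_smul]
  | add p q hp hq => rw [add_mul, diffOp_add, diffOp_add, hp, hq, map_add]

theorem diffOp_sum {ι : Type*} (s : Finset ι) (p : ι → MvPolynomial (Fin n) ℂ)
    (F : MvPowerSeries (Fin n) ℂ) : diffOp (∑ i ∈ s, p i) F = ∑ i ∈ s, diffOp (p i) F :=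
  map_sum (AddMonoidHom.mk' (fun p => diffOp p F) fun p q => diffOp_add p q F) p s

variable (B : Matrix (Fin n) (Fin n) ℂ) (k : ℕ)

theorem bfActionScalar_eq (A : FiniteWeight n) (F : MvPowerSeries (Fin n) ℂ) :
    bfActionScalar B k A F =
      ∑ a ∈ A.support, hbar k ^ a.degree • diffOp (wickSymbol B a) (A.coeff a * F) := by
  have h1 : ∀ (f : MvPowerSeries (Fin n) ℂ), seriesMul (M := ℂ) f F = f * F := by
    intro f
    funext d
    classical
    exact (coeff_mul d f F).symm
  ext d
  rw [map_sum, coeff_apply]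
  simp only [bfActionScalar, bfAction, Finset.sum_apply, h1, coeff_smul, diffOp, map_sum,
    coeff_derivMonomial, Pi.smul_apply, seriesDeriv, smul_eq_mul, nsmul_eq_mul]
  rfl

theorem bfActionScalar_eq_sum {A : FiniteWeight n} {s : Finset (Option (Fin n) →₀ ℕ)}
    (hs : A.support ⊆ s) (F : MvPowerSeries (Fin n) ℂ) : bfActionScalar B k A F =
      ∑ a ∈ s, hbar k ^ a.degree • diffOp (wickSymbol B a) (A.coeff a * F) := by
  rw [bfActionScalar_eq]
  exact Finset.sum_subset hs fun a _ ha => by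
    rw [MvPolynomial.notMem_support_iff.1 ha, zero_mul, diffOp_zero, smul_zero]

theorem bfActionScalar_add (A A' : FiniteWeight n) (F : MvPowerSeries (Fin n) ℂ) :
    bfActionScalar B k (A + A') F = bfActionScalar B k A F + bfActionScalar B k A' F := by
  classical
  rw [bfActionScalar_eq_sum B k (MvPolynomial.support_add (p := A) (q := A')),
    bfActionScalar_eq_sum B k (A := A) Finset.subset_union_left,
    bfActionScalar_eq_sum B k (A := A') Finset.subset_union_right, ← Finset.sum_add_distrib]
  simp only [MvPolynomial.coeff_add, add_mul, diffOp_map_add, smul_add]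

/-- The action of a fixed element, as an additive map in that element. -/
def bfActionHom (F : MvPowerSeries (Fin n) ℂ) : FiniteWeight n →+ MvPowerSeries (Fin n) ℂ :=
  AddMonoidHom.mk' (fun A => bfActionScalar B k A F) fun A A' => bfActionScalar_add B k A A' F

theorem bfActionScalar_sum {ι : Type*} (s : Finset ι) (A : ι → FiniteWeight n)
    (F : MvPowerSeries (Fin n) ℂ) :
    bfActionScalar B k (∑ i ∈ s, A i) F = ∑ i ∈ s, bfActionScalar B k (A i) F :=
  map_sum (bfActionHom B k F) A s

theorem bfActionScalar_neg (A : FiniteWeight n) (F : MvPowerSeries (Fin n) ℂ) :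
    bfActionScalar B k (-A) F = -bfActionScalar B k A F :=
  map_neg (bfActionHom B k F) A

theorem bfActionScalar_monomial (a : Option (Fin n) →₀ ℕ) (f F : MvPowerSeries (Fin n) ℂ) :
    bfActionScalar B k (MvPolynomial.monomial a f) F =
      hbar k ^ a.degree • diffOp (wickSymbol B a) (f * F) := by
  rw [bfActionScalar_eq_sum B k MvPolynomial.support_monomial_subset, Finset.sum_singleton,
    MvPolynomial.coeff_monomial, if_pos rfl]

theorem wickSymbol_zero : wickSymbol B 0 = 1 := by simp [wickSymbol]

theorem wickSymbol_add_single_none (a : Option (Fin n) →₀ ℕ) :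
    wickSymbol B (a + Finsupp.single none 1) = wickSymbol B a := by
  simp [wickSymbol]

theorem wickSymbol_add_single_some (a : Option (Fin n) →₀ ℕ) (j : Fin n) :
    wickSymbol B (a + Finsupp.single (some j) 1) =
      wickSymbol B a * ∑ p, MvPolynomial.C (B j p) * MvPolynomial.X p := by
  classical
  simp only [wickSymbol, Finsupp.add_apply, pow_add, Finset.prod_mul_distrib]
  congr 1
  rw [Finset.prod_eq_single j]
  · simp
  · intro i _ hij
    rw [Finsupp.single_eq_of_ne (by simpa using hij), pow_zero]
  · simp

theorem bfActionScalar_C (f F : MvPowerSeries (Fin n) ℂ) :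
    bfActionScalar B k (MvPolynomial.C f) F = f * F := by
  rw [MvPolynomial.C_apply, bfActionScalar_monomial, wickSymbol_zero, map_zero, pow_zero, one_smul,
    ← MvPolynomial.C_1, MvPolynomial.C_apply, diffOp_monomial, one_smul, derivMonomial_zero]

theorem bfActionScalar_mul_X_none (A : FiniteWeight n) (F : MvPowerSeries (Fin n) ℂ) :
    bfActionScalar B k (A * MvPolynomial.X none) F = hbar k • bfActionScalar B k A F := by
  induction A using MvPolynomial.induction_on' with
  | monomial a f =>
    rw [MvPolynomial.X, MvPolynomial.monomial_mul, bfActionScalar_monomial,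
      bfActionScalar_monomial, mul_one, wickSymbol_add_single_none, map_add, Finsupp.degree_single,
      pow_succ', mul_smul]
  | add p q hp hq => rw [add_mul, bfActionScalar_add, bfActionScalar_add, hp, hq, smul_add]

theorem bfActionScalar_mul_X_some (A : FiniteWeight n) (j : Fin n) (F : MvPowerSeries (Fin n) ℂ) :
    bfActionScalar B k (A * MvPolynomial.X (some j)) F =
      hbar k • ∑ p, B j p • pderiv ℂ p (bfActionScalar B k A F) := by
  induction A using MvPolynomial.induction_on' with
  | monomial a f =>
    rw [MvPolynomial.X, MvPolynomial.monomial_mul, bfActionScalar_monomial,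
      bfActionScalar_monomial, mul_one, wickSymbol_add_single_some, map_add, Finsupp.degree_single,
      pow_succ', mul_smul, Finset.mul_sum, diffOp_sum]
    congr 1
    rw [Finset.smul_sum]
    refine Finset.sum_congr rfl fun p _ => ?_
    rw [mul_left_comm, diffOp_C_mul, diffOp_mul_X, Derivation.map_smul, smul_comm]
  | add p q hp hq =>
    rw [add_mul, bfActionScalar_add, bfActionScalar_add, hp, hq, ← smul_add,
      ← Finset.sum_add_distrib]
    simp only [map_add, smul_add]

theorem bfActionScalar_C_C_mul (A : FiniteWeight n) (c : ℂ) (F : MvPowerSeries (Fin n) ℂ) :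
    bfActionScalar B k (MvPolynomial.C (C c) * A) F = c • bfActionScalar B k A F := by
  induction A using MvPolynomial.induction_on' with
  | monomial a f =>
    rw [MvPolynomial.C_mul_monomial, bfActionScalar_monomial, bfActionScalar_monomial, mul_assoc,
      ← smul_eq_C_mul, diffOp_smul, smul_comm]
  | add p q hp hq => rw [mul_add, bfActionScalar_add, bfActionScalar_add, hp, hq, smul_add]

/-! ### Naturality under linear changes of the fibre variables -/

variable (A : Matrix (Fin n) (Fin n) ℂ)

theorem changeSeries_C (c : ℂ) : changeSeries A (C c) = C c :=
  (changeSeries A).commutes c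

theorem changeSeries_X (i : Fin n) : changeSeries A (X i) = ∑ j, C (A i j) * X j :=
  substAlgHom_X _ _

theorem pderiv_changeSeries (q : Fin n) (F : MvPowerSeries (Fin n) ℂ) :
    pderiv ℂ q (changeSeries A F) = ∑ p, A p q • changeSeries A (pderiv ℂ p F) := by
  have h := FlatConnection.pderiv_change (h := RingHom.id ℂ) (J := A) (changeSeries A).toRingHom
    (fun c => changeSeries_C A c) (fun p => changeSeries_X A p) q F
  simp only [← smul_eq_C_mul] at h
  exact h

theorem changeSeries_mul_apply (A A' : Matrix (Fin n) (Fin n) ℂ) (F : MvPowerSeries (Fin n) ℂ) :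
    changeSeries (A * A') F = changeSeries A' (changeSeries A F) := by
  have h : (changeSeries (A * A')).toRingHom =
      (changeSeries A').toRingHom.comp (changeSeries A).toRingHom := by
    refine ringHom_ext_of_constantCoeff _ _ (fun i => ?_) (fun c => ?_) fun i => ?_
    · change constantCoeff (changeSeries (A * A') (X i)) = 0
      simp [changeSeries_X]
    · change changeSeries (A * A') (C c) = changeSeries A' (changeSeries A (C c))
      simp only [changeSeries_C]
    · change changeSeries (A * A') (X i) = changeSeries A' (changeSeries A (X i))
      simp only [changeSeries_X, map_sum, map_mul, changeSeries_C, Finset.mul_sum, Matrix.mul_apply,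
        Finset.sum_mul]
      rw [Finset.sum_comm]
      exact Finset.sum_congr rfl fun _ _ => Finset.sum_congr rfl fun _ _ => by ring
  exact congrArg (fun Φ : MvPowerSeries (Fin n) ℂ →+* _ => Φ F) h

theorem changeSeries_one_apply (F : MvPowerSeries (Fin n) ℂ) : changeSeries 1 F = F := by
  have h : (changeSeries (1 : Matrix (Fin n) (Fin n) ℂ)).toRingHom = RingHom.id _ := by
    refine ringHom_ext_of_constantCoeff _ _ (fun i => ?_) (fun c => ?_) fun i => ?_
    · change constantCoeff (changeSeries 1 (X i)) = 0
      simp [changeSeries_X]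
    · exact changeSeries_C 1 c
    · change changeSeries 1 (X i) = X i
      simp [changeSeries_X, Matrix.one_apply]
  exact congrArg (fun Φ : MvPowerSeries (Fin n) ℂ →+* _ => Φ F) h

theorem constantCoeff_changeSeries (F : MvPowerSeries (Fin n) ℂ) :
    constantCoeff (changeSeries A F) = constantCoeff F := by
  obtain ⟨G, hG⟩ := exists_eq_C_add_sum_X_mul F
  conv_lhs => rw [hG]
  simp [changeSeries_X, changeSeries_C]

theorem changeFiniteWeight_C (f : MvPowerSeries (Fin n) ℂ) :
    changeFiniteWeight A (MvPolynomial.C f) = MvPolynomial.C (changeSeries A f) := by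
  simp [changeFiniteWeight]

theorem changeFiniteWeight_X_none :
    changeFiniteWeight A (MvPolynomial.X none) = MvPolynomial.X none := by
  simp [changeFiniteWeight]

theorem changeFiniteWeight_X_some (i : Fin n) :
    changeFiniteWeight A (MvPolynomial.X (some i)) =
      ∑ j, MvPolynomial.C (C (conj (A i j))) * MvPolynomial.X (some j) := by
  simp [changeFiniteWeight]

/-- Naturality of the Bargmann--Fock action: `B` and `B'` are the inverse Kähler matrices in the two
systems of fibre variables. -/
theorem changeSeries_bfActionScalar {B B' : Matrix (Fin n) (Fin n) ℂ}
    (hB : A.map conj * B' * A.transpose = B) (α : FiniteWeight n) (F : MvPowerSeries (Fin n) ℂ) :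
    changeSeries A (bfActionScalar B k α F) =
      bfActionScalar B' k (changeFiniteWeight A α) (changeSeries A F) := by
  induction α using MvPolynomial.induction_on with
  | C f => rw [bfActionScalar_C, changeFiniteWeight_C, bfActionScalar_C, map_mul]
  | add p q hp hq =>
    rw [map_add, bfActionScalar_add, bfActionScalar_add, map_add, hp, hq]
  | mul_X p o hp =>
    rw [map_mul]
    cases o with
    | none =>
      rw [bfActionScalar_mul_X_none, changeFiniteWeight_X_none, bfActionScalar_mul_X_none, map_smul,
        hp]
    | some i =>
      rw [bfActionScalar_mul_X_some, changeFiniteWeight_X_some, map_smul, map_sum, Finset.mul_sum,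
        bfActionScalar_sum]
      have h1 : ∀ j, bfActionScalar B' k (changeFiniteWeight A p *
          (MvPolynomial.C (C (conj (A i j))) * MvPolynomial.X (some j))) (changeSeries A F) =
          hbar k • ∑ p', ∑ q, (conj (A i j) * B' j q * A p' q) •
            changeSeries A (pderiv ℂ p' (bfActionScalar B k p F)) := by
        intro j
        rw [mul_left_comm, bfActionScalar_C_C_mul, bfActionScalar_mul_X_some, ← hp, smul_comm]
        congr 1
        simp only [pderiv_changeSeries, Finset.smul_sum, smul_smul]
        rw [Finset.sum_comm]
        exact Finset.sum_congr rfl fun _ _ => Finset.sum_congr rfl fun _ _ => by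
          rw [mul_assoc]
      rw [Finset.sum_congr rfl fun j _ => h1 j, ← Finset.smul_sum]
      congr 1
      rw [Finset.sum_comm]
      refine Finset.sum_congr rfl fun p' _ => ?_
      simp only [← Finset.sum_smul]
      rw [map_smul]
      congr 1
      rw [← hB]
      simp only [Matrix.mul_apply, Matrix.map_apply, Matrix.transpose_apply, Finset.sum_mul]
      exact Finset.sum_comm

end Action

/-! ### The local geometry over an open set of a chart -/

section LocalGeometry

open Topology TopologicalSpace SmoothFun MvPowerSeries

variable {n : ℕ} {X : Type*} [TopologicalSpace X] [ChartedSpace (CSpace n) X]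
  [IsManifold 𝓘(ℂ, CSpace n) ω X]

variable (g : KahlerMetric n X) {φ : OpenPartialHomeomorph X (CSpace n)}
  (hφ : φ ∈ atlas (CSpace n) X) {U : Opens (CSpace n)} (hU : (U : Set (CSpace n)) ⊆ φ.target)

/-- The matrix of the Kähler form with entries in the algebra of smooth functions. -/
def omegaFun : Matrix (Fin n) (Fin n) (SmoothFun U) := fun i j =>
  ofFun (fun z => omega g φ z i j) (contDiffOn_const.mul ((g.smooth φ hφ i j).mono hU))

omit [IsManifold 𝓘(ℂ, CSpace n) ω X] in
theorem map_ev_omegaFun (u : U) : (omegaFun g hφ hU).map (ev u) = omega g φ u := rfl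

theorem isUnit_det_omegaFun : IsUnit (omegaFun g hφ hU).det := by
  refine isUnit_of_ne_zero fun u => ?_
  have h : ev u (omegaFun g hφ hU).det = (omega g φ u).det := RingHom.map_det _ _
  rw [h]
  exact (isUnit_det_omega g hφ (hU u.2)).ne_zero

theorem omegaFun_inv_mul : (omegaFun g hφ hU)⁻¹ * omegaFun g hφ hU = 1 :=
  Matrix.nonsing_inv_mul _ (isUnit_det_omegaFun g hφ hU)

theorem map_ev_omegaFun_inv (u : U) : ((omegaFun g hφ hU)⁻¹).map (ev u) = omegaInv g φ u := by
  refine (Matrix.inv_eq_left_inv ?_).symm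
  rw [← map_ev_omegaFun g hφ hU, ← Matrix.map_mul, omegaFun_inv_mul]
  exact Matrix.map_one _ (map_zero _) (map_one _)

omit [IsManifold 𝓘(ℂ, CSpace n) ω X] in
include hφ in
theorem dz_omega_closed (i k j : Fin n) {z : CSpace n} (hz : z ∈ φ.target) :
    dz k (fun w => omega g φ w i j) z = dz i (fun w => omega g φ w k j) z := by
  have key : ∀ i k, dz k (fun w => omega g φ w i j) z = Complex.I *
      dz k (fun w => g.inner (φ.symm w) (coordVec φ w j) (coordVec φ w i)) z := by
    intro i k
    have hd := ((g.smooth φ hφ i j).contDiffAt (φ.open_target.mem_nhds hz)).differentiableAt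
      (by simp)
    rw [dz_eq_cdir, dz_eq_cdir]
    have := cdir_mul (-Complex.I) (Pi.single k 1) (Pi.single k Complex.I)
      (differentiableAt_const Complex.I) hd
    rwa [cdir_const, mul_zero, add_zero] at this
  rw [key, key, g.closed φ hφ i k j z hz]

/-- The Levi-Civita connection over an open subset of the chart `φ`. -/
def kahlerConn : FlatConnection n (SmoothFun U) :=
  FlatConnection.ofKahler dzDer dzDer_comm (omegaFun g hφ hU) (omegaFun g hφ hU)⁻¹
    (omegaFun_inv_mul g hφ hU) fun i k j => by
      ext u
      rw [ev_dzDer k _ (F := fun w => omega g φ w i j) fun _ => rfl,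
        ev_dzDer i _ (F := fun w => omega g φ w k j) fun _ => rfl]
      exact dz_omega_closed g hφ i k j (hU u.2)

theorem kahlerConn_der (i : Fin n) : (kahlerConn g hφ hU).der i = dzDer i := rfl

theorem ev_kahlerConn_Γ (u : U) (p i j : Fin n) :
    ev u ((kahlerConn g hφ hU).Γ p i j) = christoffel g φ p i j u := by
  change ev u (∑ q, (omegaFun g hφ hU)⁻¹ q p * dzDer i (omegaFun g hφ hU j q)) = _
  rw [map_sum]
  refine Finset.sum_congr rfl fun q _ => ?_
  rw [map_mul, ev_dzDer i _ (F := fun w => omega g φ w j q) fun _ => rfl,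
    ← map_ev_omegaFun_inv g hφ hU]
  rfl

theorem dzDer_omegaFun (i j q : Fin n) : dzDer i (omegaFun g hφ hU j q) =
    ∑ p, (kahlerConn g hφ hU).Γ p i j * omegaFun g hφ hU p q :=
  FlatConnection.der_eq_sum_christoffel dzDer (omegaFun_inv_mul g hφ hU) i j q

/-! ### Evaluation of series with smooth coefficients -/

/-- Evaluation of a series with smooth coefficients at a point. -/
def seriesEv (u : U) : MvPowerSeries (Fin n) (SmoothFun U) →+* MvPowerSeries (Fin n) ℂ :=
  MvPowerSeries.map (ev u)

theorem coeff_seriesEv (u : U) (d : Fin n →₀ ℕ) (F : MvPowerSeries (Fin n) (SmoothFun U)) :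
    coeff d (seriesEv u F) = ev u (coeff d F) := rfl

theorem seriesEv_C (u : U) (f : SmoothFun U) : seriesEv u (C f) = C (ev u f) := map_C _ _

theorem seriesEv_X (u : U) (i : Fin n) :
    seriesEv u (MvPowerSeries.X i) = MvPowerSeries.X i := map_X _ _

theorem seriesEv_ext {F G : MvPowerSeries (Fin n) (SmoothFun U)}
    (h : ∀ u, seriesEv u F = seriesEv u G) : F = G := by
  ext d u
  exact congrArg (coeff d) (h u)

theorem seriesEv_pderiv (u : U) (i : Fin n) (F : MvPowerSeries (Fin n) (SmoothFun U)) :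
    seriesEv u (pderiv _ i F) = pderiv ℂ i (seriesEv u F) := by
  ext d
  rw [coeff_seriesEv, coeff_pderiv, coeff_pderiv, coeff_seriesEv, map_mul, map_add, map_natCast,
    map_one]

theorem seriesEv_coeffDeriv_dz (i : Fin n) {F' : MvPowerSeries (Fin n) (SmoothFun U)}
    {F : CSpace n → MvPowerSeries (Fin n) ℂ} (hF : ∀ u : U, seriesEv u F' = F u) (u : U) :
    seriesEv u (coeffDeriv (dzDer i) F') = dzSeries i F u := by
  ext d
  rw [coeff_seriesEv, coeff_coeffDeriv]
  exact ev_dzDer i _ (fun u => congrArg (coeff d) (hF u)) u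

theorem seriesEv_coeffDeriv_dzbar (i : Fin n) {F' : MvPowerSeries (Fin n) (SmoothFun U)}
    {F : CSpace n → MvPowerSeries (Fin n) ℂ} (hF : ∀ u : U, seriesEv u F' = F u) (u : U) :
    seriesEv u (coeffDeriv (dzbarDer i) F') = dzbarSeries i F u := by
  ext d
  rw [coeff_seriesEv, coeff_coeffDeriv]
  exact ev_dzbarDer i _ (fun u => congrArg (coeff d) (hF u)) u

/-- The series with smooth coefficients attached to a smooth family of series. -/
def liftSeries (F : CSpace n → MvPowerSeries (Fin n) ℂ)
    (hF : ∀ d, ContDiffOn ℝ ∞ (fun z => coeff d (F z)) U) :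
    MvPowerSeries (Fin n) (SmoothFun U) := fun d => ofFun _ (hF d)

theorem seriesEv_liftSeries (F : CSpace n → MvPowerSeries (Fin n) ℂ)
    (hF : ∀ d, ContDiffOn ℝ ∞ (fun z => coeff d (F z)) U) (u : U) :
    seriesEv u (liftSeries F hF) = F u := rfl

theorem contDiffOn_coeff_of_seriesEv {F' : MvPowerSeries (Fin n) (SmoothFun U)}
    {F : CSpace n → MvPowerSeries (Fin n) ℂ} (hF : ∀ u : U, seriesEv u F' = F u)
    (d : Fin n →₀ ℕ) : ContDiffOn ℝ ∞ (fun z => coeff d (F z)) U := by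
  refine (coeff d F').contDiffOn_toFun.congr fun z hz => ?_
  have := congrArg (coeff d) (hF ⟨z, hz⟩)
  rw [coeff_seriesEv, ← toFun_apply] at this
  exact this.symm

theorem seriesEv_nabla (i : Fin n) {F' : MvPowerSeries (Fin n) (SmoothFun U)}
    {F : CSpace n → MvPowerSeries (Fin n) ℂ} (hF : ∀ u : U, seriesEv u F' = F u) (u : U) :
    seriesEv u ((kahlerConn g hφ hU).nabla i F') = nablaSeries g φ i F u := by
  rw [FlatConnection.nabla_apply, kahlerConn_der, map_sub, seriesEv_coeffDeriv_dz i hF, map_sum,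
    nablaSeries]
  simp only [map_sum, map_mul, seriesEv_C, seriesEv_X, seriesEv_pderiv, hF, ev_kahlerConn_Γ]

theorem curvatureTerm_eq (l : Fin n) (m : ℕ) (p : Fin n) (u : U) :
    seriesEv u ((kahlerConn g hφ hU).curvTerm (dzbarDer l) m p) =
      curvatureTerm g φ l m p u := by
  induction m using Nat.strong_induction_on generalizing p u with
  | _ m ih =>
    match m, ih with
    | 0, _ => exact map_zero _
    | 1, _ => exact map_zero _
    | 2, _ =>
      simp only [FlatConnection.curvTerm, curvatureTerm, map_sum, map_mul, seriesEv_C, seriesEv_X,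
        ev_algebraMap]
      refine Finset.sum_congr rfl fun i _ => Finset.sum_congr rfl fun j _ => ?_
      rw [ev_dzbarDer l _ fun u => ev_kahlerConn_Γ g hφ hU u p i j]
    | m + 3, ih =>
      have ih' := fun p u => ih (m + 2) (by omega) p u
      have hm : (((m + 2 : ℕ) : ℂ) + 1) = (m : ℂ) + 3 := by push_cast; ring
      simp only [FlatConnection.curvTerm, curvatureTerm, FlatConnection.raise,
        FlatConnection.twist, FlatConnection.tangentForm, map_sum, map_mul, map_add, seriesEv_C,
        seriesEv_X, ev_algebraMap, ih', ev_kahlerConn_Γ, hm]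
      congr 1
      refine Finset.sum_congr rfl fun i _ => ?_
      rw [seriesEv_nabla g hφ hU i (fun u => ih' p u)]

theorem curvatureSum_eq (l p : Fin n) (u : U) :
    seriesEv u ((kahlerConn g hφ hU).curvSum (dzbarDer l) p) = curvatureSum g φ l p u := by
  ext d
  have h := congrArg (coeff d) (curvatureTerm_eq g hφ hU l d.degree p u)
  exact h

theorem ricciTerm_eq (l : Fin n) (m : ℕ) (u : U) :
    seriesEv u ((kahlerConn g hφ hU).ricTerm (dzbarDer l) m) = ricciTerm g φ l m u := by
  induction m using Nat.strong_induction_on generalizing u with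
  | _ m ih =>
    match m, ih with
    | 0, _ => exact map_zero _
    | 1, _ =>
      simp only [FlatConnection.ricTerm, ricciTerm, map_neg, map_sum, map_mul, seriesEv_C,
        seriesEv_X]
      refine congrArg _ (Finset.sum_congr rfl fun i _ => ?_)
      congr 1
      refine Finset.sum_congr rfl fun p _ => ?_
      rw [ev_dzbarDer l _ fun u => ev_kahlerConn_Γ g hφ hU u p p i]
    | m + 2, ih =>
      have ih' := fun u => ih (m + 1) (by omega) u
      simp only [FlatConnection.ricTerm, ricciTerm, map_sum, map_mul, seriesEv_C, seriesEv_X,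
        ev_algebraMap]
      congr 1
      exact Finset.sum_congr rfl fun i _ => by rw [seriesEv_nabla g hφ hU i ih']

theorem ricciSum_eq (l : Fin n) (u : U) :
    seriesEv u ((kahlerConn g hφ hU).ricSum (dzbarDer l)) = ricciSum g φ l u := by
  ext d
  have h := congrArg (coeff d) (ricciTerm_eq g hφ hU l d.degree u)
  exact h

end LocalGeometry

/-! ### The Fedosov connection as an equation on series -/

section Fedosov

open Topology TopologicalSpace SmoothFun MvPowerSeries

variable {n : ℕ} {X : Type*} [TopologicalSpace X] {L : X → Type*}
  [TopologicalSpace (TotalSpace ℂ L)]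

theorem isOpen_domain (φ : OpenPartialHomeomorph X (CSpace n)) (e : Trivialization ℂ (π ℂ L)) :
    IsOpen (domain φ e) := φ.isOpen_inter_preimage_symm e.open_baseSet

/-- The domain of a chart and a trivialization as an open set. -/
def domainOpens (φ : OpenPartialHomeomorph X (CSpace n)) (e : Trivialization ℂ (π ℂ L)) :
    Opens (CSpace n) := ⟨domain φ e, isOpen_domain φ e⟩

theorem subset_target {φ : OpenPartialHomeomorph X (CSpace n)} (e : Trivialization ℂ (π ℂ L))
    {U : Opens (CSpace n)} (hUe : (U : Set (CSpace n)) ⊆ domain φ e) :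
    (U : Set (CSpace n)) ⊆ φ.target := fun _ hz => (hUe hz).1

variable [∀ x, AddCommGroup (L x)] [∀ x, Module ℂ (L x)]

theorem frame_ne_zero (e : Trivialization ℂ (π ℂ L)) [e.IsLinear ℂ] {x : X} (hx : x ∈ e.baseSet) :
    e.symm x (1 : ℂ) ≠ 0 := by
  intro h
  have h1 := e.linearMapAt_symmₗ (R := ℂ) hx 1
  rw [e.coe_symmₗ hx, h, map_zero] at h1
  exact one_ne_zero h1.symm

variable [ChartedSpace (CSpace n) X] [∀ x, TopologicalSpace (L x)] [FiberBundle ℂ L]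

variable (h : LineMetric n L) {φ : OpenPartialHomeomorph X (CSpace n)}
  (hφ : φ ∈ atlas (CSpace n) X) (e : Trivialization ℂ (π ℂ L)) [MemTrivializationAtlas e]
  {U : Opens (CSpace n)}

/-- The squared norm of the holomorphic frame of the trivialization `e`. -/
def frameNorm (φ : OpenPartialHomeomorph X (CSpace n)) (e : Trivialization ℂ (π ℂ L))
    (z : CSpace n) : ℝ :=
  (h.inner (φ.symm z) (e.symm (φ.symm z) 1) (e.symm (φ.symm z) 1)).re

variable [VectorBundle ℂ ℂ L]

theorem frameNorm_pos {z : CSpace n} (hz : z ∈ domain φ e) : 0 < frameNorm h φ e z :=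
  h.pos _ _ (frame_ne_zero e hz.2)

include hφ in
omit [VectorBundle ℂ ℂ L] in
theorem contDiffOn_frameNorm : ContDiffOn ℝ ∞ (frameNorm h φ e) (domain φ e) := h.smooth φ hφ e

variable (hUe : (U : Set (CSpace n)) ⊆ domain φ e)

/-- The logarithm of the squared norm of the holomorphic frame. -/
def logNorm : SmoothFun U :=
  ofFun (fun w => ((Real.log (frameNorm h φ e w) : ℝ) : ℂ))
    (Complex.ofRealCLM.contDiff.comp_contDiffOn
      (((contDiffOn_frameNorm h hφ e).log fun _ hz => (frameNorm_pos h e hz).ne').mono hUe))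

/-- The connection form of `L^{⊗k}` in the holomorphic frame. -/
def kappa (k : ℕ) (i : Fin n) : SmoothFun U :=
  algebraMap ℂ _ (k : ℂ) * dzDer i (logNorm h hφ e hUe)

theorem ev_dzDer_logNorm (i : Fin n) (u : U) :
    ev u (dzDer i (logNorm h hφ e hUe)) = chernForm h φ e i u :=
  ev_dzDer i _ (fun _ => rfl) u

theorem ev_kappa (k : ℕ) (i : Fin n) (u : U) :
    ev u (kappa h hφ e hUe k i) = k * chernForm h φ e i u := by
  rw [kappa, map_mul, ev_dzDer_logNorm, ev_algebraMap]

theorem algebraMap_mul_der (D : Derivation ℂ (SmoothFun U) (SmoothFun U)) (c : ℂ)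
    (f : SmoothFun U) : D (algebraMap ℂ _ c * f) = algebraMap ℂ _ c * D f := by
  rw [← Algebra.smul_def, Derivation.map_smul, Algebra.smul_def]

theorem bfActionScalar_X_some (B : Matrix (Fin n) (Fin n) ℂ) (k : ℕ) (f : MvPowerSeries (Fin n) ℂ)
    (j : Fin n) (F : MvPowerSeries (Fin n) ℂ) :
    bfActionScalar B k (MvPolynomial.C f * MvPolynomial.X (some j)) F =
      hbar k • ∑ p, B j p • pderiv ℂ p (f * F) := by
  rw [bfActionScalar_mul_X_some, bfActionScalar_C]

theorem hbar_ne_zero {k : ℕ} (hk : 0 < k) : hbar k ≠ 0 :=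
  div_ne_zero Complex.I_ne_zero (Nat.cast_ne_zero.2 hk.ne')

variable [IsManifold 𝓘(ℂ, CSpace n) ω X] (g : KahlerMetric n X)

theorem omega_mul_omegaInv (hφ : φ ∈ atlas (CSpace n) X) {z : CSpace n} (hz : z ∈ φ.target) :
    omega g φ z * omegaInv g φ z = 1 :=
  Matrix.mul_nonsing_inv _ (isUnit_det_omega g hφ hz)

include hφ in
omit [VectorBundle ℂ ℂ L] [MemTrivializationAtlas e] in
/-- The first term of `γ_BT` acts as `-ħ ∂/∂yⁱ`, because `ω_{ij̄}` is contracted with its inverse.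
-/
theorem fedosovHol_eq {k : ℕ} (hk : 0 < k) (i : Fin n) (F : CSpace n → MvPowerSeries (Fin n) ℂ)
    {z : CSpace n} (hz : z ∈ φ.target) :
    fedosovHol g h k φ e i F z = nablaSeries g φ i F z +
      C (k * chernForm h φ e i z) * F z - pderiv ℂ i (F z) := by
  have key : bfActionScalar (omegaInv g φ z) k (gammaHol g φ i z) (F z) =
      -(hbar k • pderiv ℂ i (F z)) := by
    rw [gammaHol, bfActionScalar_neg, bfActionScalar_sum]
    simp only [bfActionScalar_X_some, pderiv_C_mul, ← Finset.smul_sum]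
    congr 2
    simp only [← smul_eq_C_mul, smul_smul]
    rw [Finset.sum_comm]
    simp only [← Finset.sum_smul]
    have h1 : ∀ p, ∑ j, omegaInv g φ z j p * omega g φ z i j = if i = p then 1 else 0 := by
      intro p
      rw [← Matrix.one_apply, ← omega_mul_omegaInv g hφ hz, Matrix.mul_apply]
      exact Finset.sum_congr rfl fun _ _ => mul_comm _ _
    simp [h1]
  rw [fedosovHol, key, smul_neg, smul_smul, inv_mul_cancel₀ (hbar_ne_zero hk), one_smul,
    sub_eq_add_neg]

include hφ in
/-- The factor `ȳʲ` of `I` acts as a derivative after multiplication by the curvature series, which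
is why the derivative also falls on that series. -/
theorem fedosovAnti_eq {k : ℕ} (hk : 0 < k) (l : Fin n) (F : CSpace n → MvPowerSeries (Fin n) ℂ)
    {z : CSpace n} (hz : z ∈ φ.target) :
    fedosovAnti g k φ l F z = dzbarSeries l F z +
      (hbar k)⁻¹ • ((∑ i, C (omega g φ z i l) * MvPowerSeries.X i) * F z) +
      ∑ p, pderiv ℂ p (curvatureSum g φ l p z * F z) + ricciSum g φ l z * F z := by
  have key : ∑ j, bfActionScalar (omegaInv g φ z) k (MvPolynomial.C (∑ p, curvatureSum g φ l p z *
      C (omega g φ z p j)) * MvPolynomial.X (some j)) (F z) =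
      hbar k • ∑ p, pderiv ℂ p (curvatureSum g φ l p z * F z) := by
    simp only [bfActionScalar_X_some, ← Finset.smul_sum]
    congr 1
    rw [Finset.sum_comm]
    refine Finset.sum_congr rfl fun p _ => ?_
    simp only [← Derivation.map_smul]
    rw [← map_sum]
    congr 1
    simp only [smul_eq_C_mul, Finset.mul_sum, Finset.sum_mul]
    rw [Finset.sum_comm]
    have h1 : ∀ q, ∑ j, omega g φ z q j * omegaInv g φ z j p = if q = p then 1 else 0 := by
      intro q
      rw [← Matrix.one_apply, ← omega_mul_omegaInv g hφ hz, Matrix.mul_apply]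
    have h2 : ∀ q, ∑ j, C (omegaInv g φ z j p) * (curvatureSum g φ l q z * C (omega g φ z q j) *
        F z) = C (if q = p then 1 else 0) * (curvatureSum g φ l q z * F z) := by
      intro q
      rw [← h1, map_sum, Finset.sum_mul]
      exact Finset.sum_congr rfl fun _ _ => by rw [map_mul]; ring
    simp only [h2]
    rw [Finset.sum_eq_single p (fun q _ hq => by simp [hq]) (by simp)]
    simp
  rw [fedosovAnti, gammaAnti, bfActionScalar_add, bfActionScalar_add, bfActionScalar_sum, key,
    bfActionScalar_C, bfActionScalar_mul_X_none, bfActionScalar_C, smul_add, smul_add, smul_smul,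
    smul_smul, inv_mul_cancel₀ (hbar_ne_zero hk), one_smul, one_smul, add_assoc, add_assoc,
    add_assoc]

/-! ### Local flat sections -/

/-- A smooth family of series over `U` solving the `dzⁱ` components of the Fedosov equation, that is
`∂_{yⁱ} F = ∇_i F`. -/
def IsParallelOn (k : ℕ) (φ : OpenPartialHomeomorph X (CSpace n)) (e : Trivialization ℂ (π ℂ L))
    (U : Opens (CSpace n)) (F : CSpace n → MvPowerSeries (Fin n) ℂ) : Prop :=
  (∀ d, ContDiffOn ℝ ∞ (fun z => coeff d (F z)) U) ∧
    ∀ z ∈ U, ∀ i, pderiv ℂ i (F z) =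
      nablaSeries g φ i F z + C (k * chernForm h φ e i z) * F z

variable {h g}

omit [VectorBundle ℂ ℂ L] [MemTrivializationAtlas e] [IsManifold 𝓘(ℂ, CSpace n) ω X] in
theorem IsParallelOn.mono {k : ℕ} {U V : Opens (CSpace n)} (hVU : V ≤ U)
    {F : CSpace n → MvPowerSeries (Fin n) ℂ} (hF : IsParallelOn h g k φ e U F) :
    IsParallelOn h g k φ e V F :=
  ⟨fun d => (hF.1 d).mono hVU, fun z hz => hF.2 z (hVU hz)⟩

/-- A family of series is parallel iff the series with smooth coefficients representing it is. -/
theorem isParallelOn_iff {k : ℕ} {F' : MvPowerSeries (Fin n) (SmoothFun U)}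
    {F : CSpace n → MvPowerSeries (Fin n) ℂ} (hF : ∀ u : U, seriesEv u F' = F u) :
    IsParallelOn h g k φ e U F ↔ ∀ i, pderiv _ i F' =
      (kahlerConn g hφ (subset_target e hUe)).nabla i F' + C (kappa h hφ e hUe k i) * F' := by
  have key : ∀ (i : Fin n) (u : U), seriesEv u ((kahlerConn g hφ (subset_target e hUe)).nabla i F' +
      C (kappa h hφ e hUe k i) * F') =
      nablaSeries g φ i F u + C (k * chernForm h φ e i u) * F u := by
    intro i u
    rw [map_add, map_mul, seriesEv_nabla g hφ _ i hF, seriesEv_C, ev_kappa, hF]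
  constructor
  · intro H i
    refine seriesEv_ext fun u => ?_
    rw [key, seriesEv_pderiv, hF]
    exact H.2 u u.2 i
  · intro H
    refine ⟨contDiffOn_coeff_of_seriesEv hF, fun z hz i => ?_⟩
    have := congrArg (seriesEv ⟨z, hz⟩) (H i)
    rw [key, seriesEv_pderiv, hF] at this
    exact this

include hφ hUe in
/-- A parallel family is determined by its symbol. -/
theorem IsParallelOn.eqOn {k : ℕ} {F G : CSpace n → MvPowerSeries (Fin n) ℂ}
    (hF : IsParallelOn h g k φ e U F) (hG : IsParallelOn h g k φ e U G)
    (h0 : ∀ z ∈ U, constantCoeff (F z) = constantCoeff (G z)) : Set.EqOn F G U := by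
  intro z hz
  have hF' := (isParallelOn_iff hφ e hUe (seriesEv_liftSeries F hF.1)).1 hF
  have hG' := (isParallelOn_iff hφ e hUe (seriesEv_liftSeries G hG.1)).1 hG
  have hE := (kahlerConn g hφ (subset_target e hUe)).eq_zero_of_parallel (ι := Unit)
    (fun i _ _ => kappa h hφ e hUe k i) (E := fun _ => liftSeries F hF.1 - liftSeries G hG.1)
    (fun i _ => by
      simp only [FlatConnection.twist, Finset.univ_unique, Finset.sum_singleton, map_sub, hF', hG']
      ring)
    (fun _ => by
      ext u
      rw [map_sub, map_sub, map_zero, sub_eq_zero]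
      exact h0 u u.2) ()
  have := congrArg (seriesEv ⟨z, hz⟩) hE
  rw [map_sub, map_zero, sub_eq_zero] at this
  exact this

variable (h g) in
include hφ hUe in
/-- Every smooth symbol extends to a parallel family: the one-component case of
`FlatConnection.parallel`, the connection form `k ∂ log |e|²` of the frame being `∂`-closed.
-/
theorem exists_isParallelOn (k : ℕ) {s : CSpace n → ℂ} (hs : ContDiffOn ℝ ∞ s U) :
    ∃ F : CSpace n → MvPowerSeries (Fin n) ℂ, IsParallelOn h g k φ e U F ∧
      ∀ z ∈ U, constantCoeff (F z) = s z := by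
  classical
  set D := kahlerConn g hφ (subset_target e hUe) with hD
  set M : Fin n → Unit → Unit → SmoothFun U := fun i _ _ => kappa h hφ e hUe k i with hM
  have hMflat : D.IsFlatForm M := by
    intro i j _ _
    have : dzDer i (kappa h hφ e hUe k j) = dzDer j (kappa h hφ e hUe k i) := by
      simp only [kappa, algebraMap_mul_der, dzDer_comm i j]
    simp only [hM, Finset.univ_unique, Finset.sum_singleton, hD, kahlerConn_der, this]
    ring
  set F' := D.parallel M (fun _ => ofFun s hs) () with hF'
  have hF : ∀ u : U, seriesEv u F' = (fun z => if hz : z ∈ U then seriesEv ⟨z, hz⟩ F' else 0) u :=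
    fun u => by simp
  refine ⟨fun z => if hz : z ∈ U then seriesEv ⟨z, hz⟩ F' else 0,
    (isParallelOn_iff hφ e hUe hF).2 fun i => ?_, fun z hz => ?_⟩
  · have := D.pderiv_parallel M hMflat (fun _ => ofFun s hs) i ()
    simpa [FlatConnection.twist, hM] using this
  · have h1 := D.constantCoeff_parallel M (fun _ => ofFun s hs) ()
    simp only [dif_pos hz]
    exact congrArg (ev ⟨z, hz⟩) h1

include hφ hUe in
/-- The `dz̄ˡ` components of the Fedosov equation follow from the `dzⁱ` components and the
holomorphicity of the symbol. -/
theorem IsParallelOn.fedosovAnti_eq_zero (hL : IsPrequantum g h) {k : ℕ} (hk : 0 < k)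
    {F : CSpace n → MvPowerSeries (Fin n) ℂ} (hF : IsParallelOn h g k φ e U F) (l : Fin n)
    (h0 : ∀ z ∈ U, dzbar l (fun z => constantCoeff (F z)) z = 0) {z : CSpace n} (hz : z ∈ U) :
    fedosovAnti g k φ l F z = 0 := by
  set D := kahlerConn g hφ (subset_target e hUe) with hD
  set δ : Derivation ℂ (SmoothFun U) (SmoothFun U) := dzbarDer l with hδ
  set κ := kappa h hφ e hUe k with hκ
  set F' := liftSeries F hF.1 with hF'
  have hFF' := seriesEv_liftSeries F hF.1
  have hδc : ∀ i r, δ (D.der i r) = D.der i (δ r) := fun i r => dzbarDer_dzDer l i r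
  have hw0 : ∀ j, δ (κ j) = algebraMap ℂ _ (k * Complex.I) *
      omegaFun g hφ (subset_target e hUe) j l := by
    intro j
    ext u
    rw [hκ, kappa, algebraMap_mul_der, map_mul, map_mul, ev_algebraMap, ev_algebraMap, hδ,
      ev_dzbarDer l _ (ev_dzDer_logNorm h hφ e hUe j)]
    have h1 := hL φ hφ e u (hUe u.2) j l
    have h2 : ev u (omegaFun g hφ (subset_target e hUe) j l) = omega g φ u j l := rfl
    rw [h2, h1]
    linear_combination (k * dzbar l (chernForm h φ e j) u) * Complex.I_mul_I
  have hw : ∀ i j, D.der i (δ (κ j)) = ∑ q, D.Γ q i j * δ (κ q) := by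
    intro i j
    simp only [hw0, hD, kahlerConn_der, algebraMap_mul_der, dzDer_omegaFun, Finset.mul_sum]
    exact Finset.sum_congr rfl fun _ _ => by ring
  have hpar := (isParallelOn_iff hφ e hUe hFF').1 hF
  have hs0 : δ (constantCoeff F') = 0 := by
    ext u
    rw [hδ, ev_dzbarDer l _ (F := fun z => constantCoeff (F z)) fun u => rfl, h0 u u.2, map_zero]
  have hanti := D.antiholomorphic_of_parallel δ hδc κ hw hpar hs0
  have hdiv := D.sum_pderiv_curvSum δ hδc
  have h1 := congrArg (seriesEv ⟨z, hz⟩) hanti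
  have h2 := congrArg (seriesEv ⟨z, hz⟩) hdiv
  simp only [map_add, map_sub, map_sum, map_mul, map_zero, map_neg, seriesEv_pderiv, seriesEv_C,
    seriesEv_X, hD, hδ, curvatureSum_eq, ricciSum_eq, hFF'] at h1 h2
  rw [seriesEv_coeffDeriv_dzbar l hFF'] at h1
  rw [fedosovAnti_eq hφ g hk l F (hUe hz).1]
  have h3 : (hbar k)⁻¹ • ((∑ i, C (omega g φ z i l) * MvPowerSeries.X i) * F z) =
      -((∑ i, C (ev (⟨z, hz⟩ : U) ((dzbarDer l) (κ i))) * MvPowerSeries.X i) * F z) := by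
    rw [← neg_mul, ← smul_mul_assoc, ← Finset.sum_neg_distrib, Finset.smul_sum]
    congr 1
    refine Finset.sum_congr rfl fun i _ => ?_
    rw [← hδ, hw0, map_mul, ev_algebraMap, smul_eq_C_mul, ← mul_assoc, ← neg_mul, ← map_mul,
      ← map_neg]
    congr 2
    change _ = -(k * Complex.I * omega g φ z i l)
    have hk0 : (k : ℂ) ≠ 0 := Nat.cast_ne_zero.2 hk.ne'
    rw [hbar, inv_div, div_eq_mul_inv, Complex.inv_I]
    ring
  rw [h3]
  simp only [Derivation.leibniz, smul_eq_mul, Finset.sum_add_distrib]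
  rw [← Finset.mul_sum, h2]
  linear_combination h1

end Fedosov

/-! ### Change of chart and of holomorphic frame -/

section Transition

open Topology TopologicalSpace SmoothFun MvPowerSeries

variable {n : ℕ}

/-- Composition with a smooth map, as a homomorphism of algebras of smooth functions. -/
def SmoothFun.comp {U V : Opens (CSpace n)} (ψ : CSpace n → CSpace n) (hψ : ContDiffOn ℝ ∞ ψ V)
    (hm : Set.MapsTo ψ V U) : SmoothFun U →+* SmoothFun V where
  toFun f := ofFun (fun z => f.toFun (ψ z)) (f.contDiffOn_toFun.comp hψ hm)
  map_one' := by
    ext v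
    exact toFun_apply 1 ⟨ψ v, hm v.2⟩
  map_mul' f f' := by
    ext v
    exact (toFun_apply _ ⟨ψ v, hm v.2⟩).trans (congrArg₂ (· * ·)
      (toFun_apply _ ⟨ψ v, hm v.2⟩).symm (toFun_apply _ ⟨ψ v, hm v.2⟩).symm)
  map_zero' := by
    ext v
    exact toFun_apply 0 ⟨ψ v, hm v.2⟩
  map_add' f f' := by
    ext v
    exact (toFun_apply _ ⟨ψ v, hm v.2⟩).trans (congrArg₂ (· + ·)
      (toFun_apply _ ⟨ψ v, hm v.2⟩).symm (toFun_apply _ ⟨ψ v, hm v.2⟩).symm)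

theorem SmoothFun.ev_comp {U V : Opens (CSpace n)} (ψ : CSpace n → CSpace n)
    (hψ : ContDiffOn ℝ ∞ ψ V) (hm : Set.MapsTo ψ V U) (f : SmoothFun U) (v : V) :
    ev v (SmoothFun.comp ψ hψ hm f) = ev ⟨ψ v, hm v.2⟩ f :=
  toFun_apply f ⟨ψ v, hm v.2⟩

section ChangeVar

variable {Q R : Type*} [CommRing Q] [CommRing R] (h : Q →+* R) (J : Matrix (Fin n) (Fin n) R)

theorem hasSubst_linearForm : HasSubst fun p => ∑ j, C (J p j) * (MvPowerSeries.X j :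
    MvPowerSeries (Fin n) R) :=
  hasSubst_of_constantCoeff_zero fun i => by simp

/-- The homomorphism of power series rings which is `h` on coefficients and sends `yᵖ` to
`∑ J p j yʲ`. -/
def changeVar : MvPowerSeries (Fin n) Q →+* MvPowerSeries (Fin n) R :=
  (substAlgHom (R := R) (hasSubst_linearForm J)).toRingHom.comp (MvPowerSeries.map h)

theorem changeVar_C (q : Q) : changeVar h J (C q) = C (h q) := by
  change substAlgHom (R := R) (hasSubst_linearForm J) (MvPowerSeries.map h (C q)) = _
  rw [map_C]
  exact (substAlgHom (R := R) (hasSubst_linearForm J)).commutes (h q)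

theorem changeVar_X (p : Fin n) :
    changeVar h J (MvPowerSeries.X p) = ∑ j, C (J p j) * MvPowerSeries.X j := by
  change substAlgHom (R := R) (hasSubst_linearForm J) (MvPowerSeries.map h (MvPowerSeries.X p)) = _
  rw [map_X, substAlgHom_X]

end ChangeVar

theorem seriesEv_changeVar {U V : Opens (CSpace n)} (ψ : CSpace n → CSpace n)
    (hψ : ContDiffOn ℝ ∞ ψ V) (hm : Set.MapsTo ψ V U) (J : Matrix (Fin n) (Fin n) (SmoothFun V))
    (v : V) (F : MvPowerSeries (Fin n) (SmoothFun U)) :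
    seriesEv v (changeVar (SmoothFun.comp ψ hψ hm) J F) =
      changeSeries (J.map (ev v)) (seriesEv ⟨ψ v, hm v.2⟩ F) := by
  have h : (seriesEv v).comp (changeVar (SmoothFun.comp ψ hψ hm) J) =
      (changeSeries (J.map (ev v))).toRingHom.comp (seriesEv ⟨ψ v, hm v.2⟩) := by
    have hX : ∀ i, ((seriesEv v).comp (changeVar (SmoothFun.comp ψ hψ hm) J)) (MvPowerSeries.X i) =
        ∑ j, C (ev v (J i j)) * MvPowerSeries.X j := by
      intro i
      simp only [RingHom.comp_apply, changeVar_X, map_sum, map_mul, seriesEv_C, seriesEv_X]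
    refine ringHom_ext_of_constantCoeff _ _ (fun i => ?_) (fun c => ?_) fun i => ?_
    · rw [hX]
      simp
    · change seriesEv v (changeVar (SmoothFun.comp ψ hψ hm) J (C c)) =
        changeSeries (J.map (ev v)) (seriesEv ⟨ψ v, hm v.2⟩ (C c))
      rw [changeVar_C, seriesEv_C, seriesEv_C, changeSeries_C, SmoothFun.ev_comp]
    · rw [hX]
      change _ = changeSeries (J.map (ev v)) (seriesEv ⟨ψ v, hm v.2⟩ (MvPowerSeries.X i))
      rw [seriesEv_X, changeSeries_X]
      rfl
  exact congrArg (fun Φ : MvPowerSeries (Fin n) (SmoothFun U) →+* _ => Φ F) h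

theorem dz_log_mul {f : CSpace n → ℝ} {z : CSpace n} (hf : DifferentiableAt ℝ f z)
    (h0 : f z ≠ 0) (i : Fin n) :
    dz i (fun w => ((Real.log (f w) : ℝ) : ℂ)) z * f z = dz i (fun w => (f w : ℂ)) z := by
  have h1 : fderiv ℝ (fun w => ((Real.log (f w) : ℝ) : ℂ)) z =
      Complex.ofRealCLM.comp ((f z)⁻¹ • fderiv ℝ f z) :=
    (Complex.ofRealCLM.hasFDerivAt.comp z (hf.hasFDerivAt.log h0)).fderiv
  have h2 : fderiv ℝ (fun w => ((f w : ℝ) : ℂ)) z = Complex.ofRealCLM.comp (fderiv ℝ f z) :=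
    (Complex.ofRealCLM.hasFDerivAt.comp z hf.hasFDerivAt).fderiv
  have h3 : (f z : ℂ) ≠ 0 := Complex.ofReal_ne_zero.2 h0
  simp only [dz, h1, h2, ContinuousLinearMap.comp_apply, _root_.smul_apply,
    Complex.ofRealCLM_apply, smul_eq_mul, Complex.ofReal_mul, Complex.ofReal_inv]
  field_simp

variable {X : Type*} [TopologicalSpace X] [ChartedSpace (CSpace n) X]
  [IsManifold 𝓘(ℂ, CSpace n) ω X]
  {L : X → Type*} [TopologicalSpace (TotalSpace ℂ L)]
  [∀ x, AddCommGroup (L x)] [∀ x, Module ℂ (L x)] [∀ x, TopologicalSpace (L x)]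
  [FiberBundle ℂ L] [VectorBundle ℂ ℂ L] [ContMDiffVectorBundle ω ℂ L 𝓘(ℂ, CSpace n)]

/-- The coordinate of the frame of `e` in the frame of `e'`. -/
def frameChange (e e' : Trivialization ℂ (π ℂ L)) [e'.IsLinear ℂ] (x : X) : ℂ :=
  e'.linearMapAt ℂ x (e.symm x 1)

omit [ChartedSpace (CSpace n) X] [IsManifold 𝓘(ℂ, CSpace n) ω X]
  [∀ x, TopologicalSpace (L x)] [FiberBundle ℂ L] [VectorBundle ℂ ℂ L]
  [ContMDiffVectorBundle ω ℂ L 𝓘(ℂ, CSpace n)] in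
theorem symm_eq_smul (e : Trivialization ℂ (π ℂ L)) [e.IsLinear ℂ] {x : X} (hx : x ∈ e.baseSet)
    (v : L x) : v = e.linearMapAt ℂ x v • e.symm x (1 : ℂ) := by
  have h := e.symmₗ_linearMapAt (R := ℂ) hx v
  conv_lhs => rw [← h]
  rw [← e.coe_symmₗ (R := ℂ) hx, ← map_smul, smul_eq_mul, mul_one]

variable {φ φ' : OpenPartialHomeomorph X (CSpace n)}
  (hφ : φ ∈ atlas (CSpace n) X) (hφ' : φ' ∈ atlas (CSpace n) X)
  (e e' : Trivialization ℂ (π ℂ L)) [MemTrivializationAtlas e] [MemTrivializationAtlas e']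

include hφ' in
theorem contDiffOn_frameChange :
    ContDiffOn ℂ ω (fun z => frameChange e e' (φ'.symm z)) (domain φ' e ∩ domain φ' e') := by
  have h1 : ContMDiffOn 𝓘(ℂ, CSpace n) 𝓘(ℂ, CSpace n) ω φ'.symm φ'.target :=
    contMDiffOn_symm_of_mem_maximalAtlas (IsManifold.subset_maximalAtlas hφ')
  have h2 := (contMDiffOn_coordChangeL (n := ω) (IB := 𝓘(ℂ, CSpace n)) e e').comp
    (h1.mono fun (z : CSpace n) (hz : z ∈ domain φ' e ∩ domain φ' e') => hz.1.1)
    fun z hz => ⟨hz.1.2, hz.2.2⟩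
  have h3 := (contMDiffOn_iff_contDiffOn.1 h2).clm_apply (contDiffOn_const (c := (1 : ℂ)))
  refine h3.congr fun z hz => ?_
  change frameChange e e' (φ'.symm z) = (e.coordChangeL ℂ e' (φ'.symm z)) 1
  rw [e.coordChangeL_apply e' ⟨hz.1.2, hz.2.2⟩, frameChange, e'.coe_linearMapAt_of_mem hz.2.2]

variable (h : LineMetric n L)

omit [IsManifold 𝓘(ℂ, CSpace n) ω X] [ContMDiffVectorBundle ω ℂ L 𝓘(ℂ, CSpace n)]
  [MemTrivializationAtlas e] in
theorem frameNorm_transition {z : CSpace n}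
    (hzφ : φ'.symm z ∈ φ.source) (hze' : φ'.symm z ∈ e'.baseSet) :
    (frameNorm h φ e (transition φ' φ z) : ℂ) = frameChange e e' (φ'.symm z) *
      conj (frameChange e e' (φ'.symm z)) * frameNorm h φ' e' z := by
  set x := φ'.symm z with hx
  have h1 : φ.symm (transition φ' φ z) = x := φ.left_inv hzφ
  have h2 : frameNorm h φ e (transition φ' φ z) =
      (h.inner x (e.symm x 1) (e.symm x 1)).re := by
    rw [frameNorm, h1]
  have h3 : ∀ v : L x, ((h.inner x v v).re : ℂ) = h.inner x v v := by
    intro v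
    exact Complex.conj_eq_iff_re.1 (h.conj_symm x v v)
  rw [h2, h3]
  conv_lhs => rw [symm_eq_smul e' hze' (e.symm x 1)]
  change _ = _ * ((h.inner x (e'.symm x 1) (e'.symm x 1)).re : ℂ)
  rw [h3]
  simp only [map_smulₛₗ, LinearMap.smul_apply, smul_eq_mul, RingHom.id_apply]
  simp only [frameChange]
  ring

end Transition

section ParallelTransition

open Topology TopologicalSpace SmoothFun MvPowerSeries

theorem ContDiffOn.real_smooth {E F : Type*} [NormedAddCommGroup E] [NormedSpace ℂ E]
    [NormedAddCommGroup F] [NormedSpace ℂ F] {f : E → F} {s : Set E} (hf : ContDiffOn ℂ ω f s) :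
    ContDiffOn ℝ ∞ f s :=
  (hf.of_le le_top).restrict_scalars ℝ

theorem dzDer_conj_holomorphic {n : ℕ} {V : Opens (CSpace n)} {f : CSpace n → ℂ}
    (hf : ContDiffOn ℂ ω f V) {F : SmoothFun V}
    (hF : ∀ v : V, ev v F = conj (f v)) (i : Fin n) : dzDer i F = 0 := by
  ext v
  rw [ev_dzDer i F (F := fun z => conj (f z)) hF, map_zero]
  exact dz_conj_of_holomorphic
    ((hf.contDiffAt (V.isOpen.mem_nhds v.2)).differentiableAt (by simp)) i

theorem subset_domain_inter {n : ℕ} {X : Type*} [TopologicalSpace X]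
    {φ φ' : OpenPartialHomeomorph X (CSpace n)} {U V : Opens (CSpace n)}
    (hV : (V : Set (CSpace n)) ⊆ φ'.target ∩ φ'.symm ⁻¹' φ.source)
    {L : X → Type*} [TopologicalSpace (TotalSpace ℂ L)] (e e' : Trivialization ℂ (π ℂ L))
    (hUe : (U : Set (CSpace n)) ⊆ domain φ e) (hVe : (V : Set (CSpace n)) ⊆ domain φ' e')
    (hm : Set.MapsTo (transition φ' φ) V U) :
    (V : Set (CSpace n)) ⊆ domain φ' e ∩ domain φ' e' := by
  intro z hz
  refine ⟨⟨(hV hz).1, ?_⟩, hVe hz⟩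
  have := (hUe (hm hz)).2
  rwa [Set.mem_preimage, transition, φ.left_inv (hV hz).2] at this

variable {n : ℕ} {X : Type*} [TopologicalSpace X] [ChartedSpace (CSpace n) X]
  [IsManifold 𝓘(ℂ, CSpace n) ω X] {φ φ' : OpenPartialHomeomorph X (CSpace n)}
  (hφ : φ ∈ atlas (CSpace n) X) (hφ' : φ' ∈ atlas (CSpace n) X) {U V : Opens (CSpace n)}
  (hV : (V : Set (CSpace n)) ⊆ φ'.target ∩ φ'.symm ⁻¹' φ.source)

include hφ hφ' hV

theorem contDiffOn_jacobian (a i : Fin n) :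
    ContDiffOn ℂ ω (fun z => jacobian φ' φ z a i) V := by
  have h1 := ((contDiffOn_transition hφ' hφ).mono hV).fderiv_of_isOpen V.isOpen (m := ω) le_top
  exact contDiffOn_pi.1 (h1.clm_apply contDiffOn_const) a

/-- The Jacobian matrix of the transition map with entries in the algebra of smooth functions. -/
def jacobianFun : Matrix (Fin n) (Fin n) (SmoothFun V) := fun a i =>
  ofFun _ (ContDiffOn.real_smooth (contDiffOn_jacobian hφ hφ' hV a i))

/-- The complex conjugate of the Jacobian matrix of the transition map. -/
def jacobianConjFun : Matrix (Fin n) (Fin n) (SmoothFun V) := fun a i =>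
  ofFun (fun z => conj (jacobian φ' φ z a i)) (Complex.conjCLE.contDiff.comp_contDiffOn
    (ContDiffOn.real_smooth (contDiffOn_jacobian hφ hφ' hV a i)))

theorem contDiffOn_real_transition : ContDiffOn ℝ ∞ (transition φ' φ) V :=
  ContDiffOn.real_smooth ((contDiffOn_transition hφ' hφ).mono hV)

theorem dzDer_comp (hm : Set.MapsTo (transition φ' φ) V U) (i : Fin n) (q : SmoothFun U) :
    dzDer i (SmoothFun.comp (transition φ' φ) (contDiffOn_real_transition hφ hφ' hV) hm q) =
      ∑ a, jacobianFun hφ hφ' hV a i *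
        SmoothFun.comp (transition φ' φ) (contDiffOn_real_transition hφ hφ' hV) hm (dzDer a q) := by
  ext v
  rw [ev_dzDer i _ (F := fun z => q.toFun (transition φ' φ z)) fun v => rfl, map_sum]
  rw [dz_comp_holomorphic (differentiableAt_toFun q ⟨_, hm v.2⟩)
    ((((contDiffOn_transition hφ' hφ).mono hV).contDiffAt
      (V.isOpen.mem_nhds v.2)).differentiableAt (by simp))]
  refine Finset.sum_congr rfl fun a _ => ?_
  rw [map_mul, SmoothFun.ev_comp, ev_dzDer a q fun u => (toFun_apply q u).symm]
  rfl

theorem christoffelLaw_transition (g : KahlerMetric n X) (hU : (U : Set (CSpace n)) ⊆ φ.target)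
    (hm : Set.MapsTo (transition φ' φ) V U) :
    FlatConnection.ChristoffelLaw (kahlerConn g hφ hU)
      (kahlerConn g hφ' (hV.trans Set.inter_subset_left))
      (SmoothFun.comp (transition φ' φ) (contDiffOn_real_transition hφ hφ' hV) hm)
      (jacobianFun hφ hφ' hV) := by
  refine FlatConnection.christoffelLaw_of_kahler _ _ _ _ (W := omegaFun g hφ hU)
    (W' := omegaFun g hφ' (hV.trans Set.inter_subset_left))
    (V' := (omegaFun g hφ' (hV.trans Set.inter_subset_left))⁻¹)
    (fun i j q => dzDer_omegaFun g hφ hU i j q)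
    (fun i j q => dzDer_omegaFun g hφ' _ i j q)
    (Matrix.mul_nonsing_inv _ (isUnit_det_omegaFun g hφ' _)) (dzDer_comp hφ hφ' hV hm)
    (jacobianConjFun hφ hφ' hV) (fun i a b => ?_) ?_
  · exact dzDer_conj_holomorphic (contDiffOn_jacobian hφ hφ' hV a b) (fun _ => rfl) i
  · ext i j v
    have h1 := congrFun (congrFun (omega_transition g hφ' hφ (hV v.2)) i) j
    refine h1.trans ?_
    simp only [Matrix.mul_apply, map_sum, map_mul, Matrix.map_apply, Matrix.transpose_apply,
      SmoothFun.ev_comp]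
    rfl

variable {L : X → Type*} [TopologicalSpace (TotalSpace ℂ L)]
  [∀ x, AddCommGroup (L x)] [∀ x, Module ℂ (L x)] [∀ x, TopologicalSpace (L x)]
  [FiberBundle ℂ L] [VectorBundle ℂ ℂ L] [ContMDiffVectorBundle ω ℂ L 𝓘(ℂ, CSpace n)]
  (e e' : Trivialization ℂ (π ℂ L)) [MemTrivializationAtlas e] [MemTrivializationAtlas e']
  (h : LineMetric n L) (g : KahlerMetric n X)
  (hUe : (U : Set (CSpace n)) ⊆ domain φ e) (hVe : (V : Set (CSpace n)) ⊆ domain φ' e')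
  (hm : Set.MapsTo (transition φ' φ) V U)

include hUe hVe hm in
/-- The transformation law of the Chern connection form: the norms of the frames differ by the
squared modulus of the holomorphic function `frameChange e e'`. -/
theorem dz_frameChange (i : Fin n) {c : SmoothFun V}
    (hc : ∀ v : V, ev v c = frameChange e e' (φ'.symm v)) (k : ℕ) :
    dzDer i (c ^ k) + kappa h hφ' e' hVe k i * c ^ k =
      c ^ k * ∑ a, jacobianFun hφ hφ' hV a i *
        SmoothFun.comp (transition φ' φ) (contDiffOn_real_transition hφ hφ' hV) hm
          (kappa h hφ e hUe k a) := by
  have hcd : ContDiffOn ℂ ω (fun z => frameChange e e' (φ'.symm z)) V :=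
    (contDiffOn_frameChange hφ' e e').mono
      (subset_domain_inter hV e e' hUe hVe hm)
  set hh := SmoothFun.comp (transition φ' φ) (contDiffOn_real_transition hφ hφ' hV) hm with hhh
  set θ : Fin n → SmoothFun U := fun a => dzDer a (logNorm h hφ e hUe) with hθ
  set θ' : SmoothFun V := dzDer i (logNorm h hφ' e' hVe) with hθ'
  set N : SmoothFun U := ofFun (fun w => (frameNorm h φ e w : ℂ))
    (Complex.ofRealCLM.contDiff.comp_contDiffOn ((contDiffOn_frameNorm h hφ e).mono hUe)) with hN
  set N' : SmoothFun V := ofFun (fun w => (frameNorm h φ' e' w : ℂ))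
    (Complex.ofRealCLM.contDiff.comp_contDiffOn ((contDiffOn_frameNorm h hφ' e').mono hVe)) with hN'
  set cbar : SmoothFun V := ofFun (fun z => conj (frameChange e e' (φ'.symm z)))
    (Complex.conjCLE.contDiff.comp_contDiffOn (ContDiffOn.real_smooth hcd)) with hcbar
  have hdN : ∀ a, dzDer a N = θ a * N := by
    intro a
    ext u
    rw [ev_dzDer a N (F := fun w => (frameNorm h φ e w : ℂ)) (fun _ => rfl), map_mul, hθ,
      ev_dzDer_logNorm]
    exact (dz_log_mul (((contDiffOn_frameNorm h hφ e).contDiffAt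
      ((isOpen_domain φ e).mem_nhds (hUe u.2))).differentiableAt (by simp))
      (frameNorm_pos h e (hUe u.2)).ne' a).symm
  have hdN' : dzDer i N' = θ' * N' := by
    ext v
    rw [ev_dzDer i N' (F := fun w => (frameNorm h φ' e' w : ℂ)) (fun _ => rfl), map_mul, hθ',
      ev_dzDer_logNorm]
    exact (dz_log_mul (((contDiffOn_frameNorm h hφ' e').contDiffAt
      ((isOpen_domain φ' e').mem_nhds (hVe v.2))).differentiableAt (by simp))
      (frameNorm_pos h e' (hVe v.2)).ne' i).symm
  have hNN' : hh N = c * cbar * N' := by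
    ext v
    rw [hhh, SmoothFun.ev_comp, map_mul, map_mul, hc]
    exact frameNorm_transition e e' h (hV v.2).2 (hVe v.2).2
  have hdcbar : dzDer i cbar = 0 := dzDer_conj_holomorphic hcd (fun _ => rfl) i
  have hmain : dzDer i c + θ' * c = c * ∑ a, jacobianFun hφ hφ' hV a i * hh (θ a) := by
    have hu : IsUnit (cbar * N') := by
      refine isUnit_of_ne_zero fun v => ?_
      have h1 : ev v (c * cbar * N') ≠ 0 := by
        rw [← hNN', hhh, SmoothFun.ev_comp]
        exact Complex.ofReal_ne_zero.2 (frameNorm_pos h e (hUe (hm v.2))).ne'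
      rw [mul_assoc, map_mul] at h1
      exact right_ne_zero_of_mul h1
    refine hu.mul_right_cancel ?_
    have h1 := dzDer_comp hφ hφ' hV hm i N
    rw [← hhh, hNN'] at h1
    simp only [hdN, map_mul, hNN', Derivation.leibniz, smul_eq_mul, hdcbar, hdN', mul_zero,
      zero_add] at h1
    have h2 : ∑ a, jacobianFun hφ hφ' hV a i * (hh (θ a) * (c * cbar * N')) =
        (∑ a, jacobianFun hφ hφ' hV a i * hh (θ a)) * (c * cbar * N') := by
      rw [Finset.sum_mul]
      exact Finset.sum_congr rfl fun _ _ => by ring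
    rw [h2] at h1
    linear_combination h1
  have hhk : ∀ a, hh (kappa h hφ e hUe k a) = algebraMap ℂ _ (k : ℂ) * hh (θ a) := by
    intro a
    rw [kappa, map_mul]
    congr 1
    ext v
    rw [hhh, SmoothFun.ev_comp, ev_algebraMap, ev_algebraMap]
  have h3 : ∑ a, jacobianFun hφ hφ' hV a i * hh (kappa h hφ e hUe k a) =
      algebraMap ℂ _ (k : ℂ) * ∑ a, jacobianFun hφ hφ' hV a i * hh (θ a) := by
    rw [Finset.mul_sum]
    exact Finset.sum_congr rfl fun _ _ => by rw [hhk]; ring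
  rw [h3, kappa, ← hθ', map_natCast]
  clear h3 hhk
  generalize (∑ a, jacobianFun hφ hφ' hV a i * hh (θ a)) = S at hmain ⊢
  induction k with
  | zero => simp
  | succ k ih =>
    rw [pow_succ, Derivation.leibniz, smul_eq_mul, smul_eq_mul, Nat.cast_succ]
    linear_combination c * ih + c ^ k * hmain

include hφ hφ' hUe hVe hV hm in
/-- Parallel families of series correspond to each other under a change of chart and of frame. -/
theorem IsParallelOn.change {h : LineMetric n L} {g : KahlerMetric n X} {k : ℕ}
    {F : CSpace n → MvPowerSeries (Fin n) ℂ} (hF : IsParallelOn h g k φ e U F) :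
    IsParallelOn h g k φ' e' V fun z => C (frameChange e e' (φ'.symm z) ^ k) *
      changeSeries (jacobian φ' φ z) (F (transition φ' φ z)) := by
  have hcd : ContDiffOn ℂ ω (fun z => frameChange e e' (φ'.symm z)) V :=
    (contDiffOn_frameChange hφ' e e').mono
      (subset_domain_inter hV e e' hUe hVe hm)
  set c : SmoothFun V := ofFun _ (ContDiffOn.real_smooth hcd) with hc
  set Φ := changeVar (SmoothFun.comp (transition φ' φ)
    (contDiffOn_real_transition hφ hφ' hV) hm) (jacobianFun hφ hφ' hV) with hΦ
  have hpar := (isParallelOn_iff hφ e hUe (seriesEv_liftSeries F hF.1)).1 hF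
  refine (isParallelOn_iff hφ' e' hVe (F' := C (c ^ k) * Φ (liftSeries F hF.1))
    fun v => ?_).2 ?_
  · rw [map_mul, seriesEv_C, map_pow, hΦ, seriesEv_changeVar]
    rfl
  · intro i
    exact FlatConnection.parallel_change Φ (changeVar_C _ _) (changeVar_X _ _)
      (dzDer_comp hφ hφ' hV hm) (christoffelLaw_transition hφ hφ' hV g
        (subset_target e hUe) hm)
      (fun i => dz_frameChange hφ hφ' hV e e' h hUe hVe hm i (fun _ => rfl) k) hpar i

end ParallelTransition

/-! ### Tensor powers of the line -/

section PowCoord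

variable {X : Type*} [TopologicalSpace X] {L : X → Type*} [TopologicalSpace (TotalSpace ℂ L)]
  [∀ x, AddCommGroup (L x)] [∀ x, Module ℂ (L x)] (k : ℕ)
  (e e' : Trivialization ℂ (π ℂ L)) [e.IsLinear ℂ] [e'.IsLinear ℂ]

/-- The `k`-th tensor power of the frame of the trivialization `e`. -/
def framePow (x : X) : ⨂[ℂ]^k (L x) := PiTensorProduct.tprod ℂ fun _ => e.symm x (1 : ℂ)

theorem powCoord_tprod (x : X) (v : Fin k → L x) :
    powCoord k e x (PiTensorProduct.tprod ℂ v) = ∏ i, e.linearMapAt ℂ x (v i) := by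
  rw [powCoord, PiTensorProduct.lift.tprod]
  simp

omit [e.IsLinear ℂ] in
theorem powCoord_framePow (x : X) : powCoord k e' x (framePow k e x) = frameChange e e' x ^ k := by
  rw [framePow, powCoord_tprod]
  simp [frameChange]

theorem eq_powCoord_smul_framePow {x : X} (hx : x ∈ e.baseSet) (T : ⨂[ℂ]^k (L x)) :
    T = powCoord k e x T • framePow k e x := by
  have h : (LinearMap.id : (⨂[ℂ]^k (L x)) →ₗ[ℂ] _) =
      (powCoord k e x).smulRight (framePow k e x) := by
    refine PiTensorProduct.ext (MultilinearMap.ext fun v => ?_)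
    change PiTensorProduct.tprod ℂ v = powCoord k e x (PiTensorProduct.tprod ℂ v) • framePow k e x
    rw [powCoord_tprod, framePow, ← MultilinearMap.map_smul_univ]
    congr 1
    funext i
    exact symm_eq_smul e hx (v i)
  exact congrArg (fun f : (⨂[ℂ]^k (L x)) →ₗ[ℂ] _ => f T) h

theorem powCoord_injective {x : X} (hx : x ∈ e.baseSet) :
    Function.Injective (powCoord k e x) := by
  intro S T h
  rw [eq_powCoord_smul_framePow k e hx S, h, ← eq_powCoord_smul_framePow k e hx T]

theorem powCoord_change {x : X} (hx : x ∈ e.baseSet) (T : ⨂[ℂ]^k (L x)) :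
    powCoord k e' x T = frameChange e e' x ^ k * powCoord k e x T := by
  conv_lhs => rw [eq_powCoord_smul_framePow k e hx T]
  rw [map_smul, powCoord_framePow, smul_eq_mul, mul_comm]

/-- The coordinates in the frame of `e` of a series with coefficients in the `k`-th tensor power. -/
def coordSeries {n : ℕ} (x : X) (T : SeriesIn n (⨂[ℂ]^k (L x))) : MvPowerSeries (Fin n) ℂ :=
  fun d => powCoord k e x (T d)

theorem coeff_coordSeries {n : ℕ} (x : X) (T : SeriesIn n (⨂[ℂ]^k (L x))) (d : Fin n →₀ ℕ) :
    MvPowerSeries.coeff d (coordSeries k e x T) = powCoord k e x (T d) := rfl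

end PowCoord

/-! ### Flat sections of the Bargmann--Fock sheaf -/

section Global

open Topology TopologicalSpace SmoothFun MvPowerSeries

variable {n : ℕ} {X : Type*} [TopologicalSpace X] [ChartedSpace (CSpace n) X]
  [IsManifold 𝓘(ℂ, CSpace n) ω X]
  {L : X → Type*} [TopologicalSpace (TotalSpace ℂ L)]
  [∀ x, AddCommGroup (L x)] [∀ x, Module ℂ (L x)] [∀ x, TopologicalSpace (L x)]
  [FiberBundle ℂ L] [VectorBundle ℂ ℂ L]
  {g : KahlerMetric n X} {h : LineMetric n L} {k : ℕ}
  {φ φ' : OpenPartialHomeomorph X (CSpace n)}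
  (hφ : φ ∈ atlas (CSpace n) X) (hφ' : φ' ∈ atlas (CSpace n) X)
  (e e' : Trivialization ℂ (π ℂ L)) [MemTrivializationAtlas e] [MemTrivializationAtlas e']

omit [IsManifold 𝓘(ℂ, CSpace n) ω X] in
theorem localFock_eq (O : ∀ x, SeriesIn n (⨂[ℂ]^k (L x))) (z : CSpace n) :
    localFock O φ e z =
      changeSeries (frameMatrix φ z) (coordSeries k e (φ.symm z) (O (φ.symm z))) := rfl

omit [IsManifold 𝓘(ℂ, CSpace n) ω X] in
theorem constantCoeff_localFock (O : ∀ x, SeriesIn n (⨂[ℂ]^k (L x))) (z : CSpace n) :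
    constantCoeff (localFock O φ e z) = localSection (symbol O) φ e z :=
  constantCoeff_changeSeries _ _

include hφ in
theorem IsParallelOn.congr {U : Opens (CSpace n)} (hUe : (U : Set (CSpace n)) ⊆ domain φ e)
    {F G : CSpace n → MvPowerSeries (Fin n) ℂ}
    (hF : IsParallelOn h g k φ e U F) (hFG : Set.EqOn G F U) : IsParallelOn h g k φ e U G :=
  (isParallelOn_iff hφ e hUe (F' := liftSeries F hF.1) fun u => (hFG u.2).symm).2
    ((isParallelOn_iff hφ e hUe (seriesEv_liftSeries F hF.1)).1 hF)

include hφ in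
theorem IsFlat.isParallelOn (hk : 0 < k) {O : ∀ x, SeriesIn n (⨂[ℂ]^k (L x))}
    (hO : IsFlat g h O) : IsParallelOn h g k φ e (domainOpens φ e) (localFock O φ e) := by
  refine ⟨(hO φ hφ e).1, fun z hz i => ?_⟩
  have h1 := ((hO φ hφ e).2 z hz i).1
  rw [fedosovHol_eq h hφ e g hk i _ hz.1, sub_eq_zero] at h1
  exact h1.symm

/-- For a holomorphic symbol the `dzⁱ` components of the Fedosov equation in all charts suffice. -/
theorem isFlat_of_isParallelOn (hL : IsPrequantum g h) (hk : 0 < k)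
    {O : ∀ x, SeriesIn n (⨂[ℂ]^k (L x))} (hO : IsHolomorphicSection n (symbol O))
    (H : ∀ φ ∈ atlas (CSpace n) X, ∀ (e : Trivialization ℂ (π ℂ L)) [MemTrivializationAtlas e],
      IsParallelOn h g k φ e (domainOpens φ e) (localFock O φ e)) : IsFlat g h O := by
  intro φ hφ e _
  refine ⟨(H φ hφ e).1, fun z hz i => ⟨?_, ?_⟩⟩
  · rw [fedosovHol_eq h hφ e g hk i _ hz.1, (H φ hφ e).2 z hz i, sub_self]
  · refine (H φ hφ e).fedosovAnti_eq_zero hφ e subset_rfl hL hk i (fun w hw => ?_) hz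
    simp only [constantCoeff_localFock]
    exact (hO φ hφ e).2 w hw i

include hφ in
theorem localFock_injective {z : CSpace n} (hz : z ∈ domain φ e)
    {O O' : ∀ x, SeriesIn n (⨂[ℂ]^k (L x))} (hO : localFock O φ e z = localFock O' φ e z) :
    O (φ.symm z) = O' (φ.symm z) := by
  have inv : ∀ H, changeSeries (coframeMatrix φ z) (changeSeries (frameMatrix φ z) H) = H := by
    intro H
    rw [← changeSeries_mul_apply, frame_mul_coframe hφ hz.1, changeSeries_one_apply]
  have h1 := (inv _).symm.trans ((congrArg (changeSeries (coframeMatrix φ z)) hO).trans (inv _))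
  funext d
  exact powCoord_injective k e hz.2 (congrFun h1 d)

/-- A flat section is determined by its symbol. -/
theorem IsFlat.eq_of_symbol_eq (hk : 0 < k) {O O' : ∀ x, SeriesIn n (⨂[ℂ]^k (L x))}
    (hO : IsFlat g h O) (hO' : IsFlat g h O') (hs : symbol O = symbol O') : O = O' := by
  funext x
  have hφ := chart_mem_atlas (CSpace n) x
  set φ := chartAt (CSpace n) x with hφx
  set e := trivializationAt ℂ L x with hex
  have hx : φ.symm (φ x) = x := φ.left_inv (mem_chart_source _ x)
  have hz : φ x ∈ domain φ e := ⟨φ.map_source (mem_chart_source _ x), by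
    rw [Set.mem_preimage, hx]; exact mem_baseSet_trivializationAt ℂ L x⟩
  have h1 := (hO.isParallelOn hφ e hk).eqOn hφ e subset_rfl (hO'.isParallelOn hφ e hk)
    (fun z _ => by rw [constantCoeff_localFock, constantCoeff_localFock, hs]) hz
  have h2 := localFock_injective hφ e hz h1
  rwa [hx] at h2

variable [ContMDiffVectorBundle ω ℂ L 𝓘(ℂ, CSpace n)]

include hφ hφ' in
/-- Local parallel families with the same symbol agree where their domains overlap. -/
theorem IsParallelOn.eq_transition {s : ∀ x, ⨂[ℂ]^k (L x)}
    {F F' : CSpace n → MvPowerSeries (Fin n) ℂ}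
    (hF : IsParallelOn h g k φ e (domainOpens φ e) F)
    (hF0 : ∀ z ∈ domain φ e, constantCoeff (F z) = localSection s φ e z)
    (hF' : IsParallelOn h g k φ' e' (domainOpens φ' e') F')
    (hF0' : ∀ z ∈ domain φ' e', constantCoeff (F' z) = localSection s φ' e' z)
    {z : CSpace n} (hz : z ∈ domain φ' e') (hzφ : φ'.symm z ∈ φ.source)
    (hze : φ'.symm z ∈ e.baseSet) :
    F' z = C (frameChange e e' (φ'.symm z) ^ k) *
      changeSeries (jacobian φ' φ z) (F (transition φ' φ z)) := by
  let V : Opens (CSpace n) := domainOpens φ' e' ⊓ ⟨_, isOpen_overlap φ' φ⟩ ⊓ domainOpens φ' e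
  have hVe : (V : Set (CSpace n)) ⊆ domain φ' e' := fun w hw => hw.1.1
  have hV : (V : Set (CSpace n)) ⊆ φ'.target ∩ φ'.symm ⁻¹' φ.source := fun w hw => hw.1.2
  have hback : ∀ w ∈ V, φ.symm (transition φ' φ w) = φ'.symm w := fun w hw =>
    φ.left_inv (hV hw).2
  have hm : Set.MapsTo (transition φ' φ) V (domainOpens φ e) := fun w hw =>
    ⟨φ.map_source (hV hw).2, by
      rw [Set.mem_preimage, hback w hw]
      exact hw.2.2⟩
  refine (hF'.mono e' (V := V) fun w hw => hw.1.1).eqOn hφ' e' hVe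
    (hF.change hφ hφ' hV e e' subset_rfl hVe hm) (fun w hw => ?_)
    ⟨⟨hz, hz.1, hzφ⟩, hz.1, hze⟩
  rw [hF0' w (hVe hw), map_mul, constantCoeff_C, constantCoeff_changeSeries, hF0 _ (hm hw),
    localSection, localSection, hback w hw, powCoord_change k e e' hw.2.2]

variable (h g) in
/-- The local parallel families with symbol `s` agree on overlaps by uniqueness, so they define a
global section. -/
theorem exists_isFlat (hL : IsPrequantum g h) (hk : 0 < k) {s : ∀ x, ⨂[ℂ]^k (L x)}
    (hs : IsHolomorphicSection n s) :
    ∃ O : ∀ x, SeriesIn n (⨂[ℂ]^k (L x)), IsFlat g h O ∧ symbol O = s := by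
  have hloc : ∀ (φ : OpenPartialHomeomorph X (CSpace n)) (_ : φ ∈ atlas (CSpace n) X)
      (e : Trivialization ℂ (π ℂ L)) [MemTrivializationAtlas e],
      ∃ F, IsParallelOn h g k φ e (domainOpens φ e) F ∧
        ∀ z ∈ domain φ e, constantCoeff (F z) = localSection s φ e z := fun φ hφ e _ =>
    exists_isParallelOn h hφ e subset_rfl g k (hs φ hφ e).1
  -- the value at `x` is computed in the preferred chart and trivialization at `x`
  choose F hF hF0 using fun x : X =>
    hloc (chartAt (CSpace n) x) (chart_mem_atlas _ x) (trivializationAt ℂ L x)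
  let O : ∀ x, SeriesIn n (⨂[ℂ]^k (L x)) := fun x d =>
    coeff d (changeSeries (coframeMatrix (chartAt (CSpace n) x) (chartAt (CSpace n) x x))
      (F x (chartAt (CSpace n) x x))) • framePow k (trivializationAt ℂ L x) x
  have hOF : ∀ (φ' : OpenPartialHomeomorph X (CSpace n)) (_ : φ' ∈ atlas (CSpace n) X)
      (e' : Trivialization ℂ (π ℂ L)) [MemTrivializationAtlas e']
      (F' : CSpace n → MvPowerSeries (Fin n) ℂ),
      IsParallelOn h g k φ' e' (domainOpens φ' e') F' →
      (∀ z ∈ domain φ' e', constantCoeff (F' z) = localSection s φ' e' z) →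
      Set.EqOn (localFock O φ' e') F' (domain φ' e') := by
    intro φ' hφ' e' _ F' hF' hF0' z hz
    set x := φ'.symm z with hx
    have hφ := chart_mem_atlas (CSpace n) x
    have hxφ := mem_chart_source (CSpace n) x
    rw [(hF x).eq_transition hφ hφ' (trivializationAt ℂ L x) e' (hF0 x) hF' hF0' hz hxφ
      (mem_baseSet_trivializationAt ℂ L x), localFock_eq]
    have h1 : coordSeries k e' x (O x) =
        C (frameChange (trivializationAt ℂ L x) e' x ^ k) *
          changeSeries (coframeMatrix (chartAt (CSpace n) x) (chartAt (CSpace n) x x))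
            (F x (chartAt (CSpace n) x x)) := by
      ext d
      rw [coeff_coordSeries, coeff_C_mul, mul_comm, ← powCoord_framePow, ← smul_eq_mul, ← map_smul]
    rw [← hx, h1, map_mul, changeSeries_C, ← changeSeries_mul_apply,
      frameMatrix_transition hφ' hφ ⟨hz.1, hxφ⟩, ← Matrix.mul_assoc]
    have h2 : transition φ' (chartAt (CSpace n) x) z = chartAt (CSpace n) x x := rfl
    rw [h2, coframe_mul_frame hφ ((chartAt (CSpace n) x).map_source hxφ), Matrix.one_mul]
  have hsymb : symbol O = s := by
    funext x
    have hφ := chart_mem_atlas (CSpace n) x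
    have hxφ := mem_chart_source (CSpace n) x
    set φ := chartAt (CSpace n) x with hφx
    set e := trivializationAt ℂ L x with hex
    have hx : φ.symm (φ x) = x := φ.left_inv hxφ
    have hz : φ x ∈ domain φ e := ⟨φ.map_source hxφ, by
      rw [Set.mem_preimage, hx]; exact mem_baseSet_trivializationAt ℂ L x⟩
    have h1 := hOF φ hφ e (F x) (hF x) (hF0 x) hz
    have h2 := congrArg constantCoeff h1
    rw [constantCoeff_localFock, hF0 x _ hz] at h2
    have h3 := powCoord_injective k e hz.2 h2
    rwa [hx] at h3
  refine ⟨O, isFlat_of_isParallelOn hL hk (hsymb ▸ hs) fun φ' hφ' e' _ => ?_, hsymb⟩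
  obtain ⟨F', hF', hF0'⟩ := hloc φ' hφ' e'
  exact hF'.congr hφ' e' subset_rfl (hOF φ' hφ' e' F' hF' hF0')

theorem flatLift_spec (hL : IsPrequantum g h) (hk : 0 < k) {s : ∀ x, ⨂[ℂ]^k (L x)}
    (hs : IsHolomorphicSection n s) :
    IsFlat g h (flatLift g h s) ∧ symbol (flatLift g h s) = s :=
  Classical.epsilon_spec (exists_isFlat g h hL hk hs)

end Global

/-! ### Iterated derivatives in the fibre variables -/

section IterDeriv

open MvPowerSeries

variable {n : ℕ} {R : Type*} [CommRing R]

/-- The iterated derivative `∂/∂y^{I_1} ⋯ ∂/∂y^{I_r}`. -/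
def iterDeriv : (r : ℕ) → (Fin r → Fin n) → MvPowerSeries (Fin n) R → MvPowerSeries (Fin n) R
  | 0, _, F => F
  | r + 1, I, F => pderiv R (I 0) (iterDeriv r (Fin.tail I) F)

theorem iterDeriv_cons {r : ℕ} (i : Fin n) (I : Fin r → Fin n) (F : MvPowerSeries (Fin n) R) :
    iterDeriv (r + 1) (Fin.cons i I) F = pderiv R i (iterDeriv r I F) := by
  rw [iterDeriv, Fin.cons_zero, Fin.tail_cons]

theorem iterDeriv_pderiv {r : ℕ} (I : Fin r → Fin n) (i : Fin n) (F : MvPowerSeries (Fin n) R) :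
    iterDeriv r I (pderiv R i F) = pderiv R i (iterDeriv r I F) := by
  induction r with
  | zero => rfl
  | succ r ih => rw [iterDeriv, ih, pderiv_comm, iterDeriv]

theorem iterDeriv_add {r : ℕ} (I : Fin r → Fin n) (F G : MvPowerSeries (Fin n) R) :
    iterDeriv r I (F + G) = iterDeriv r I F + iterDeriv r I G := by
  induction r with
  | zero => rfl
  | succ r ih => rw [iterDeriv, ih, map_add, iterDeriv, iterDeriv]

theorem iterDeriv_C_mul {r : ℕ} (I : Fin r → Fin n) (c : R) (F : MvPowerSeries (Fin n) R) :
    iterDeriv r I (C c * F) = C c * iterDeriv r I F := by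
  induction r with
  | zero => rfl
  | succ r ih => rw [iterDeriv, ih, pderiv_C_mul, iterDeriv]

/-- Commuting `∇_i` past `r` derivatives in the fibre produces one Christoffel term for each of
them, as in the covariant derivative of a covariant `r`-tensor. -/
theorem FlatConnection.iterDeriv_nabla [Algebra ℂ R] (D : FlatConnection n R) (i : Fin n) {r : ℕ}
    (I : Fin r → Fin n) (F : MvPowerSeries (Fin n) R) :
    iterDeriv r I (D.nabla i F) = D.nabla i (iterDeriv r I F) -
      ∑ a, ∑ q, C (D.Γ q i (I a)) * iterDeriv r (Function.update I a q) F := by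
  induction r with
  | zero => simp [iterDeriv]
  | succ r ih =>
    rw [iterDeriv, ih, Fin.sum_univ_succ, map_sub, D.pderiv_nabla]
    simp only [map_sum, pderiv_C_mul, iterDeriv, Function.update_self, Fin.tail_update_zero,
      Fin.tail_update_succ, ne_eq, not_false_eq_true,
      Function.update_of_ne, (Fin.succ_ne_zero _).symm, Fin.tail]
    ring

/-- The monomial `y^{I_1} ⋯ y^{I_r}`. -/
def yMonomial {r : ℕ} (I : Fin r → Fin n) : MvPowerSeries (Fin n) R := ∏ a, X (I a)

/-- Taylor's formula in degree `r`, summed over index tuples rather than exponents. -/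
theorem vanishesInDegree_taylor (r : ℕ) (F : MvPowerSeries (Fin n) R) :
    VanishesInDegree r (C (r.factorial : R) * F -
      ∑ I : Fin r → Fin n, C (constantCoeff (iterDeriv r I F)) * yMonomial I) := by
  induction r generalizing F with
  | zero =>
    rw [vanishesInDegree_zero_iff]
    simp [iterDeriv, yMonomial]
  | succ r ih =>
    have h1 : ∑ I : Fin (r + 1) → Fin n, C (constantCoeff (iterDeriv (r + 1) I F)) * yMonomial I =
        ∑ i, X i * ∑ I : Fin r → Fin n,
          C (constantCoeff (iterDeriv r I (pderiv R i F))) * yMonomial I := by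
      rw [← (Fin.consEquiv fun _ : Fin (r + 1) => Fin n).sum_comp, Fintype.sum_prod_type]
      refine Finset.sum_congr rfl fun i _ => ?_
      rw [Finset.mul_sum]
      refine Finset.sum_congr rfl fun I _ => ?_
      change C (constantCoeff (iterDeriv (r + 1) (Fin.cons i I) F)) * yMonomial (Fin.cons i I) = _
      rw [iterDeriv_cons, iterDeriv_pderiv, yMonomial, Fin.prod_univ_succ]
      simp only [Fin.cons_zero, Fin.cons_succ, yMonomial]
      ring
    have h2 : VanishesInDegree (r + 1) (∑ i, X i * (C (r.factorial : R) * pderiv R i F -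
        ∑ I : Fin r → Fin n, C (constantCoeff (iterDeriv r I (pderiv R i F))) * yMonomial I)) :=
      VanishesInDegree.sum fun i _ => (ih _).X_mul i
    have h3 : VanishesInDegree (r + 1) (C ((r + 1).factorial : R) * F -
        C (r.factorial : R) * ∑ i, X i * pderiv R i F) := by
      intro d hd
      rw [map_sub, coeff_C_mul, coeff_C_mul, coeff_sum_X_mul_pderiv, hd, Nat.factorial_succ]
      push_cast
      ring
    have h5 := h3.add h2
    rw [h1]
    refine (congrArg (VanishesInDegree (r + 1)) ?_).mp h5
    simp only [mul_sub, Finset.sum_sub_distrib, Finset.mul_sum]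
    have : ∑ i, X i * (C (r.factorial : R) * pderiv R i F) =
        ∑ i, C (r.factorial : R) * (X i * pderiv R i F) :=
      Finset.sum_congr rfl fun _ _ => by ring
    rw [this]
    ring

end IterDeriv

/-! ### Higher covariant derivatives of a section through its flat lift -/

section HigherDeriv

open Topology TopologicalSpace SmoothFun MvPowerSeries

/-- The involution exchanging the `a`-th entry of a tuple with an extra index. -/
theorem sum_update_swap {n r : ℕ} {R : Type*} [AddCommMonoid R]
    (K : (Fin r → Fin n) → (Fin r → Fin n) → R) (a : Fin r) :
    ∑ I, ∑ q, K I (Function.update I a q) = ∑ I, ∑ q, K (Function.update I a q) I := by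
  have hinv : Function.Involutive fun p : (Fin r → Fin n) × Fin n =>
      (Function.update p.1 a p.2, p.1 a) := by
    rintro ⟨I, q⟩
    simp
  rw [← Fintype.sum_prod_type', ← Fintype.sum_prod_type', ← Equiv.sum_comp hinv.toPerm]
  refine Finset.sum_congr rfl fun p _ => ?_
  simp

variable {n : ℕ} {X : Type*} [TopologicalSpace X] [ChartedSpace (CSpace n) X]
  [IsManifold 𝓘(ℂ, CSpace n) ω X]
  {L : X → Type*} [TopologicalSpace (TotalSpace ℂ L)]
  [∀ x, AddCommGroup (L x)] [∀ x, Module ℂ (L x)] [∀ x, TopologicalSpace (L x)]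
  [FiberBundle ℂ L] [VectorBundle ℂ ℂ L]
  {g : KahlerMetric n X} {h : LineMetric n L} {k : ℕ}
  {φ : OpenPartialHomeomorph X (CSpace n)} (hφ : φ ∈ atlas (CSpace n) X)
  (e : Trivialization ℂ (π ℂ L)) [MemTrivializationAtlas e]
  {U : Opens (CSpace n)} (hUe : (U : Set (CSpace n)) ⊆ domain φ e)

include hφ hUe in
/-- The covariant derivative of the symbol of a parallel series along a tensor is read off from the
Taylor coefficients of the series. -/
theorem localCovDeriv_eq {F : CSpace n → MvPowerSeries (Fin n) ℂ}
    (hF : IsParallelOn h g k φ e U F) {s : CSpace n → ℂ}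
    (hs : ∀ z ∈ U, s z = constantCoeff (F z)) {r : ℕ} {G : CSpace n → (Fin r → Fin n) → ℂ}
    (hG : ∀ I, ContDiffOn ℝ ∞ (fun z => G z I) U) {z : CSpace n} (hz : z ∈ U) :
    localCovDeriv g h k φ e r G s z = ∑ I, G z I * constantCoeff (iterDeriv r I (F z)) := by
  set D := kahlerConn g hφ (subset_target e hUe) with hD
  set κ := kappa h hφ e hUe k with hκ
  set F' := liftSeries F hF.1 with hF'
  have hpar := (isParallelOn_iff hφ e hUe (seriesEv_liftSeries F hF.1)).1 hF
  have hstep : ∀ {r : ℕ} (i : Fin n) (I : Fin r → Fin n),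
      constantCoeff (iterDeriv (r + 1) (Fin.cons i I) F') =
        dzDer i (constantCoeff (iterDeriv r I F')) + κ i * constantCoeff (iterDeriv r I F') -
          ∑ a, ∑ q, D.Γ q i (I a) * constantCoeff (iterDeriv r (Function.update I a q) F') := by
    intro r i I
    rw [iterDeriv_cons, ← iterDeriv_pderiv, hpar, iterDeriv_add, iterDeriv_C_mul,
      D.iterDeriv_nabla, map_add, map_sub, D.constantCoeff_nabla]
    simp only [map_sum, map_mul, constantCoeff_C, ← hκ]
    rw [hD, kahlerConn_der]
    ring
  have hev : ∀ {r : ℕ} (I : Fin r → Fin n) (u : U), ev u (constantCoeff (iterDeriv r I F')) =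
      constantCoeff (iterDeriv r I (F u)) := by
    intro r I u
    have : ∀ {r : ℕ} (I : Fin r → Fin n),
        seriesEv u (iterDeriv r I F') = iterDeriv r I (F u) := by
      intro r I
      induction r with
      | zero => rfl
      | succ r ih => rw [iterDeriv, seriesEv_pderiv, ih, iterDeriv]
    exact congrArg constantCoeff (this I)
  have main : ∀ (r : ℕ) (G' : (Fin r → Fin n) → SmoothFun U) (G : CSpace n → (Fin r → Fin n) → ℂ),
      (∀ (u : U) I, ev u (G' I) = G u I) → ∀ u : U,
      localCovDeriv g h k φ e r G s u =
        ev u (∑ I, G' I * constantCoeff (iterDeriv r I F')) := by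
    intro r
    induction r with
    | zero =>
      intro G' G hGG' u
      rw [Fintype.sum_unique, map_mul, hGG', hev]
      change G u Fin.elim0 * s u = _
      rw [hs u u.2, Subsingleton.elim default Fin.elim0]
      rfl
    | succ r ih =>
      intro G' G hGG' u
      have h1 := fun i : Fin n => ih (fun I => G' (Fin.cons i I)) (fun w I => G w (Fin.cons i I))
        (fun u I => hGG' u _)
      have h2 := fun i : Fin n => ih (fun I => dzDer i (G' (Fin.cons i I)) +
          ∑ a, ∑ q, D.Γ (I a) i q * G' (Fin.cons i (Function.update I a q)))
        (nablaTensor g φ i fun w I => G w (Fin.cons i I)) (fun u I => by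
          rw [map_add, ev_dzDer i _ (F := fun w => G w (Fin.cons i I)) fun u => hGG' u _,
            nablaTensor]
          simp only [map_sum, map_mul, hGG', hD, ev_kahlerConn_Γ])
      have h3 : ∀ i, dz i (localCovDeriv g h k φ e r (fun w I => G w (Fin.cons i I)) s) u =
          ev u (dzDer i (∑ I, G' (Fin.cons i I) * constantCoeff (iterDeriv r I F'))) :=
        fun i => (ev_dzDer i _ (fun u => (h1 i u).symm) u).symm
      rw [localCovDeriv]
      simp only [h1, h2, h3, ← ev_kappa h hφ e hUe, ← hκ]
      rw [← (Fin.consEquiv fun _ : Fin (r + 1) => Fin n).sum_comp, Fintype.sum_prod_type, map_sum]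
      refine Finset.sum_congr rfl fun i _ => ?_
      rw [← map_mul, ← map_add, ← map_sub]
      congr 1
      change _ = ∑ I : Fin r → Fin n,
        G' (Fin.cons i I) * constantCoeff (iterDeriv (r + 1) (Fin.cons i I) F')
      have h4 : ∑ I : Fin r → Fin n, (∑ a, ∑ q, D.Γ (I a) i q *
            G' (Fin.cons i (Function.update I a q))) * constantCoeff (iterDeriv r I F') =
          ∑ I : Fin r → Fin n, G' (Fin.cons i I) * ∑ a, ∑ q, D.Γ q i (I a) *
            constantCoeff (iterDeriv r (Function.update I a q) F') := by
        simp only [Finset.sum_mul, Finset.mul_sum]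
        rw [Finset.sum_comm, Finset.sum_comm (s := (Finset.univ : Finset (Fin r → Fin n)))]
        refine Finset.sum_congr rfl fun a _ => ?_
        have := sum_update_swap (fun I I' : Fin r → Fin n => D.Γ (I a) i (I' a) *
          G' (Fin.cons i I') * constantCoeff (iterDeriv r I F')) a
        simp only [Function.update_self] at this
        rw [this]
        exact Finset.sum_congr rfl fun _ _ => Finset.sum_congr rfl fun _ _ => by ring
      simp only [hstep, mul_sub, Finset.sum_sub_distrib]
      rw [← h4]
      simp only [add_mul, Finset.sum_add_distrib, map_sum, Derivation.leibniz, smul_eq_mul,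
        Finset.mul_sum, mul_add]
      have h5 : ∑ I : Fin r → Fin n, G' (Fin.cons i I) * (κ i * constantCoeff (iterDeriv r I F')) =
          ∑ I : Fin r → Fin n, κ i * (G' (Fin.cons i I) * constantCoeff (iterDeriv r I F')) :=
        Finset.sum_congr rfl fun _ _ => by ring
      have h6 : ∑ I : Fin r → Fin n,
            constantCoeff (iterDeriv r I F') * dzDer i (G' (Fin.cons i I)) =
          ∑ I : Fin r → Fin n, dzDer i (G' (Fin.cons i I)) * constantCoeff (iterDeriv r I F') :=
        Finset.sum_congr rfl fun _ _ => mul_comm _ _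
      rw [h5, h6]
      ring
  rw [main r (fun I => ofFun _ (hG I)) G (fun _ _ => rfl) ⟨z, hz⟩, map_sum]
  refine Finset.sum_congr rfl fun I _ => ?_
  rw [map_mul, hev]
  rfl

end HigherDeriv

/-! ### The symbol of the Bargmann--Fock action -/

section Symbol

open MvPowerSeries

variable {n : ℕ}

theorem constantCoeff_derivMonomial (e : Fin n →₀ ℕ) (F : MvPowerSeries (Fin n) ℂ) :
    constantCoeff (derivMonomial e F) = ((∏ i, (e i).factorial : ℕ) : ℂ) * coeff e F := by
  rw [← coeff_zero_eq_constantCoeff_apply, coeff_derivMonomial, zero_add]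
  simp [Nat.descFactorial_self]

/-- The functional `F ↦ σ(A ⊛ F)`, without the powers of `ħ`. -/
def wickFunctional (B : Matrix (Fin n) (Fin n) ℂ) (A : FiniteWeight n) :
    MvPowerSeries (Fin n) ℂ →ₗ[ℂ] ℂ where
  toFun F := ∑ a ∈ A.support, constantCoeff (diffOp (wickSymbol B a) (A.coeff a * F))
  map_add' F G := by
    simp only [mul_add, diffOp_map_add, map_add, Finset.sum_add_distrib]
  map_smul' c F := by
    rw [RingHom.id_apply, smul_eq_mul, Finset.mul_sum]
    refine Finset.sum_congr rfl fun a _ => ?_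
    rw [mul_smul_comm, diffOp_smul, smul_eq_C_mul, map_mul, constantCoeff_C]

theorem wickFunctional_apply (B : Matrix (Fin n) (Fin n) ℂ) (A : FiniteWeight n)
    (F : MvPowerSeries (Fin n) ℂ) : wickFunctional B A F =
      ∑ a ∈ A.support, constantCoeff (diffOp (wickSymbol B a) (A.coeff a * F)) := rfl

theorem degree_of_isHomogeneous {m : ℕ} {A : FiniteWeight n} (hA : A.IsHomogeneous m)
    {a : Option (Fin n) →₀ ℕ} (ha : a ∈ A.support) : a.degree = m := by
  rw [Finsupp.degree_eq_weight_one]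
  exact hA (MvPolynomial.mem_support_iff.1 ha)

/-- For `α` of fixed total degree in `ħ` and `ȳ` the level `k` enters only through a power of
`ħ`. -/
theorem constantCoeff_bfActionScalar (B : Matrix (Fin n) (Fin n) ℂ) (k : ℕ) {m : ℕ}
    {A : FiniteWeight n} (hA : A.IsHomogeneous m) (F : MvPowerSeries (Fin n) ℂ) :
    constantCoeff (bfActionScalar B k A F) = hbar k ^ m * wickFunctional B A F := by
  rw [bfActionScalar_eq, map_sum, wickFunctional_apply, Finset.mul_sum]
  refine Finset.sum_congr rfl fun a ha => ?_
  rw [degree_of_isHomogeneous hA ha, smul_eq_C_mul, map_mul, constantCoeff_C]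

theorem isHomogeneous_changeFiniteWeight (A : Matrix (Fin n) (Fin n) ℂ) {m : ℕ}
    {α : FiniteWeight n} (hα : α.IsHomogeneous m) :
    (changeFiniteWeight A α).IsHomogeneous m := by
  have h := hα.eval₂ (n := 1) (MvPolynomial.C.comp (changeSeries A).toRingHom) (fun o =>
    o.elim (MvPolynomial.X none) fun i =>
      ∑ j, MvPolynomial.C (C (conj (A i j))) * MvPolynomial.X (some j))
    (fun r => MvPolynomial.isHomogeneous_C _ _) (fun o => by
      cases o with
      | none => exact MvPolynomial.isHomogeneous_X _ _
      | some i => exact MvPolynomial.IsHomogeneous.sum _ _ _ fun j _ =>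
          MvPolynomial.isHomogeneous_C_mul_X _ _)
  rwa [one_mul] at h

/-- The functional is natural. This follows from naturality of the action at level one, where `ħ` is
invertible. -/
theorem wickFunctional_change {A B B' : Matrix (Fin n) (Fin n) ℂ}
    (hB : A.map conj * B' * A.transpose = B) {m : ℕ} {α : FiniteWeight n}
    (hα : α.IsHomogeneous m) (F : MvPowerSeries (Fin n) ℂ) :
    wickFunctional B' (changeFiniteWeight A α) (changeSeries A F) = wickFunctional B α F := by
  have h := congrArg constantCoeff (changeSeries_bfActionScalar 1 A hB α F)
  rw [constantCoeff_changeSeries, constantCoeff_bfActionScalar _ _ hα,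
    constantCoeff_bfActionScalar _ _ (isHomogeneous_changeFiniteWeight A hα)] at h
  exact (mul_left_cancel₀ (pow_ne_zero m (hbar_ne_zero one_pos)) h).symm

theorem IsBihomogeneous.isHomogeneous {l m : ℕ} {A : FiniteWeight n}
    (hA : IsBihomogeneous l m A) : A.IsHomogeneous m := by
  intro a ha
  obtain ⟨d, hd⟩ : ∃ d, coeff d (A.coeff a) ≠ 0 := by
    by_contra! h
    exact ha (MvPowerSeries.ext h)
  have := (hA a d hd).2.1
  rwa [Finsupp.degree_eq_weight_one] at this

theorem isHomogeneous_wickSymbol (B : Matrix (Fin n) (Fin n) ℂ) (a : Option (Fin n) →₀ ℕ) :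
    (wickSymbol B a).IsHomogeneous (∑ j, a (some j)) := by
  refine MvPolynomial.IsHomogeneous.prod _ _ _ fun j _ => ?_
  have h := (MvPolynomial.IsHomogeneous.sum Finset.univ
    (fun p => MvPolynomial.C (B j p) * MvPolynomial.X p) 1
    fun p _ => MvPolynomial.isHomogeneous_C_mul_X (B j p) p).pow (a (some j))
  rwa [one_mul] at h

/-- The exponents of a given degree, as a finite set. -/
def exponents (ι : Type*) [Fintype ι] [DecidableEq ι] (d : ℕ) : Finset (ι →₀ ℕ) :=
  Finset.univ.finsuppAntidiag d

theorem mem_exponents {ι : Type*} [Fintype ι] [DecidableEq ι] {d : ℕ} {a : ι →₀ ℕ} :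
    a ∈ exponents ι d ↔ a.degree = d := by
  simp [exponents, Finset.mem_finsuppAntidiag, Finsupp.degree_eq_sum]

theorem constantCoeff_diffOp_wickSymbol (B : Matrix (Fin n) (Fin n) ℂ) (a : Option (Fin n) →₀ ℕ)
    (F : MvPowerSeries (Fin n) ℂ) : constantCoeff (diffOp (wickSymbol B a) F) =
      ∑ e ∈ exponents (Fin n) (∑ j, a (some j)),
        (wickSymbol B a).coeff e * (((∏ i, (e i).factorial : ℕ) : ℂ) * coeff e F) := by
  have hs : (wickSymbol B a).support ⊆ exponents (Fin n) (∑ j, a (some j)) := by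
    intro e he
    rw [mem_exponents, Finsupp.degree_eq_weight_one]
    exact isHomogeneous_wickSymbol B a (MvPolynomial.mem_support_iff.1 he)
  rw [diffOp_eq_sum hs, map_sum]
  refine Finset.sum_congr rfl fun e _ => ?_
  rw [smul_eq_C_mul, map_mul, constantCoeff_C, constantCoeff_derivMonomial]

/-- On `Sym^l T*X ⊗ Sym^m T̄*X` the symbol of the action sees only the terms of degree `m - l`: the
`m` derivatives must use up the `l` new factors and everything else. -/
theorem wickFunctional_eq_zero (B : Matrix (Fin n) (Fin n) ℂ) {l m r : ℕ} (hr : m = l + r)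
    {A : FiniteWeight n} (hA : IsBihomogeneous l m A) {F : MvPowerSeries (Fin n) ℂ}
    (hF : VanishesInDegree r F) : wickFunctional B A F = 0 := by
  rw [wickFunctional_apply]
  refine Finset.sum_eq_zero fun a _ => ?_
  rw [constantCoeff_diffOp_wickSymbol]
  refine Finset.sum_eq_zero fun e he => ?_
  rw [mem_exponents] at he
  suffices h : coeff e (A.coeff a * F) = 0 by rw [h, mul_zero, mul_zero]
  classical
  rw [coeff_mul]
  refine Finset.sum_eq_zero fun p hp => ?_
  by_cases h1 : coeff p.1 (A.coeff a) = 0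
  · rw [h1, zero_mul]
  · obtain ⟨h0, hm, hl⟩ := hA a p.1 h1
    have h2 : a.degree = ∑ j, a (some j) := by
      rw [Finsupp.degree_eq_sum, Fintype.sum_option, h0, zero_add]
    have h3 := congrArg Finsupp.degree (Finset.HasAntidiagonal.mem_antidiagonal.1 hp)
    rw [map_add] at h3
    rw [hF p.2 (by omega), mul_zero]

theorem VanishesInDegree.changeSeries {r : ℕ} {F : MvPowerSeries (Fin n) ℂ}
    (hF : VanishesInDegree r F) (A : Matrix (Fin n) (Fin n) ℂ) :
    VanishesInDegree r (changeSeries A F) := by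
  induction r generalizing F with
  | zero =>
    rw [vanishesInDegree_zero_iff] at hF ⊢
    rw [constantCoeff_changeSeries, hF]
  | succ r ih =>
    refine vanishesInDegree_succ_of_pderiv fun i => ?_
    rw [pderiv_changeSeries]
    refine VanishesInDegree.sum fun p _ => ?_
    rw [smul_eq_C_mul]
    exact (ih (hF.pderiv p)).C_mul _

/-- A functional that depends only on the terms of degree `r` is a combination of the derivatives of
order `r` at the origin. -/
theorem eq_sum_taylor (Λ : MvPowerSeries (Fin n) ℂ →ₗ[ℂ] ℂ) {r : ℕ}
    (hΛ : ∀ F, VanishesInDegree r F → Λ F = 0) (F : MvPowerSeries (Fin n) ℂ) :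
    Λ F = ∑ I : Fin r → Fin n,
      (r.factorial : ℂ)⁻¹ * Λ (yMonomial I) * constantCoeff (iterDeriv r I F) := by
  have h := hΛ _ (vanishesInDegree_taylor r F)
  simp only [← smul_eq_C_mul, map_sub, map_sum, map_smul, smul_eq_mul, sub_eq_zero] at h
  have h0 : (r.factorial : ℂ) ≠ 0 := Nat.cast_ne_zero.2 r.factorial_ne_zero
  rw [← inv_mul_cancel_left₀ h0 (Λ F), h, Finset.mul_sum]
  exact Finset.sum_congr rfl fun _ _ => by ring

theorem changeSeries_yMonomial (A : Matrix (Fin n) (Fin n) ℂ) {r : ℕ} (I : Fin r → Fin n) :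
    changeSeries A (yMonomial I) =
      ∑ K : Fin r → Fin n, (∏ a, A (I a) (K a)) • (yMonomial K : MvPowerSeries (Fin n) ℂ) := by
  simp only [yMonomial, map_prod, changeSeries_X]
  rw [Finset.prod_univ_sum, Fintype.piFinset_univ]
  refine Finset.sum_congr rfl fun K _ => ?_
  rw [Finset.prod_mul_distrib, smul_eq_C_mul, map_prod]

/-! ### Smooth dependence on the base point -/

section Smooth

variable {U : Set (CSpace n)}

theorem contDiffOn_coeff_mul {σ : Type*} {p q : CSpace n → MvPolynomial σ ℂ}
    (hp : ∀ e, ContDiffOn ℝ ∞ (fun z => (p z).coeff e) U)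
    (hq : ∀ e, ContDiffOn ℝ ∞ (fun z => (q z).coeff e) U) (e : σ →₀ ℕ) :
    ContDiffOn ℝ ∞ (fun z => (p z * q z).coeff e) U := by
  classical
  simp only [MvPolynomial.coeff_mul]
  exact ContDiffOn.sum fun x _ => (hp x.1).mul (hq x.2)

theorem contDiffOn_coeff_wickSymbol {B : CSpace n → Matrix (Fin n) (Fin n) ℂ}
    (hB : ∀ i j, ContDiffOn ℝ ∞ (fun z => B z i j) U) (a : Option (Fin n) →₀ ℕ)
    (e : Fin n →₀ ℕ) : ContDiffOn ℝ ∞ (fun z => (wickSymbol (B z) a).coeff e) U := by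
  classical
  have hone : ∀ e, ContDiffOn ℝ ∞ (fun _ : CSpace n => (1 : MvPolynomial (Fin n) ℂ).coeff e) U :=
    fun e => contDiffOn_const
  have hlin : ∀ (j : Fin n) e, ContDiffOn ℝ ∞ (fun z => (∑ p, MvPolynomial.C (B z j p) *
      MvPolynomial.X p : MvPolynomial (Fin n) ℂ).coeff e) U := by
    intro j e
    simp only [MvPolynomial.coeff_sum, MvPolynomial.coeff_C_mul]
    exact ContDiffOn.sum fun p _ => (hB j p).mul contDiffOn_const
  have hpow : ∀ (j : Fin n) (N : ℕ) e, ContDiffOn ℝ ∞ (fun z => ((∑ p, MvPolynomial.C (B z j p) *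
      MvPolynomial.X p : MvPolynomial (Fin n) ℂ) ^ N).coeff e) U := by
    intro j N
    induction N with
    | zero => simpa only [pow_zero] using hone
    | succ N ih =>
      intro e
      simp only [pow_succ]
      exact contDiffOn_coeff_mul ih (hlin j) e
  have hprod : ∀ (s : Finset (Fin n)) e, ContDiffOn ℝ ∞ (fun z => (∏ j ∈ s,
      (∑ p, MvPolynomial.C (B z j p) * MvPolynomial.X p : MvPolynomial (Fin n) ℂ) ^
        a (some j)).coeff e) U := by
    intro s
    induction s using Finset.induction_on with
    | empty => simpa only [Finset.prod_empty] using hone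
    | insert j s hj ih =>
      intro e
      simp only [Finset.prod_insert hj]
      exact contDiffOn_coeff_mul (hpow j _) ih e
  exact hprod Finset.univ e

/-- The supports vary with the point, so the sums are first extended to all exponents of the
relevant degrees. -/
theorem contDiffOn_wickFunctional {B : CSpace n → Matrix (Fin n) (Fin n) ℂ}
    (hB : ∀ i j, ContDiffOn ℝ ∞ (fun z => B z i j) U) {m : ℕ} {A : CSpace n → FiniteWeight n}
    (hA : ∀ z, (A z).IsHomogeneous m)
    (hA' : ∀ a d, ContDiffOn ℝ ∞ (fun z => coeff d ((A z).coeff a)) U)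
    (F : MvPowerSeries (Fin n) ℂ) :
    ContDiffOn ℝ ∞ (fun z => wickFunctional (B z) (A z) F) U := by
  classical
  have h : ∀ z, wickFunctional (B z) (A z) F = ∑ a ∈ exponents (Option (Fin n)) m,
      ∑ e ∈ exponents (Fin n) (∑ j, a (some j)), (wickSymbol (B z) a).coeff e *
        (((∏ i, (e i).factorial : ℕ) : ℂ) * ∑ x ∈ Finset.HasAntidiagonal.antidiagonal e,
          coeff x.1 ((A z).coeff a) * coeff x.2 F) := by
    intro z
    rw [wickFunctional_apply]
    refine (Finset.sum_subset (fun a ha => mem_exponents.2 (degree_of_isHomogeneous (hA z) ha))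
      fun a _ ha => ?_).trans (Finset.sum_congr rfl fun a _ => ?_)
    · rw [MvPolynomial.notMem_support_iff.1 ha, zero_mul, diffOp_zero, map_zero]
    · rw [constantCoeff_diffOp_wickSymbol]
      simp only [coeff_mul]
  simp only [h]
  exact ContDiffOn.sum fun a _ => ContDiffOn.sum fun e _ =>
    (contDiffOn_coeff_wickSymbol hB a e).mul (contDiffOn_const.mul
      (ContDiffOn.sum fun x _ => (hA' a x.1).mul contDiffOn_const))

end Smooth

end Symbol

/-! ### The tensor field of a section of the finite weight bundle -/

section SymbolTensor

open Topology TopologicalSpace SmoothFun MvPowerSeries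

variable {n : ℕ} {X : Type*} [TopologicalSpace X] [ChartedSpace (CSpace n) X]

/-- The tensor `∂_{K_1} ⊗ ⋯ ⊗ ∂_{K_r}` in the standard coordinates of the fibre at `x`. -/
def basisTensor {r : ℕ} (x : X) (K : Fin r → Fin n) :
    ⨂[ℂ]^r (TangentSpace 𝓘(ℂ, CSpace n) x) :=
  PiTensorProduct.tprod ℂ fun a => (Pi.single (K a) 1 : CSpace n)

/-- The tensor field `G = (1/r!) ∑_K σ(α ⊛ y^{K_1} ⋯ y^{K_r}) ∂_{K_1} ⊗ ⋯ ⊗ ∂_{K_r}`, the powers of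
`ħ` being left out. -/
def symbolTensor (g : KahlerMetric n X) (α : X → FiniteWeight n) (r : ℕ) (x : X) :
    ⨂[ℂ]^r (TangentSpace 𝓘(ℂ, CSpace n) x) :=
  ∑ K : Fin r → Fin n,
    ((r.factorial : ℂ)⁻¹ * wickFunctional (omegaInvAt g x) (α x) (yMonomial K)) •
      basisTensor x K

/-- The functional `σ(α ⊛ ·)` at a point of a chart, on series in the fibre variables of that
chart. -/
def chartFunctional (g : KahlerMetric n X) (α : X → FiniteWeight n)
    (φ : OpenPartialHomeomorph X (CSpace n)) (z : CSpace n) : MvPowerSeries (Fin n) ℂ →ₗ[ℂ] ℂ :=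
  wickFunctional (omegaInvAt g (φ.symm z)) (α (φ.symm z)) ∘ₗ
    (changeSeries (coframeMatrix φ z)).toLinearMap

theorem chartFunctional_apply (g : KahlerMetric n X) (α : X → FiniteWeight n)
    (φ : OpenPartialHomeomorph X (CSpace n)) (z : CSpace n) (F : MvPowerSeries (Fin n) ℂ) :
    chartFunctional g α φ z F = wickFunctional (omegaInvAt g (φ.symm z)) (α (φ.symm z))
      (changeSeries (coframeMatrix φ z) F) := rfl

theorem tensorComponents_symbolTensor (g : KahlerMetric n X) (α : X → FiniteWeight n) {r : ℕ}
    (φ : OpenPartialHomeomorph X (CSpace n)) (z : CSpace n) (I : Fin r → Fin n) :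
    tensorComponents (symbolTensor g α r) φ z I =
      (r.factorial : ℂ)⁻¹ * chartFunctional g α φ z (yMonomial I) := by
  have h1 : ∀ K : Fin r → Fin n, PiTensorProduct.lift ((MultilinearMap.mkPiAlgebra ℂ (Fin r)
      ℂ).compLinearMap fun a => (LinearMap.proj (I a) : CSpace n →ₗ[ℂ] ℂ) ∘ₗ
        (mfderiv 𝓘(ℂ, CSpace n) 𝓘(ℂ, CSpace n) φ (φ.symm z)).toLinearMap)
      (basisTensor (φ.symm z) K) = ∏ a, coframeMatrix φ z (I a) (K a) := by
    intro K
    refine (PiTensorProduct.lift.tprod _).trans ?_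
    exact MultilinearMap.mkPiAlgebra_apply (R := ℂ) (ι := Fin r) (A := ℂ) _
  have h2 : chartFunctional g α φ z (yMonomial I) = ∑ K : Fin r → Fin n,
      (∏ a, coframeMatrix φ z (I a) (K a)) *
        wickFunctional (omegaInvAt g (φ.symm z)) (α (φ.symm z)) (yMonomial K) := by
    rw [chartFunctional_apply, changeSeries_yMonomial, map_sum]
    exact Finset.sum_congr rfl fun K _ => by rw [map_smul, smul_eq_mul]
  obtain ⟨T, hT, hT'⟩ : ∃ T : (⨂[ℂ]^r (TangentSpace 𝓘(ℂ, CSpace n) (φ.symm z))) →ₗ[ℂ] ℂ,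
      (∀ G, tensorComponents G φ z I = T (G (φ.symm z))) ∧ ∀ K : Fin r → Fin n,
        T (basisTensor (φ.symm z) K) = ∏ a, coframeMatrix φ z (I a) (K a) := ⟨_, fun _ => rfl, h1⟩
  rw [h2, Finset.mul_sum, hT, symbolTensor, map_sum]
  refine Finset.sum_congr rfl fun K _ => ?_
  rw [map_smul, smul_eq_mul, hT']
  ring

variable [IsManifold 𝓘(ℂ, CSpace n) ω X] (g : KahlerMetric n X)
  {φ : OpenPartialHomeomorph X (CSpace n)} (hφ : φ ∈ atlas (CSpace n) X)
include hφ

theorem omegaInvAt_eq_conj {z : CSpace n} (hz : z ∈ φ.target) :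
    (frameMatrix φ z).map conj * omegaInv g φ z * (frameMatrix φ z).transpose =
      omegaInvAt g (φ.symm z) := by
  rw [omegaInvAt_eq]
  refine (Matrix.inv_eq_left_inv ?_).symm
  have h1 : omegaInv g φ z * omega g φ z = 1 := mul_eq_one_comm.1 (omega_mul_omegaInv g hφ hz)
  rw [omega_eq, ← Matrix.mul_assoc, ← Matrix.mul_assoc, mul_eq_one_comm] at h1
  simpa only [Matrix.mul_assoc] using h1

/-- In a chart the functional is given by the local components of `ω⁻¹` and of the section `α`,
which are smooth. -/
theorem chartFunctional_eq {α : X → FiniteWeight n} {m : ℕ} (hα : ∀ x, (α x).IsHomogeneous m)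
    {z : CSpace n} (hz : z ∈ φ.target) : chartFunctional g α φ z =
      wickFunctional (omegaInv g φ z) (localWeyl α φ z) := by
  refine LinearMap.ext fun F => ?_
  rw [chartFunctional_apply, ← wickFunctional_change (omegaInvAt_eq_conj g hφ hz) (hα _),
    ← changeSeries_mul_apply, coframe_mul_frame hφ hz, changeSeries_one_apply, localWeyl]

theorem contDiffOn_omegaInv (i j : Fin n) :
    ContDiffOn ℝ ∞ (fun z => omegaInv g φ z i j) φ.target := by
  let U : Opens (CSpace n) := ⟨φ.target, φ.open_target⟩
  refine (contDiffOn_toFun ((omegaFun g hφ (U := U) subset_rfl)⁻¹ i j)).congr fun z hz => ?_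
  rw [← map_ev_omegaFun_inv g hφ (U := U) subset_rfl ⟨z, hz⟩]
  exact (toFun_apply ((omegaFun g hφ (U := U) subset_rfl)⁻¹ i j) (⟨z, hz⟩ : U)).symm

omit hφ in
theorem isSmoothTensor_symbolTensor {α : X → FiniteWeight n} {m : ℕ} (hα : IsSmoothWeyl α)
    (hαm : ∀ x, (α x).IsHomogeneous m) (r : ℕ) : IsSmoothTensor (symbolTensor g α r) := by
  intro φ hφ I
  refine ((contDiffOn_const (c := (r.factorial : ℂ)⁻¹)).mul
    (contDiffOn_wickFunctional (contDiffOn_omegaInv g hφ)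
    (fun z => isHomogeneous_changeFiniteWeight (frameMatrix φ z) (hαm (φ.symm z))) (hα φ hφ)
    (yMonomial I))).congr fun z hz => ?_
  rw [tensorComponents_symbolTensor, chartFunctional_eq g hφ hαm hz, localWeyl]

end SymbolTensor

/-! ### The operator `P_{α,k}` -/

section Operator

open Topology TopologicalSpace SmoothFun MvPowerSeries

variable {n : ℕ} {X : Type*} [TopologicalSpace X]
  {L : X → Type*} [TopologicalSpace (TotalSpace ℂ L)]
  [∀ x, AddCommGroup (L x)] [∀ x, Module ℂ (L x)] {k : ℕ}

theorem coordSeries_bfAction (e : Trivialization ℂ (π ℂ L)) [e.IsLinear ℂ]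
    (B : Matrix (Fin n) (Fin n) ℂ) (A : FiniteWeight n) (x : X) (T : SeriesIn n (⨂[ℂ]^k (L x))) :
    coordSeries k e x (bfAction B k A T) = bfActionScalar B k A (coordSeries k e x T) := by
  funext d
  change powCoord k e x (bfAction B k A T d) = bfAction B k A (coordSeries k e x T) d
  simp only [bfAction, Finset.sum_apply, Pi.smul_apply, map_sum, map_smul, seriesDeriv, seriesMul,
    map_nsmul]
  rfl

theorem localSection_smul (c : ℂ) (t : ∀ x, ⨂[ℂ]^k (L x))
    (φ : OpenPartialHomeomorph X (CSpace n))
    (e : Trivialization ℂ (π ℂ L)) [e.IsLinear ℂ] (z : CSpace n) :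
    localSection (c • t) φ e z = c * localSection t φ e z :=
  map_smul (powCoord k e (φ.symm z)) c (t (φ.symm z))

variable [ChartedSpace (CSpace n) X] [∀ x, TopologicalSpace (L x)] [FiberBundle ℂ L]
  [VectorBundle ℂ ℂ L]

theorem localSection_bfOperator (g : KahlerMetric n X) (h : LineMetric n L) {m : ℕ}
    {α : X → FiniteWeight n} (hα : ∀ x, (α x).IsHomogeneous m) (s : ∀ x, ⨂[ℂ]^k (L x))
    (φ : OpenPartialHomeomorph X (CSpace n)) (e : Trivialization ℂ (π ℂ L))
    [MemTrivializationAtlas e] (z : CSpace n) :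
    localSection (bfOperator g h k α s) φ e z = hbar k ^ m *
      wickFunctional (omegaInvAt g (φ.symm z)) (α (φ.symm z))
        (coordSeries k e (φ.symm z) (flatLift g h s (φ.symm z))) := by
  rw [← constantCoeff_bfActionScalar _ _ (hα _), ← coordSeries_bfAction]
  rfl

variable [IsManifold 𝓘(ℂ, CSpace n) ω X]

/-- The symbol of the action on `O`, up to the power of `ħ`, is the pairing of `symbolTensor` with
the Taylor coefficients of `O`. -/
theorem wickFunctional_coordSeries (g : KahlerMetric n X) {l r : ℕ} {α : X → FiniteWeight n}
    (hα : ∀ x, IsBihomogeneous l (l + r) (α x)) {φ : OpenPartialHomeomorph X (CSpace n)}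
    (hφ : φ ∈ atlas (CSpace n) X) (e : Trivialization ℂ (π ℂ L)) [MemTrivializationAtlas e]
    {z : CSpace n} (hz : z ∈ φ.target) (O : ∀ x, SeriesIn n (⨂[ℂ]^k (L x))) :
    wickFunctional (omegaInvAt g (φ.symm z)) (α (φ.symm z))
        (coordSeries k e (φ.symm z) (O (φ.symm z))) =
      ∑ I : Fin r → Fin n, tensorComponents (symbolTensor g α r) φ z I *
        constantCoeff (iterDeriv r I (localFock O φ e z)) := by
  have h1 : coordSeries k e (φ.symm z) (O (φ.symm z)) =
      changeSeries (coframeMatrix φ z) (localFock O φ e z) := by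
    rw [localFock_eq, ← changeSeries_mul_apply, frame_mul_coframe hφ hz, changeSeries_one_apply]
  rw [h1, ← chartFunctional_apply, eq_sum_taylor (r := r) (chartFunctional g α φ z)]
  · exact Finset.sum_congr rfl fun I _ => by rw [tensorComponents_symbolTensor]
  · intro F hF
    rw [chartFunctional_apply]
    exact wickFunctional_eq_zero _ rfl (hα _) (hF.changeSeries _)

theorem isHigherCovDeriv_bfOperator [ContMDiffVectorBundle ω ℂ L 𝓘(ℂ, CSpace n)]
    {g : KahlerMetric n X} {h : LineMetric n L}
    (hL : IsPrequantum g h) {l r : ℕ} {α : X → FiniteWeight n} (hα : IsSmoothWeyl α)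
    (hαlm : ∀ x, IsBihomogeneous l (l + r) (α x)) (hk : 0 < k) {s : ∀ x, ⨂[ℂ]^k (L x)}
    (hs : IsHolomorphicSection n s) :
    IsHigherCovDeriv g h (symbolTensor g α r) s
      ((hbar k ^ (l + r))⁻¹ • bfOperator g h k α s) := by
  intro φ hφ e _ z hz
  obtain ⟨hO, hsymb⟩ := flatLift_spec hL hk hs
  have hαm := fun x => (hαlm x).isHomogeneous
  have hG := isSmoothTensor_symbolTensor g hα hαm r φ hφ
  have h0 : hbar k ^ (l + r) ≠ 0 := pow_ne_zero _ (hbar_ne_zero hk)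
  rw [localSection_smul, localSection_bfOperator g h hαm, inv_mul_cancel_left₀ h0,
    wickFunctional_coordSeries g hαlm hφ e hz.1]
  exact (localCovDeriv_eq hφ e subset_rfl (hO.isParallelOn hφ e hk)
    (fun z _ => by rw [constantCoeff_localFock, hsymb])
    (fun I => (hG I).mono fun w hw => hw.1) hz).symm

end Operator

end BargmannFock

end

theorem mainTheorem6 {n : ℕ} {X : Type*} [TopologicalSpace X] [T2Space X] [CompactSpace X]
    [ChartedSpace (BargmannFock.CSpace n) X]
    [IsManifold 𝓘(ℂ, BargmannFock.CSpace n) ω X]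
    (g : BargmannFock.KahlerMetric n X)
    (L : X → Type*) [TopologicalSpace (TotalSpace ℂ L)]
    [∀ x, AddCommGroup (L x)] [∀ x, Module ℂ (L x)] [∀ x, TopologicalSpace (L x)]
    [FiberBundle ℂ L] [VectorBundle ℂ ℂ L]
    [ContMDiffVectorBundle ω ℂ L 𝓘(ℂ, BargmannFock.CSpace n)]
    (h : BargmannFock.LineMetric n L) (hL : BargmannFock.IsPrequantum g h)
    (l m : ℕ) (hlm : l ≤ m)
    (α : X → BargmannFock.FiniteWeight n) (hα : BargmannFock.IsSmoothWeyl α)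
    (hαlm : ∀ x, BargmannFock.IsBihomogeneous l m (α x)) :
    (∀ k : ℕ, 0 < k → ∀ s : (∀ x, ⨂[ℂ]^k (L x)), BargmannFock.IsHolomorphicSection n s →
      ∃! O : (∀ x, BargmannFock.SeriesIn n (⨂[ℂ]^k (L x))),
        BargmannFock.IsFlat g h O ∧ BargmannFock.symbol O = s) ∧
    ∃ G : (∀ x : X, ⨂[ℂ]^(m - l) (TangentSpace 𝓘(ℂ, BargmannFock.CSpace n) x)),
      BargmannFock.IsSmoothTensor G ∧
      ∀ k : ℕ, 0 < k → ∀ s : (∀ x, ⨂[ℂ]^k (L x)), BargmannFock.IsHolomorphicSection n s →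
        ∃ t : (∀ x, ⨂[ℂ]^k (L x)),
          BargmannFock.IsHigherCovDeriv g h G s t ∧
          BargmannFock.bfOperator g h k α s = (Complex.I / (k : ℂ)) ^ m • t := by
  refine ⟨fun k hk s hs => ?_, ?_⟩
  · obtain ⟨O, hO, hOs⟩ := BargmannFock.exists_isFlat g h hL hk hs
    exact ⟨O, ⟨hO, hOs⟩, fun O' hO' => hO'.1.eq_of_symbol_eq hk hO (hO'.2.trans hOs.symm)⟩
  · refine ⟨BargmannFock.symbolTensor g α (m - l),
      BargmannFock.isSmoothTensor_symbolTensor g hα (fun x => (hαlm x).isHomogeneous) _,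
      fun k hk s hs => ⟨(BargmannFock.hbar k ^ m)⁻¹ • BargmannFock.bfOperator g h k α s, ?_, ?_⟩⟩
    · obtain ⟨r, rfl⟩ := Nat.exists_eq_add_of_le hlm
      rw [Nat.add_sub_cancel_left]
      exact BargmannFock.isHigherCovDeriv_bfOperator hL hα hαlm hk hs
    · exact (smul_inv_smul₀ (pow_ne_zero m (BargmannFock.hbar_ne_zero hk)) _).symm
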